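/- Notation: $D=-i\partial_x$ on $\mathbb R$; $\Pi_+$ is the Szegő projector on $L^2(\mathbb R)$, $\widehat{\Pi_+f}(\xi)=\mathbf 1_{\xi\ge 0}\hat f(\xi)$; $L^2_+(\mathbb R)=\{f\in L^2(\mathbb R):\operatorname{supp}\hat f\subset[0,\infty)\}$ and $H^s_+(\mathbb R)=H^s(\mathbb R)\cap L^2_+(\mathbb R)$, where $\|f\|_{H^s}=\|(1+D^2)^{s/2}f\|_{L^2}$. **Theorem.** There is a function $C_*:[0,\infty)\to(0,\infty)$ with the following property. For every $s>\frac12$ and every $C>0$ there are $C_0>0$ and $\delta_0>0$ (depending only on $s$ and $C$), and for every $M\ge 0$ there is $\varepsilon_0>0$ (depending only on $s,C,M$), such that the following holds for all $0<\delta<\delta_0$, all $0\le\alpha\le\frac12$, all $0<\varepsilon<\varepsilon_0$ and all $W_0\in H^s_+(\mathbb R)$ with $\|W_0\|_{H^{1/2}}\le M$. Let $v\in C(\mathbb R,H^s(\mathbb R))$ be the solution of $$i\partial_t v-|D|v=|v|^2v,\qquad v(0)=\varepsilon W_0,$$ (that is, $v(t)=e^{-i|D|t}\varepsilon W_0-i\int_0^t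 e^{-i|D|(t-\tau)}\big(|v(\tau)|^2v(\tau)\big)\,d\tau$ for all $t\in\mathbb R$), and let $\mathcal W\in C(\mathbb R,H^s_+(\mathbb R))$ be the solution of the Szegő equation $$i\partial_t\mathcal W=\Pi_+(|\mathcal W|^2\mathcal W),\qquad \mathcal W(0)=\varepsilon W_0.$$ Assume that $$\|\mathcal W(t)\|_{H^s}\le C\varepsilon\Big(\log\frac1{\varepsilon^{\delta}}\Big)^{\alpha}\qquad\text{for all }t\in\mathbb R.$$ Then $$\|v(t)-e^{-i|D|t}\mathcal W(t)\|_{H^s}\le C_*(M)\,\varepsilon^{2-C_0\delta}\qquad\text{for all }\ 0\le t\le\frac1{\varepsilon^2}\Big(\log\frac1{\varepsilon^{\delta}}\Big)^{1-2\alpha}.$$ In particular the constant in the error bound depends only on the $H^{1/2}$-norm of $W_0$. -/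

import Mathlib

open MeasureTheory FourierTransform Filter Topology
open scoped ENNReal

noncomputable section

namespace NLWSzego

/-- The space `L²(ℝ)` of complex-valued functions. -/
abbrev L2 : Type := Lp ℂ 2 (volume : Measure ℝ)

/-- The Sobolev norm `‖f‖_{H^s}`, as an extended number.
The Fourier transform of Mathlib is `∫ e^{-2πixξ} f(x) dx`, so that the operator `D = -i∂ₓ` is
multiplication by `2πξ` on the Fourier side. -/
def hsNorm (s : ℝ) (f : L2) : ℝ≥0∞ :=
  (∫⁻ ξ : ℝ, ENNReal.ofReal ((1 + (2 * Real.pi * ξ) ^ 2) ^ s) * ‖(𝓕 f : L2) ξ‖ₑ ^ 2) ^ (1 / 2 : ℝ)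

/-- `f ∈ H^s(ℝ)`, for `s ≥ 0`. -/
def MemHs (s : ℝ) (f : L2) : Prop := hsNorm s f < ∞

/-- `f ∈ H^s_+(ℝ)`: moreover the Fourier transform of `f` is supported in `[0, ∞)`. -/
def MemHsPlus (s : ℝ) (f : L2) : Prop :=
  MemHs s f ∧ ∀ᵐ ξ : ℝ, ξ < 0 → (𝓕 f : L2) ξ = 0

/-- `v ∈ C(ℝ, H^s(ℝ))`. -/
def ContinuousHs (s : ℝ) (v : ℝ → L2) : Prop :=
  (∀ t, MemHs s (v t)) ∧ ∀ t₀, Tendsto (fun t => hsNorm s (v t - v t₀)) (𝓝 t₀) (𝓝 0)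

/-- The Fourier multiplier with bounded symbol `m`. -/
def fourierMul (m : ℝ → ℂ) (hm : MemLp m ∞ volume) (f : L2) : L2 :=
  𝓕⁻ ((hm.toLp m : Lp ℂ ∞ (volume : Measure ℝ)) • (𝓕 f : L2))

theorem memLp_szegoSymbol : MemLp (Set.indicator (Set.Ici (0 : ℝ)) (fun _ => (1 : ℂ))) ∞ volume :=
  (memLp_top_const (1 : ℂ)).indicator measurableSet_Ici

/-- The Szegő projector `Π₊` onto nonnegative frequencies. -/
def szego (f : L2) : L2 :=
  fourierMul (Set.indicator (Set.Ici (0 : ℝ)) (fun _ => (1 : ℂ))) memLp_szegoSymbol f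

theorem memLp_propagatorSymbol (t : ℝ) :
    MemLp (fun ξ : ℝ => Complex.exp (-(Complex.I * (2 * Real.pi * |ξ| : ℝ) * t))) ∞ volume := by
  refine memLp_top_of_bound (by fun_prop) 1 (Eventually.of_forall fun ξ => ?_)
  rw [Complex.norm_exp]
  simp

/-- The linear propagator `e^{-i|D|t}`. -/
def propagator (t : ℝ) (f : L2) : L2 :=
  fourierMul (fun ξ : ℝ => Complex.exp (-(Complex.I * (2 * Real.pi * |ξ| : ℝ) * t)))
    (memLp_propagatorSymbol t) f

open Classical in
/-- The nonlinearity `|f|² f`, for `f ∈ L²(ℝ)` such that `|f|² f ∈ L²(ℝ)`; this holds for every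
`f ∈ H^s(ℝ)` with `s > 1/2`, since such an `f` is bounded. (Otherwise the value is `0`.) -/
def cubic (f : L2) : L2 :=
  if h : MemLp (fun x : ℝ => ((‖f x‖ ^ 2 : ℝ) : ℂ) * f x) 2 volume then h.toLp _ else 0

/-- `v ∈ C(ℝ, H^s)` solves `i ∂ₜ v - |D| v = |v|² v` with `v(0) = v₀`: it satisfies Duhamel's formula
`v(t) = e^{-i|D|t} v₀ - i ∫₀ᵗ e^{-i|D|(t-τ)} (|v(τ)|² v(τ)) dτ`. (The integrand is continuous with
values in `L²(ℝ)` when `s > 1/2`.) -/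
structure IsNLWSolution (s : ℝ) (v₀ : L2) (v : ℝ → L2) : Prop where
  continuousHs : ContinuousHs s v
  duhamel : ∀ t, v t = propagator t v₀ -
    Complex.I • ∫ τ in (0 : ℝ)..t, propagator (t - τ) (cubic (v τ))

/-- `W ∈ C(ℝ, H^s_+)` solves the Szegő equation `i ∂ₜ W = Π₊(|W|² W)` with `W(0) = W₀`, the
derivative in time being taken in `L²(ℝ)`. -/
structure IsSzegoSolution (s : ℝ) (W₀ : L2) (W : ℝ → L2) : Prop where
  continuousHs : ContinuousHs s W
  memHsPlus : ∀ t, MemHsPlus s (W t)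
  differentiable : Differentiable ℝ W
  equation : ∀ t, Complex.I • deriv W t = szego (cubic (W t))
  initial : W 0 = W₀

end NLWSzego

end

noncomputable section

namespace NLWSzego

/-! ### Weights and weighted `L²` estimates for convolutions -/

/-! Pull the wave equation back along the linear flow and compare `e^{i|D|t} v(t)` with the Szegő
solution `W(t)`. Since `W` has only nonnegative frequencies, `e^{-i|D|t}` acts on it as a
translation, and translations commute with `|f|² f`. Conjugating the nonlinearity by the flow
therefore leaves the multiplier `e^{i(|D|-D)t}`. It equals `1` on nonnegative frequencies, which
gives exactly the Szegő nonlinearity, and oscillates as `e^{-2iDt}` on negative ones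
(`propSymbol_cubicHat`). The difference of the two flows is thus driven by a Lipschitz term and by
the time integral of this non-resonant part.

The oscillating integral is of size `ε²`, up to logarithms (`norm_integral_osc_le`,
`norm_osc_szego_le`). Cut the negative frequencies at `κ = ε²` and at a fixed radius `r`. On `[-κ,
0)` use the supremum `S ~ ε³` of the Fourier transform of `|W|² W`: the contribution is `t √κ S ~
ε²`. Below `-κ` integrate by parts in time. Between `-r` and `-κ` the factor `1/ξ` has `L²` norm at
most `κ^{-1/2}`, so the boundary terms cost `S/√κ ~ ε²` and the remaining integral `t S'/√κ ~ ε²`,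
with `S' ~ ε⁵` for the time derivative. Beyond `r` the factor `1/ξ` is bounded and the `H^s` norm is
used; these terms are of order `ε³` up to logarithms and are absorbed by taking `ε` small.

On `[-r, 0)` the weight of `H^s` is at most `2`, and `S`, `S'` are controlled by the `H^{1/2}` norm
of `W` through the product estimates `H^{1/2}·H^{1/2} ⊂ H^{1/4}` and `H^{1/4}·H^{1/2} ⊂ L²`. That
norm stays bounded because mass plus momentum is conserved (`massMom_const`, `energy_half_le`). This
is why the constant in the error sees only `M`.

Finally a Grönwall and continuity argument (`le_exp_of_bootstrap`, `norm_interaction_diff_le`)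
multiplies the error by `exp(c ‖W‖² T)`. With `‖W‖ ≤ Cε L^α` and `T = ε^{-2} L^{1-2α}`, where `L =
log(1/ε^δ)`, the exponent is of order `L`, and `e^{C₀ L} = ε^{-C₀ δ}` is the announced loss. -/

/-- The weight `(1 + (2πξ)²)^σ`. -/
def wt (σ ξ : ℝ) : ℝ≥0∞ := ENNReal.ofReal ((1 + (2 * Real.pi * ξ) ^ 2) ^ σ)

/-- The square of the weighted `L²` norm `‖(1 + (2πξ)²)^{σ/2} a‖`. -/
def energy (σ : ℝ) (a : ℝ → ℂ) : ℝ≥0∞ := ∫⁻ ξ, wt σ ξ * ‖a ξ‖ₑ ^ 2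

/-- The convolution of two complex-valued functions on the line. -/
def conv (a b : ℝ → ℂ) (ξ : ℝ) : ℂ := ∫ η, a η * b (ξ - η)

theorem one_le_jap (ξ : ℝ) : 1 ≤ 1 + (2 * Real.pi * ξ) ^ 2 := by nlinarith [sq_nonneg (2 * Real.pi * ξ)]

theorem jap_pos (ξ : ℝ) : 0 < 1 + (2 * Real.pi * ξ) ^ 2 := by positivity

@[fun_prop]
theorem measurable_wt (σ : ℝ) : Measurable (wt σ) := by unfold wt; fun_prop

theorem wt_mul (σ τ ξ : ℝ) : wt σ ξ * wt τ ξ = wt (σ + τ) ξ := by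
  rw [wt, wt, wt, ← ENNReal.ofReal_mul (by positivity), ← Real.rpow_add (jap_pos ξ)]

theorem wt_sq (σ ξ : ℝ) : wt σ ξ ^ 2 = wt (2 * σ) ξ := by
  rw [sq, wt_mul, two_mul]

@[simp] theorem wt_zero (ξ : ℝ) : wt 0 ξ = 1 := by simp [wt]

@[simp] theorem wt_neg (σ ξ : ℝ) : wt σ (-ξ) = wt σ ξ := by simp [wt]

theorem wt_ne_zero (σ ξ : ℝ) : wt σ ξ ≠ 0 := by
  simp only [wt, ne_eq, ENNReal.ofReal_eq_zero, not_le]; positivity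

theorem wt_ne_top (σ ξ : ℝ) : wt σ ξ ≠ ∞ := ENNReal.ofReal_ne_top

theorem wt_mono {σ τ : ℝ} (h : σ ≤ τ) (ξ : ℝ) : wt σ ξ ≤ wt τ ξ :=
  ENNReal.ofReal_le_ofReal (Real.rpow_le_rpow_of_exponent_le (one_le_jap ξ) h)

theorem energy_mono {σ τ : ℝ} (h : σ ≤ τ) (a : ℝ → ℂ) : energy σ a ≤ energy τ a :=
  lintegral_mono fun ξ => mul_le_mul_left (wt_mono h ξ) _

theorem energy_congr {σ : ℝ} {a b : ℝ → ℂ} (h : a =ᵐ[volume] b) : energy σ a = energy σ b :=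
  lintegral_congr_ae (h.mono fun ξ hξ => by simp only [hξ])

theorem energy_le_of_norm_le {σ : ℝ} {a b : ℝ → ℂ} (h : ∀ᵐ ξ, ‖a ξ‖ ≤ ‖b ξ‖) :
    energy σ a ≤ energy σ b :=
  lintegral_mono_ae (h.mono fun ξ hξ => by
    gcongr
    exact enorm_le_iff_norm_le.2 hξ)

/-- Cauchy-Schwarz for lower integrals. -/
theorem sq_lintegral_mul_le {f g : ℝ → ℝ≥0∞} (hf : AEMeasurable f) (hg : AEMeasurable g) :
    (∫⁻ x, f x * g x) ^ 2 ≤ (∫⁻ x, f x ^ 2) * ∫⁻ x, g x ^ 2 := by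
  have h := ENNReal.lintegral_mul_le_Lp_mul_Lq volume Real.HolderConjugate.two_two hf hg
  calc (∫⁻ x, f x * g x) ^ 2
      ≤ ((∫⁻ x, f x ^ (2 : ℝ)) ^ (1 / 2 : ℝ) * (∫⁻ x, g x ^ (2 : ℝ)) ^ (1 / 2 : ℝ)) ^ 2 := by
        gcongr; exact h
    _ = _ := by
        rw [mul_pow]
        simp only [← ENNReal.rpow_natCast, ← ENNReal.rpow_mul]
        norm_num

theorem lintegral_lintegral_mul_sub {f g : ℝ → ℝ≥0∞} (hf : AEMeasurable f) (hg : AEMeasurable g) :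
    ∫⁻ ξ, ∫⁻ η, f η * g (ξ - η) = (∫⁻ η, f η) * ∫⁻ η, g η := by
  rw [lintegral_lintegral_swap]
  · calc ∫⁻ η, ∫⁻ ξ, f η * g (ξ - η) = ∫⁻ η, f η * ∫⁻ ξ, g ξ := by
          refine lintegral_congr fun η => ?_
          have hg' : AEMeasurable fun ξ => g (ξ - η) := hg.comp_quasiMeasurePreserving
            (measurePreserving_sub_right volume η).quasiMeasurePreserving
          rw [lintegral_const_mul'' _ hg', lintegral_sub_right_eq_self g η]
      _ = _ := lintegral_mul_const'' _ hf
  · have h2 : AEMeasurable (fun p : ℝ × ℝ => g (p.1 - p.2)) (volume.prod volume) :=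
      hg.comp_quasiMeasurePreserving (quasiMeasurePreserving_sub _ _)
    exact hf.comp_snd.mul h2

theorem aemeasurable_comp_sub {g : ℝ → ℝ≥0∞} (hg : AEMeasurable g) (ξ : ℝ) :
    AEMeasurable fun η => g (ξ - η) :=
  hg.comp_quasiMeasurePreserving (Measure.measurePreserving_sub_left volume ξ).quasiMeasurePreserving

/-- Weights and inverse weights are inserted before Cauchy-Schwarz, so that the first factor is a
kernel independent of `f` and `g`. -/
theorem sq_lintegral_mul_sub_le {f g : ℝ → ℝ≥0∞} (hf : AEMeasurable f) (hg : AEMeasurable g)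
    (α β ξ : ℝ) :
    (∫⁻ η, f η * g (ξ - η)) ^ 2 ≤ (∫⁻ η, wt (-α) η * wt (-β) (ξ - η)) *
      ∫⁻ η, (wt α η * f η ^ 2) * (wt β (ξ - η) * g (ξ - η) ^ 2) := by
  have key : ∀ η, f η * g (ξ - η) = (wt (-(α / 2)) η * wt (-(β / 2)) (ξ - η)) *
      ((wt (α / 2) η * f η) * (wt (β / 2) (ξ - η) * g (ξ - η))) := fun η => by
    have h1 : wt (-(α / 2)) η * wt (α / 2) η = 1 := by rw [wt_mul]; simp
    have h2 : wt (-(β / 2)) (ξ - η) * wt (β / 2) (ξ - η) = 1 := by rw [wt_mul]; simp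
    calc f η * g (ξ - η) = (wt (-(α / 2)) η * wt (α / 2) η) *
          (wt (-(β / 2)) (ξ - η) * wt (β / 2) (ξ - η)) * (f η * g (ξ - η)) := by simp [h1, h2]
      _ = _ := by ring
  rw [lintegral_congr key]
  have hg' := aemeasurable_comp_sub hg ξ
  have hm : AEMeasurable fun η => wt (-(α / 2)) η * wt (-(β / 2)) (ξ - η) := by fun_prop
  have hm' : AEMeasurable fun η => (wt (α / 2) η * f η) * (wt (β / 2) (ξ - η) * g (ξ - η)) :=
    ((measurable_wt _).aemeasurable.mul hf).mul
      ((((measurable_wt _).comp (measurable_const.sub measurable_id)).aemeasurable).mul hg')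
  refine (sq_lintegral_mul_le hm hm').trans (le_of_eq ?_)
  congr 1
  · refine lintegral_congr fun η => ?_
    rw [mul_pow, wt_sq, wt_sq]; ring_nf
  · refine lintegral_congr fun η => ?_
    rw [mul_pow, mul_pow, mul_pow, wt_sq, wt_sq]; ring_nf

/-- Once the kernel is bounded uniformly in `ξ`, Tonelli factors the remaining double integral. Each
Sobolev product estimate below thus reduces to bounding one kernel. -/
theorem lintegral_wt_mul_sq_lintegral_le {f g : ℝ → ℝ≥0∞} (hf : AEMeasurable f)
    (hg : AEMeasurable g) {α β γ : ℝ} {K : ℝ≥0∞}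
    (hK : ∀ ξ, wt γ ξ * ∫⁻ η, wt (-α) η * wt (-β) (ξ - η) ≤ K) :
    ∫⁻ ξ, wt γ ξ * (∫⁻ η, f η * g (ξ - η)) ^ 2 ≤
      K * ((∫⁻ η, wt α η * f η ^ 2) * ∫⁻ η, wt β η * g η ^ 2) := by
  have hF : AEMeasurable fun η => wt α η * f η ^ 2 := by fun_prop
  have hG : AEMeasurable fun η => wt β η * g η ^ 2 := by fun_prop
  rw [← lintegral_lintegral_mul_sub hF hG]
  -- For `K = ∞` the bound is trivial unless the product of the two energies vanishes: then `∞ * 0 =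
  -- 0`, and the left side has to be shown to vanish too.
  rcases eq_or_ne K ∞ with rfl | hKt
  · by_cases h0 : ∫⁻ ξ, ∫⁻ η, wt α η * f η ^ 2 * (wt β (ξ - η) * g (ξ - η) ^ 2) = 0
    · rw [h0, mul_zero]
      rw [lintegral_lintegral_mul_sub hF hG, mul_eq_zero] at h0
      refine (lintegral_eq_zero_of_ae_eq_zero (Eventually.of_forall fun ξ => ?_)).le
      have hz : ∫⁻ η, f η * g (ξ - η) = 0 := by
        rcases h0 with h0 | h0
        · rw [lintegral_eq_zero_iff' hF] at h0
          refine lintegral_eq_zero_of_ae_eq_zero (h0.mono fun η hη => ?_)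
          have : f η = 0 := by simpa [wt_ne_zero] using hη
          simp [this]
        · rw [lintegral_eq_zero_iff' hG] at h0
          have h1 := (Measure.measurePreserving_sub_left volume ξ).quasiMeasurePreserving.ae h0
          refine lintegral_eq_zero_of_ae_eq_zero (h1.mono fun η hη => ?_)
          have : g (ξ - η) = 0 := by simpa [wt_ne_zero] using hη
          simp [this]
      simp [hz]
    · simp [ENNReal.top_mul h0]
  rw [← lintegral_const_mul' _ _ hKt]
  refine lintegral_mono fun ξ => ?_
  calc wt γ ξ * (∫⁻ η, f η * g (ξ - η)) ^ 2
      ≤ wt γ ξ * ((∫⁻ η, wt (-α) η * wt (-β) (ξ - η)) *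
        ∫⁻ η, (wt α η * f η ^ 2) * (wt β (ξ - η) * g (ξ - η) ^ 2)) := by
        gcongr; exact sq_lintegral_mul_sub_le hf hg α β ξ
    _ = (wt γ ξ * ∫⁻ η, wt (-α) η * wt (-β) (ξ - η)) *
        ∫⁻ η, (wt α η * f η ^ 2) * (wt β (ξ - η) * g (ξ - η) ^ 2) := by ring
    _ ≤ _ := by gcongr; exact hK ξ

theorem enorm_conv_le (a b : ℝ → ℂ) (ξ : ℝ) : ‖conv a b ξ‖ₑ ≤ ∫⁻ η, ‖a η‖ₑ * ‖b (ξ - η)‖ₑ := by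
  simpa only [enorm_mul, conv] using enorm_integral_le_lintegral_enorm fun η => a η * b (ξ - η)

theorem energy_conv_le {a b : ℝ → ℂ} (ha : AEStronglyMeasurable a) (hb : AEStronglyMeasurable b)
    {α β γ : ℝ} {K : ℝ≥0∞} (hK : ∀ ξ, wt γ ξ * ∫⁻ η, wt (-α) η * wt (-β) (ξ - η) ≤ K) :
    energy γ (conv a b) ≤ K * (energy α a * energy β b) := by
  refine le_trans (lintegral_mono fun ξ => ?_)
    (lintegral_wt_mul_sq_lintegral_le ha.enorm hb.enorm hK)
  gcongr
  exact enorm_conv_le a b ξ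

/-! ### Kernel bounds and the resulting Sobolev product estimates. -/

/-- The integral of the weight `(1 + (2πξ)²)^{-σ}`. -/
def wtInt (σ : ℝ) : ℝ≥0∞ := ∫⁻ ξ, wt (-σ) ξ

theorem wtInt_lt_top {σ : ℝ} (h : 1 / 2 < σ) : wtInt σ < ∞ := by
  have h1 := (integrable_rpow_neg_one_add_norm_sq (E := ℝ) (μ := volume) (r := 2 * σ)
    (by simp; linarith)).comp_mul_left' (R := 2 * Real.pi) (by positivity)
  have h2 := h1.lintegral_lt_top
  refine lt_of_le_of_lt (le_of_eq (lintegral_congr fun ξ => ?_)) h2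
  simp only [wt, Real.norm_eq_abs, sq_abs]
  congr 2
  ring

/-- The larger of `|η|` and `|ξ - η|` is at least `|ξ|/2`; squaring gives the factor `4`. -/
theorem wt_le_add {γ : ℝ} (hγ : 0 ≤ γ) (ξ η : ℝ) :
    wt γ ξ ≤ ENNReal.ofReal (4 ^ γ) * (wt γ η + wt γ (ξ - η)) := by
  rw [wt, wt, wt, ← ENNReal.ofReal_add (by positivity) (by positivity),
    ← ENNReal.ofReal_mul (by positivity)]
  refine ENNReal.ofReal_le_ofReal ?_
  have key : ∀ x y : ℝ, (2 * Real.pi * y) ^ 2 ≤ (2 * Real.pi * x) ^ 2 →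
      (1 + (2 * Real.pi * (x + y)) ^ 2) ^ γ ≤ 4 ^ γ * (1 + (2 * Real.pi * x) ^ 2) ^ γ := by
    intro x y hxy
    rw [← Real.mul_rpow (by positivity) (by positivity)]
    refine Real.rpow_le_rpow (by positivity) ?_ hγ
    nlinarith [sq_nonneg (2 * Real.pi * x - 2 * Real.pi * y)]
  have p1 : 0 ≤ (1 + (2 * Real.pi * η) ^ 2) ^ γ := by positivity
  have p2 : 0 ≤ (1 + (2 * Real.pi * (ξ - η)) ^ 2) ^ γ := by positivity
  have p3 : (0 : ℝ) ≤ 4 ^ γ := by positivity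
  rcases le_total ((2 * Real.pi * (ξ - η)) ^ 2) ((2 * Real.pi * η) ^ 2) with h | h
  · have := key η (ξ - η) h
    rw [add_sub_cancel] at this
    nlinarith [mul_nonneg p3 p2]
  · have := key (ξ - η) η h
    rw [sub_add_cancel] at this
    nlinarith [mul_nonneg p3 p1]

theorem lintegral_wt_sub (σ ξ : ℝ) : ∫⁻ η, wt (-σ) (ξ - η) = wtInt σ :=
  lintegral_sub_left_eq_self (wt (-σ)) ξ

/-- Both weights decrease with the modulus, so both may be evaluated at whichever of `x`, `y` is
smaller in modulus. -/
theorem wt_mul_wt_le {σ τ : ℝ} (hσ : 0 ≤ σ) (hτ : 0 ≤ τ) (x y : ℝ) :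
    wt (-σ) x * wt (-τ) y ≤ wt (-(σ + τ)) x + wt (-(σ + τ)) y := by
  have anti : ∀ {ρ : ℝ}, 0 ≤ ρ → ∀ {u v : ℝ}, (2 * Real.pi * u) ^ 2 ≤ (2 * Real.pi * v) ^ 2 →
      wt (-ρ) v ≤ wt (-ρ) u := fun hρ u v huv =>
    ENNReal.ofReal_le_ofReal (Real.rpow_le_rpow_of_nonpos (jap_pos _) (by linarith) (by linarith))
  rcases le_total ((2 * Real.pi * x) ^ 2) ((2 * Real.pi * y) ^ 2) with h | h
  · refine le_trans ?_ le_self_add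
    rw [neg_add, ← wt_mul]
    gcongr
    exact anti hτ h
  · refine le_trans ?_ le_add_self
    rw [neg_add, ← wt_mul]
    gcongr
    exact anti hσ h

theorem wt_conv_bound_self {s : ℝ} (hs : 0 ≤ s) (ξ : ℝ) :
    wt s ξ * ∫⁻ η, wt (-s) η * wt (-s) (ξ - η) ≤ ENNReal.ofReal (4 ^ s) * (wtInt s + wtInt s) := by
  rw [← lintegral_const_mul' _ _ (wt_ne_top _ _)]
  calc ∫⁻ η, wt s ξ * (wt (-s) η * wt (-s) (ξ - η))
      ≤ ∫⁻ η, ENNReal.ofReal (4 ^ s) * (wt (-s) (ξ - η) + wt (-s) η) := by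
        refine lintegral_mono fun η => ?_
        calc wt s ξ * (wt (-s) η * wt (-s) (ξ - η))
            ≤ (ENNReal.ofReal (4 ^ s) * (wt s η + wt s (ξ - η))) *
              (wt (-s) η * wt (-s) (ξ - η)) := by gcongr; exact wt_le_add hs ξ η
          _ = ENNReal.ofReal (4 ^ s) * ((wt s η * wt (-s) η) * wt (-s) (ξ - η) +
              (wt s (ξ - η) * wt (-s) (ξ - η)) * wt (-s) η) := by ring
          _ = _ := by rw [wt_mul, wt_mul]; simp
    _ = _ := by
        rw [lintegral_const_mul' _ _ ENNReal.ofReal_ne_top, lintegral_add_right _ (by fun_prop),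
          lintegral_wt_sub]; rfl

theorem wt_conv_bound_quarter_half (ξ : ℝ) :
    ∫⁻ η, wt (-(1 / 4)) η * wt (-(1 / 2)) (ξ - η) ≤ wtInt (3 / 4) + wtInt (3 / 4) := by
  calc ∫⁻ η, wt (-(1 / 4)) η * wt (-(1 / 2)) (ξ - η)
      ≤ ∫⁻ η, (wt (-(3 / 4)) η + wt (-(3 / 4)) (ξ - η)) := by
        refine lintegral_mono fun η => ?_
        refine (wt_mul_wt_le (by norm_num) (by norm_num) _ _).trans (le_of_eq ?_)
        norm_num
    _ = _ := by rw [lintegral_add_left (by fun_prop), lintegral_wt_sub]; rfl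

/-- `H^{1/2}` is not an algebra. Asking only for `H^{1/4}` leaves total decay `1/2 + 1/2 - 1/4 = 3/4
> 1/2`, which is integrable. -/
theorem wt_conv_bound_half_half (ξ : ℝ) :
    wt (1 / 4) ξ * ∫⁻ η, wt (-(1 / 2)) η * wt (-(1 / 2)) (ξ - η) ≤
      ENNReal.ofReal (4 ^ (1 / 4 : ℝ)) * (2 * (wtInt (3 / 4) + wtInt (3 / 4))) := by
  rw [← lintegral_const_mul' _ _ (wt_ne_top _ _)]
  have hsymm : ∫⁻ η, wt (-(1 / 2)) η * wt (-(1 / 4)) (ξ - η) =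
      ∫⁻ η, wt (-(1 / 4)) η * wt (-(1 / 2)) (ξ - η) := by
    rw [← lintegral_sub_left_eq_self (fun η => wt (-(1 / 2)) η * wt (-(1 / 4)) (ξ - η)) ξ]
    simp [mul_comm]
  calc ∫⁻ η, wt (1 / 4) ξ * (wt (-(1 / 2)) η * wt (-(1 / 2)) (ξ - η))
      ≤ ∫⁻ η, ENNReal.ofReal (4 ^ (1 / 4 : ℝ)) * (wt (-(1 / 4)) η * wt (-(1 / 2)) (ξ - η) +
          wt (-(1 / 2)) η * wt (-(1 / 4)) (ξ - η)) := by
        refine lintegral_mono fun η => ?_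
        calc wt (1 / 4) ξ * (wt (-(1 / 2)) η * wt (-(1 / 2)) (ξ - η))
            ≤ (ENNReal.ofReal (4 ^ (1 / 4 : ℝ)) * (wt (1 / 4) η + wt (1 / 4) (ξ - η))) *
              (wt (-(1 / 2)) η * wt (-(1 / 2)) (ξ - η)) := by
              gcongr; exact wt_le_add (by norm_num) ξ η
          _ = ENNReal.ofReal (4 ^ (1 / 4 : ℝ)) *
              ((wt (1 / 4) η * wt (-(1 / 2)) η) * wt (-(1 / 2)) (ξ - η) +
              wt (-(1 / 2)) η * (wt (1 / 4) (ξ - η) * wt (-(1 / 2)) (ξ - η))) := by ring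
          _ = _ := by rw [wt_mul, wt_mul]; norm_num
    _ = ENNReal.ofReal (4 ^ (1 / 4 : ℝ)) *
          (2 * ∫⁻ η, wt (-(1 / 4)) η * wt (-(1 / 2)) (ξ - η)) := by
        rw [lintegral_const_mul' _ _ ENNReal.ofReal_ne_top, lintegral_add_left (by fun_prop),
          hsymm, two_mul]
    _ ≤ _ := by gcongr; exact wt_conv_bound_quarter_half ξ

/-- The constant in the bilinear estimates below the critical regularity. -/
def convConst : ℝ≥0∞ :=
  ENNReal.ofReal (4 ^ (1 / 4 : ℝ)) * (2 * (wtInt (3 / 4) + wtInt (3 / 4)))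

theorem wtInt_add_self_lt_top {σ : ℝ} (h : 1 / 2 < σ) : wtInt σ + wtInt σ < ∞ :=
  ENNReal.add_lt_top.2 ⟨wtInt_lt_top h, wtInt_lt_top h⟩

theorem convConst_lt_top : convConst < ∞ :=
  ENNReal.mul_lt_top ENNReal.ofReal_lt_top
    (ENNReal.mul_lt_top (by simp) (wtInt_add_self_lt_top (by norm_num)))

theorem energy_conv_half_half {a b : ℝ → ℂ} (ha : AEStronglyMeasurable a)
    (hb : AEStronglyMeasurable b) :
    energy (1 / 4) (conv a b) ≤ convConst * (energy (1 / 2) a * energy (1 / 2) b) :=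
  energy_conv_le ha hb wt_conv_bound_half_half

/-- Together with the previous estimate this places a cubic expression in `L²` at the sole cost of
`H^{1/2}` norms. -/
theorem energy_conv_quarter_half {a b : ℝ → ℂ} (ha : AEStronglyMeasurable a)
    (hb : AEStronglyMeasurable b) :
    energy 0 (conv a b) ≤ convConst * (energy (1 / 4) a * energy (1 / 2) b) := by
  refine energy_conv_le ha hb fun ξ => ?_
  rw [wt_zero, one_mul]
  refine (wt_conv_bound_quarter_half ξ).trans ?_
  have h4 : (1 : ℝ≥0∞) ≤ ENNReal.ofReal (4 ^ (1 / 4 : ℝ)) :=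
    ENNReal.one_le_ofReal.2 (Real.one_le_rpow (by norm_num) (by norm_num))
  calc wtInt (3 / 4) + wtInt (3 / 4) = 1 * (1 * (wtInt (3 / 4) + wtInt (3 / 4))) := by simp
    _ ≤ _ := by unfold convConst; gcongr; norm_num

/-- A pointwise bound on the Fourier side: this is what is integrated over the small frequencies,
where nothing is gained from oscillation. -/
theorem sq_enorm_conv_le {a b : ℝ → ℂ} (ha : AEStronglyMeasurable a)
    (hb : AEStronglyMeasurable b) (ξ : ℝ) : ‖conv a b ξ‖ₑ ^ 2 ≤ energy 0 a * energy 0 b := by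
  calc ‖conv a b ξ‖ₑ ^ 2 ≤ (∫⁻ η, ‖a η‖ₑ * ‖b (ξ - η)‖ₑ) ^ 2 := by
        gcongr; exact enorm_conv_le a b ξ
    _ ≤ (∫⁻ η, ‖a η‖ₑ ^ 2) * ∫⁻ η, ‖b (ξ - η)‖ₑ ^ 2 :=
        sq_lintegral_mul_le ha.enorm (aemeasurable_comp_sub hb.enorm ξ)
    _ = _ := by
        rw [lintegral_sub_left_eq_self (fun η => ‖b η‖ₑ ^ 2) ξ]
        simp [energy]

/-! ### The space `H^s` on the Fourier side -/

/-- The measure `(1 + (2πξ)²)^s dξ`. -/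
def wtMeasure (s : ℝ) : Measure ℝ := volume.withDensity (wt s)

/-- The space of Fourier transforms of elements of `H^s(ℝ)`. -/
abbrev HsHat (s : ℝ) : Type := Lp ℂ 2 (wtMeasure s)

theorem wtMeasure_ac (s : ℝ) : wtMeasure s ≪ volume := withDensity_absolutelyContinuous _ _

theorem ac_wtMeasure (s : ℝ) : volume ≪ wtMeasure s :=
  withDensity_absolutelyContinuous' (by fun_prop) (Eventually.of_forall (wt_ne_zero s))

theorem ae_wtMeasure (s : ℝ) : ae (wtMeasure s) = ae volume :=
  le_antisymm (wtMeasure_ac s).ae_le (ac_wtMeasure s).ae_le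

theorem lintegral_wtMeasure (s : ℝ) (f : ℝ → ℝ≥0∞) :
    ∫⁻ ξ, f ξ ∂(wtMeasure s) = ∫⁻ ξ, wt s ξ * f ξ := by
  rw [wtMeasure, lintegral_withDensity_eq_lintegral_mul_non_measurable _ (measurable_wt s)
    (Eventually.of_forall fun ξ => (wt_ne_top s ξ).lt_top)]
  rfl

theorem eLpNorm_wtMeasure_sq (s : ℝ) (f : ℝ → ℂ) :
    eLpNorm f 2 (wtMeasure s) ^ 2 = energy s f := by
  rw [eLpNorm_eq_lintegral_rpow_enorm_toReal (by norm_num) (by norm_num), energy,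
    ← lintegral_wtMeasure, ← ENNReal.rpow_natCast, ← ENNReal.rpow_mul]
  norm_num

theorem HsHat.aesm {s : ℝ} (a : HsHat s) : AEStronglyMeasurable a volume :=
  (Lp.aestronglyMeasurable a).mono_ac (ac_wtMeasure s)

theorem HsHat.enorm_sq {s : ℝ} (a : HsHat s) : ‖a‖ₑ ^ 2 = energy s a := by
  rw [Lp.enorm_def, eLpNorm_wtMeasure_sq]

theorem HsHat.energy_lt_top {s : ℝ} (a : HsHat s) : energy s a < ∞ := by
  rw [← a.enorm_sq]; simp

theorem memLp_wtMeasure {s : ℝ} {f : ℝ → ℂ} (hf : AEStronglyMeasurable f)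
    (h : energy s f < ∞) : MemLp f 2 (wtMeasure s) := by
  refine ⟨hf.mono_ac (wtMeasure_ac s), ?_⟩
  rw [← eLpNorm_wtMeasure_sq] at h
  exact (ENNReal.pow_lt_top_iff.1 h).resolve_right (by norm_num)

/-- The element of `HsHat s` represented by a function of finite energy. -/
def HsHat.mk {s : ℝ} (f : ℝ → ℂ) (hf : AEStronglyMeasurable f) (h : energy s f < ∞) : HsHat s :=
  (memLp_wtMeasure hf h).toLp f

theorem HsHat.coe_mk {s : ℝ} {f : ℝ → ℂ} (hf : AEStronglyMeasurable f) (h : energy s f < ∞) :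
    (HsHat.mk f hf h : HsHat s) =ᵐ[volume] f := by
  have := (memLp_wtMeasure hf h).coeFn_toLp
  rwa [EventuallyEq, ae_wtMeasure] at this

theorem HsHat.ext {s : ℝ} {a b : HsHat s} (h : a =ᵐ[volume] b) : a = b :=
  Lp.ext (by rwa [EventuallyEq, ae_wtMeasure])

theorem HsHat.coe_add {s : ℝ} (a b : HsHat s) : (a + b : HsHat s) =ᵐ[volume] fun ξ => a ξ + b ξ := by
  have := Lp.coeFn_add a b
  rwa [EventuallyEq, ae_wtMeasure] at this

theorem HsHat.coe_sub {s : ℝ} (a b : HsHat s) : (a - b : HsHat s) =ᵐ[volume] fun ξ => a ξ - b ξ := by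
  have := Lp.coeFn_sub a b
  rwa [EventuallyEq, ae_wtMeasure] at this

theorem HsHat.coe_smul {s : ℝ} (c : ℂ) (a : HsHat s) :
    (c • a : HsHat s) =ᵐ[volume] fun ξ => c * a ξ := by
  have := Lp.coeFn_smul c a
  rwa [EventuallyEq, ae_wtMeasure] at this

theorem HsHat.coe_real_smul {s : ℝ} (c : ℝ) (a : HsHat s) :
    (c • a : HsHat s) =ᵐ[volume] fun ξ => c * a ξ := by
  have := Lp.coeFn_smul c a
  rw [EventuallyEq, ae_wtMeasure] at this
  filter_upwards [this] with ξ h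
  simpa using h

theorem enorm_le_of_sq_le {E F : Type*} [SeminormedAddCommGroup E] [SeminormedAddCommGroup F]
    {a : E} {b : F} {K : ℝ} (hK : 0 ≤ K) (h : ‖a‖ₑ ^ 2 ≤ ENNReal.ofReal (K ^ 2) * ‖b‖ₑ ^ 2) :
    ‖a‖ ≤ K * ‖b‖ := by
  rw [← ofReal_norm, ← ofReal_norm, ← ENNReal.ofReal_pow (norm_nonneg _),
    ← ENNReal.ofReal_pow (norm_nonneg _), ← ENNReal.ofReal_mul (by positivity),
    ENNReal.ofReal_le_ofReal_iff (by positivity), ← mul_pow] at h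
  exact le_of_sq_le_sq h (by positivity)

/-- Bounded measurable Fourier symbols. -/
structure Symbol where
  /-- the underlying function -/
  toFun : ℝ → ℂ
  meas : Measurable toFun
  bound : ∃ K : ℝ, ∀ ξ, ‖toFun ξ‖ ≤ K

theorem energy_mul_le {σ K : ℝ} {m a : ℝ → ℂ} (h : ∀ᵐ ξ, ‖m ξ‖ ≤ K) :
    energy σ (fun ξ => m ξ * a ξ) ≤ ENNReal.ofReal (K ^ 2) * energy σ a := by
  rw [energy, energy, ← lintegral_const_mul' _ _ ENNReal.ofReal_ne_top]
  refine lintegral_mono_ae (h.mono fun ξ hξ => ?_)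
  have hK : 0 ≤ K := (norm_nonneg _).trans hξ
  rw [enorm_mul, mul_pow, mul_left_comm, ENNReal.ofReal_pow hK]
  gcongr
  rw [← ofReal_norm]
  exact ENNReal.ofReal_le_ofReal hξ

theorem Symbol.energy_lt_top {s : ℝ} (m : Symbol) (a : HsHat s) :
    energy s (fun ξ => m.toFun ξ * a ξ) < ∞ :=
  m.bound.elim fun _ hK => (energy_mul_le (Eventually.of_forall hK)).trans_lt
    (ENNReal.mul_lt_top ENNReal.ofReal_lt_top a.energy_lt_top)

theorem Symbol.aesm {s : ℝ} (m : Symbol) (a : HsHat s) :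
    AEStronglyMeasurable (fun ξ => m.toFun ξ * a ξ) volume :=
  m.meas.aestronglyMeasurable.mul a.aesm

/-- The Fourier multiplier with symbol `m`. -/
def Symbol.op {s : ℝ} (m : Symbol) : HsHat s →L[ℂ] HsHat s :=
  have hfin : ∀ a : HsHat s, energy s (fun ξ => m.toFun ξ * a ξ) < ∞ := m.energy_lt_top
  have hm : ∀ a : HsHat s, AEStronglyMeasurable (fun ξ => m.toFun ξ * a ξ) volume := m.aesm
  LinearMap.mkContinuousOfExistsBound
    { toFun := fun a => HsHat.mk (fun ξ => m.toFun ξ * a ξ) (hm a) (hfin a)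
      map_add' := fun a b => HsHat.ext (by
        filter_upwards [HsHat.coe_mk (hm a) (hfin a), HsHat.coe_mk (hm b) (hfin b),
          HsHat.coe_mk (hm (a + b)) (hfin (a + b)), HsHat.coe_add a b,
          HsHat.coe_add (HsHat.mk _ (hm a) (hfin a)) (HsHat.mk _ (hm b) (hfin b))]
          with ξ h1 h2 h3 h4 h5
        rw [h3, h5, h1, h2, h4, mul_add])
      map_smul' := fun c a => HsHat.ext (by
        filter_upwards [HsHat.coe_mk (hm a) (hfin a),
          HsHat.coe_mk (hm (c • a)) (hfin (c • a)), HsHat.coe_smul c a,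
          HsHat.coe_smul c (HsHat.mk _ (hm a) (hfin a))] with ξ h1 h2 h3 h4
        rw [h2, RingHom.id_apply, h4, h1, h3]; ring) }
    (m.bound.elim fun K hK => ⟨|K|, fun a => enorm_le_of_sq_le (abs_nonneg K) (by
      rw [HsHat.enorm_sq, HsHat.enorm_sq, sq_abs]
      exact (energy_congr (HsHat.coe_mk (hm a) (hfin a))).trans_le
        (energy_mul_le (Eventually.of_forall hK)))⟩)

theorem Symbol.coe_op {s : ℝ} (m : Symbol) (a : HsHat s) :
    m.op a =ᵐ[volume] fun ξ => m.toFun ξ * a ξ :=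
  HsHat.coe_mk (m.aesm a) (m.energy_lt_top a)

theorem Symbol.norm_op_le {s : ℝ} (m : Symbol) {K : ℝ} (hK : 0 ≤ K) (h : ∀ ξ, ‖m.toFun ξ‖ ≤ K)
    (a : HsHat s) : ‖m.op a‖ ≤ K * ‖a‖ := by
  refine enorm_le_of_sq_le hK ?_
  rw [HsHat.enorm_sq, HsHat.enorm_sq, energy_congr (m.coe_op a)]
  exact energy_mul_le (Eventually.of_forall h)

/-! ### Convolution as a continuous bilinear map -/

section Conv

variable {s : ℝ}

/-- Cauchy-Schwarz against the weight of exponent `-s`, integrable exactly because `s > 1/2`.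
Integrability of the Fourier transform makes the inversion integral and the convolution theorem
available pointwise. -/
theorem integrable_of_energy {s : ℝ} (hs : 1 / 2 < s) {f : ℝ → ℂ} (hf : AEStronglyMeasurable f)
    (h : energy s f < ∞) : Integrable f := by
  refine ⟨hf, ?_⟩
  have key : ∀ ξ, ‖f ξ‖ₑ = wt (-(s / 2)) ξ * (wt (s / 2) ξ * ‖f ξ‖ₑ) := fun ξ => by
    rw [← mul_assoc, wt_mul]; simp
  have h1 := sq_lintegral_mul_le (measurable_wt (-(s / 2))).aemeasurable
    ((measurable_wt (s / 2)).aemeasurable.mul hf.enorm)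
  simp only [Pi.mul_apply, mul_pow, wt_sq, ← key] at h1
  have h2 : ∀ ξ, wt (2 * -(s / 2)) ξ = wt (-s) ξ := fun ξ => by ring_nf
  have h3 : ∀ ξ, wt (2 * (s / 2)) ξ = wt s ξ := fun ξ => by ring_nf
  simp only [h2, h3] at h1
  exact (ENNReal.pow_lt_top_iff.1 (h1.trans_lt (ENNReal.mul_lt_top (wtInt_lt_top hs) h))).resolve_right
    (by norm_num)

theorem memLp_two_of_energy {s : ℝ} (hs : 0 ≤ s) {f : ℝ → ℂ} (hf : AEStronglyMeasurable f)
    (h : energy s f < ∞) : MemLp f 2 volume := by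
  refine ⟨hf, ?_⟩
  have h0 : eLpNorm f 2 volume ^ 2 = energy 0 f := by
    rw [eLpNorm_eq_lintegral_rpow_enorm_toReal (by norm_num) (by norm_num), energy,
      ← ENNReal.rpow_natCast, ← ENNReal.rpow_mul]
    norm_num
  have := h0.trans_lt ((energy_mono hs f).trans_lt h)
  exact (ENNReal.pow_lt_top_iff.1 this).resolve_right (by norm_num)

theorem integrable_conv_integrand {a b : ℝ → ℂ} (ha : MemLp a 2 volume) (hb : MemLp b 2 volume)
    (ξ : ℝ) : Integrable fun η => a η * b (ξ - η) :=
  MemLp.integrable_mul ha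
    (hb.comp_measurePreserving (Measure.measurePreserving_sub_left volume ξ))

theorem conv_congr {a a' b b' : ℝ → ℂ} (ha : a =ᵐ[volume] a') (hb : b =ᵐ[volume] b') :
    conv a b = conv a' b' := by
  funext ξ
  refine integral_congr_ae ?_
  filter_upwards [ha, (Measure.measurePreserving_sub_left volume ξ).quasiMeasurePreserving.ae hb]
    with η h1 h2
  rw [h1, h2]

theorem conv_eq_convolution (a b : ℝ → ℂ) :
    conv a b = MeasureTheory.convolution a b (ContinuousLinearMap.mul ℂ ℂ) volume := rfl

theorem conv_comm (a b : ℝ → ℂ) : conv a b = conv b a := by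
  funext ξ
  rw [conv, ← integral_sub_left_eq_self _ volume ξ]
  simp [conv, mul_comm]

theorem integrable_conv {a b : ℝ → ℂ} (ha : Integrable a) (hb : Integrable b) :
    Integrable (conv a b) :=
  ha.integrable_convolution (ContinuousLinearMap.mul ℂ ℂ) hb

variable [hs : Fact (1 / 2 < s)]

theorem HsHat.integrable (a : HsHat s) : Integrable a volume :=
  integrable_of_energy hs.out a.aesm a.energy_lt_top

theorem HsHat.memLp (a : HsHat s) : MemLp a 2 volume :=
  memLp_two_of_energy (by linarith [hs.out]) a.aesm a.energy_lt_top

/-- The constant in the algebra property of `H^s`, `s > 1/2`. -/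
def algConst (s : ℝ) : ℝ≥0∞ := ENNReal.ofReal (4 ^ s) * (wtInt s + wtInt s)

theorem algConst_lt_top : algConst s < ∞ :=
  ENNReal.mul_lt_top ENNReal.ofReal_lt_top (wtInt_add_self_lt_top hs.out)

theorem energy_conv_self {a b : ℝ → ℂ} (ha : AEStronglyMeasurable a)
    (hb : AEStronglyMeasurable b) :
    energy s (conv a b) ≤ algConst s * (energy s a * energy s b) :=
  energy_conv_le ha hb (wt_conv_bound_self (by linarith [hs.out]))

/-- Convolution of elements of `HsHat s`, that is, multiplication in `H^s`. -/
def HsHat.convMk (a b : HsHat s) : HsHat s :=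
  HsHat.mk (conv a b) (integrable_conv a.integrable b.integrable).aestronglyMeasurable
    ((energy_conv_self a.aesm b.aesm).trans_lt (ENNReal.mul_lt_top algConst_lt_top
      (ENNReal.mul_lt_top a.energy_lt_top b.energy_lt_top)))

theorem HsHat.coe_convMk (a b : HsHat s) : a.convMk b =ᵐ[volume] conv a b := HsHat.coe_mk _ _

theorem HsHat.convMk_comm (a b : HsHat s) : a.convMk b = b.convMk a :=
  HsHat.ext ((a.coe_convMk b).trans (by rw [conv_comm]; exact (b.coe_convMk a).symm))

theorem HsHat.convMk_add (a b c : HsHat s) : a.convMk (b + c) = a.convMk b + a.convMk c := by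
  refine HsHat.ext ?_
  filter_upwards [a.coe_convMk (b + c), HsHat.coe_add (a.convMk b) (a.convMk c), a.coe_convMk b,
    a.coe_convMk c] with ξ h1 h2 h3 h4
  rw [h1, h2, h3, h4, conv_congr (ae_eq_refl a) (HsHat.coe_add b c), conv, conv, conv,
    ← integral_add (integrable_conv_integrand a.memLp b.memLp ξ)
      (integrable_conv_integrand a.memLp c.memLp ξ)]
  simp only [mul_add]

theorem HsHat.convMk_smul (r : ℂ) (a b : HsHat s) : a.convMk (r • b) = r • a.convMk b := by
  refine HsHat.ext ?_
  filter_upwards [a.coe_convMk (r • b), HsHat.coe_smul r (a.convMk b), a.coe_convMk b]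
    with ξ h1 h2 h3
  rw [h1, h2, h3, conv_congr (ae_eq_refl a) (HsHat.coe_smul r b), conv, conv, ← integral_const_mul]
  simp only [mul_left_comm]

theorem HsHat.norm_convMk_le (a b : HsHat s) :
    ‖a.convMk b‖ ≤ Real.sqrt (algConst s).toReal * ‖a‖ * ‖b‖ := by
  have h : ‖a.convMk b‖ₑ ^ 2 ≤
      ENNReal.ofReal ((Real.sqrt (algConst s).toReal * ‖a‖) ^ 2) * ‖b‖ₑ ^ 2 := by
    rw [HsHat.enorm_sq, energy_congr (a.coe_convMk b), mul_pow, Real.sq_sqrt ENNReal.toReal_nonneg,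
      ENNReal.ofReal_mul ENNReal.toReal_nonneg, ENNReal.ofReal_toReal algConst_lt_top.ne,
      ENNReal.ofReal_pow (norm_nonneg _), ofReal_norm, HsHat.enorm_sq, HsHat.enorm_sq, mul_assoc]
    exact energy_conv_self a.aesm b.aesm
  exact enorm_le_of_sq_le (by positivity) h

/-- Convolution as a continuous bilinear map. -/
def convL : HsHat s →L[ℂ] HsHat s →L[ℂ] HsHat s :=
  LinearMap.mkContinuous₂
    (LinearMap.mk₂ ℂ HsHat.convMk
      (fun a b c => by
        rw [HsHat.convMk_comm, HsHat.convMk_add, HsHat.convMk_comm c, HsHat.convMk_comm c])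
      (fun r a b => by rw [HsHat.convMk_comm, HsHat.convMk_smul, HsHat.convMk_comm b])
      HsHat.convMk_add HsHat.convMk_smul)
    (Real.sqrt (algConst s).toReal) HsHat.norm_convMk_le

theorem coe_convL (a b : HsHat s) : convL a b =ᵐ[volume] conv a b := a.coe_convMk b

theorem convL_comm (a b : HsHat s) : convL a b = convL b a := a.convMk_comm b

end Conv

/-! ### Complex conjugation and the cubic nonlinearity -/

/-- The Fourier transform of the conjugate of the function with Fourier transform `a`. -/
def starHat (a : ℝ → ℂ) (ξ : ℝ) : ℂ := starRingEnd ℂ (a (-ξ))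

theorem ae_neg {p : ℝ → Prop} (h : ∀ᵐ ξ : ℝ, p ξ) : ∀ᵐ ξ : ℝ, p (-ξ) :=
  (Measure.measurePreserving_neg (volume : Measure ℝ)).quasiMeasurePreserving.ae h

theorem starHat_congr {a b : ℝ → ℂ} (h : a =ᵐ[volume] b) : starHat a =ᵐ[volume] starHat b :=
  (ae_neg h).mono fun ξ hξ => by simp only [starHat, hξ]

theorem aesm_starHat {a : ℝ → ℂ} (ha : AEStronglyMeasurable a) : AEStronglyMeasurable (starHat a) :=
  Complex.continuous_conj.comp_aestronglyMeasurable
    (ha.comp_quasiMeasurePreserving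
      (Measure.measurePreserving_neg (volume : Measure ℝ)).quasiMeasurePreserving)

theorem energy_starHat (σ : ℝ) (a : ℝ → ℂ) : energy σ (starHat a) = energy σ a := by
  rw [energy, energy, ← lintegral_neg_eq_self]
  simp [starHat]

theorem energy_starHat_lt_top {s : ℝ} (a : HsHat s) : energy s (starHat a) < ∞ := by
  rw [energy_starHat]; exact a.energy_lt_top

/-- Complex conjugation, on the Fourier side, as an `ℝ`-linear map. -/
def starL {s : ℝ} : HsHat s →L[ℝ] HsHat s :=
  have hfin : ∀ a : HsHat s, energy s (starHat a) < ∞ := energy_starHat_lt_top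
  LinearMap.mkContinuous
    { toFun := fun a => HsHat.mk (starHat a) (aesm_starHat a.aesm) (hfin a)
      map_add' := fun a b => HsHat.ext (by
        filter_upwards [HsHat.coe_mk (aesm_starHat a.aesm) (hfin a),
          HsHat.coe_mk (aesm_starHat b.aesm) (hfin b),
          HsHat.coe_mk (aesm_starHat (a + b).aesm) (hfin (a + b)),
          starHat_congr (HsHat.coe_add a b),
          HsHat.coe_add (HsHat.mk _ (aesm_starHat a.aesm) (hfin a))
            (HsHat.mk _ (aesm_starHat b.aesm) (hfin b))] with ξ h1 h2 h3 h4 h5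
        rw [h3, h5, h1, h2, h4]
        simp [starHat])
      map_smul' := fun c a => HsHat.ext (by
        filter_upwards [HsHat.coe_mk (aesm_starHat a.aesm) (hfin a),
          HsHat.coe_mk (aesm_starHat (c • a).aesm) (hfin (c • a)),
          starHat_congr (HsHat.coe_real_smul c a),
          HsHat.coe_real_smul c (HsHat.mk _ (aesm_starHat a.aesm) (hfin a))] with ξ h1 h2 h3 h4
        rw [h2, RingHom.id_apply, h4, h1, h3]
        simp [starHat]) } 1
    (fun a => enorm_le_of_sq_le zero_le_one (by
      rw [HsHat.enorm_sq, HsHat.enorm_sq]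
      refine (energy_congr (HsHat.coe_mk (aesm_starHat a.aesm) (hfin a))).trans_le ?_
      rw [energy_starHat]; simp))

theorem coe_starL {s : ℝ} (a : HsHat s) : starL a =ᵐ[volume] starHat a :=
  HsHat.coe_mk (aesm_starHat a.aesm) (energy_starHat_lt_top a)

theorem norm_starL {s : ℝ} (a : HsHat s) : ‖starL a‖ = ‖a‖ := by
  have h : ‖starL a‖ₑ ^ 2 = ‖a‖ₑ ^ 2 := by
    rw [HsHat.enorm_sq, HsHat.enorm_sq, energy_congr (coe_starL a), energy_starHat]
  refine le_antisymm ?_ ?_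
  · simpa using enorm_le_of_sq_le zero_le_one (by simpa using h.le)
  · simpa using enorm_le_of_sq_le zero_le_one (by simpa using h.ge)

/-- The nonlinearity `|f|² f` on the Fourier side. -/
def cubicHat {s : ℝ} [Fact (1 / 2 < s)] (a : HsHat s) : HsHat s := convL (convL a (starL a)) a

section

/-! ### Inverse Fourier transforms of elements of `HsHat s` -/

/-- The inverse Fourier transform on `L²` is given by the Fourier integral for integrable
functions. -/
theorem coe_fourierInv_ae_eq (f : L2) (hf : Integrable f) :
    (𝓕⁻ f : L2) =ᵐ[volume] fun x => 𝓕 (f : ℝ → ℂ) (-x) := by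
  have hcont : Continuous (𝓕 (f : ℝ → ℂ)) :=
    VectorFourier.fourierIntegral_continuous Real.continuous_fourierChar continuous_inner hf
  refine ae_eq_of_integral_contDiff_smul_eq ((Lp.memLp _).locallyIntegrable (by norm_num))
    (hcont.comp continuous_neg).locallyIntegrable ?_
  intro g g_smooth g_cpt
  have hg₁ : HasCompactSupport (Complex.ofRealCLM ∘ g) := g_cpt.comp_left rfl
  have hg₂ : ContDiff ℝ (⊤ : ℕ∞) (Complex.ofRealCLM ∘ g) := by fun_prop
  set φ : SchwartzMap ℝ ℂ := hg₁.toSchwartzMap hg₂ with hφ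
  have hφg : ∀ x, φ x = (g x : ℂ) := fun x => by simp [hφ]
  -- Both sides are tested against a smooth compactly supported function. On `L²` the inverse
  -- transform moves to the test function by duality of tempered distributions; for integrable `f`
  -- it moves back by Fubini.
  have hflip := VectorFourier.integral_fourierIntegral_smul_eq_flip (μ := volume) (ν := volume)
    (L := innerₗ ℝ) Real.continuous_fourierChar continuous_inner
    (f := fun x => φ (-x)) (g := (f : ℝ → ℂ)) φ.integrable.comp_neg hf
  have hflip' : ∫ ξ, 𝓕 (fun x => φ (-x)) ξ • f ξ = ∫ x, φ (-x) • 𝓕 (f : ℝ → ℂ) x := by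
    simpa using! hflip
  calc ∫ x, g x • (𝓕⁻ f : L2) x = ∫ x, φ x • (𝓕⁻ f : L2) x := by simp [hφg]
    _ = Lp.toTemperedDistribution (𝓕⁻ f : L2) φ := (Lp.toTemperedDistribution_apply _ _).symm
    _ = Lp.toTemperedDistribution f (𝓕⁻ φ) := by
        rw [← Lp.fourierInv_toTemperedDistribution_eq]; rfl
    _ = ∫ x, (𝓕⁻ φ) x • f x := Lp.toTemperedDistribution_apply _ _
    _ = ∫ ξ, 𝓕 (fun x => φ (-x)) ξ • f ξ := by
        rw [SchwartzMap.fourierInv_coe, Real.fourierInv_eq_fourier_comp_neg]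
    _ = ∫ x, φ (-x) • 𝓕 (f : ℝ → ℂ) x := hflip'
    _ = ∫ x, φ x • 𝓕 (f : ℝ → ℂ) (-x) := by
        rw [← integral_neg_eq_self]; simp
    _ = _ := by simp [hφg]

variable {s : ℝ} [hs : Fact (1 / 2 < s)]

theorem norm_memLp_toLp_le (a : HsHat s) : ‖a.memLp.toLp a‖ ≤ 1 * ‖a‖ := by
  refine enorm_le_of_sq_le zero_le_one ?_
  rw [Lp.enorm_def, Lp.enorm_def, eLpNorm_wtMeasure_sq, eLpNorm_congr_ae a.memLp.coeFn_toLp]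
  have h0 : eLpNorm a 2 volume ^ 2 = energy 0 a := by
    rw [eLpNorm_eq_lintegral_rpow_enorm_toReal (by norm_num) (by norm_num), energy,
      ← ENNReal.rpow_natCast, ← ENNReal.rpow_mul]
    norm_num
  rw [h0]
  simpa using energy_mono (by linarith [hs.out] : (0 : ℝ) ≤ s) a

/-- The inclusion of `HsHat s` in `L²`. -/
def inclL : HsHat s →L[ℂ] L2 :=
  LinearMap.mkContinuous
    { toFun := fun a => a.memLp.toLp a
      map_add' := fun a b => by
        rw [← MemLp.toLp_add]
        exact MemLp.toLp_congr _ _ (HsHat.coe_add a b)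
      map_smul' := fun c a => by
        rw [RingHom.id_apply, ← MemLp.toLp_const_smul]
        exact MemLp.toLp_congr _ _ (HsHat.coe_smul c a) } 1 norm_memLp_toLp_le

theorem coe_inclL (a : HsHat s) : inclL a =ᵐ[volume] a := a.memLp.coeFn_toLp

/-- The inverse Fourier transform, from `HsHat s` to `L²`. -/
def invFourier : HsHat s →L[ℂ] L2 :=
  ((Lp.fourierTransformₗᵢ ℝ ℂ).symm.toContinuousLinearEquiv : L2 →L[ℂ] L2).comp inclL

theorem invFourier_apply (a : HsHat s) : invFourier a = 𝓕⁻ (inclL a) := rfl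

theorem fourier_invFourier (a : HsHat s) : 𝓕 (invFourier a) = inclL a := by
  rw [invFourier_apply, fourier_fourierInv_eq]

theorem coe_fourier_invFourier (a : HsHat s) : (𝓕 (invFourier a) : L2) =ᵐ[volume] a := by
  rw [fourier_invFourier]; exact coe_inclL a

theorem invFourier_injective : Function.Injective (invFourier : HsHat s → L2) := fun a b h => by
  refine HsHat.ext ?_
  have := coe_fourier_invFourier a
  rw [h] at this
  exact this.symm.trans (coe_fourier_invFourier b)

theorem hsNorm_eq_energy (σ : ℝ) (f : L2) : hsNorm σ f = energy σ (𝓕 f : L2) ^ (1 / 2 : ℝ) := rfl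

theorem hsNorm_invFourier_energy (σ : ℝ) (a : HsHat s) :
    hsNorm σ (invFourier a) = energy σ a ^ (1 / 2 : ℝ) := by
  rw [hsNorm_eq_energy, energy_congr (coe_fourier_invFourier a)]

theorem hsNorm_invFourier (a : HsHat s) : hsNorm s (invFourier a) = ‖a‖ₑ := by
  rw [hsNorm_invFourier_energy, ← a.enorm_sq, ← ENNReal.rpow_natCast, ← ENNReal.rpow_mul]
  norm_num

theorem exists_invFourier_eq {f : L2} (hf : MemHs s f) : ∃ a : HsHat s, invFourier a = f := by
  have hm : AEStronglyMeasurable (𝓕 f : L2) volume := Lp.aestronglyMeasurable _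
  have he : energy s (𝓕 f : L2) < ∞ := by
    rw [MemHs, hsNorm_eq_energy] at hf
    exact (ENNReal.rpow_lt_top_iff_of_pos (by norm_num)).1 hf
  have h : inclL (HsHat.mk _ hm he : HsHat s) = 𝓕 f :=
    Lp.ext ((coe_inclL _).trans (HsHat.coe_mk hm he))
  exact ⟨HsHat.mk _ hm he, by rw [invFourier_apply, h, fourierInv_fourier_eq]⟩

theorem coe_invFourier (a : HsHat s) :
    invFourier a =ᵐ[volume] fun x => 𝓕 (a : ℝ → ℂ) (-x) := by
  rw [invFourier_apply]
  refine (coe_fourierInv_ae_eq _ (a.integrable.congr (coe_inclL a).symm)).trans ?_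
  exact Eventually.of_forall fun x => Real.fourier_congr_ae (coe_inclL a) _

theorem invFourier_convL (a b : HsHat s) :
    invFourier (convL a b) =ᵐ[volume] fun x => invFourier a x * invFourier b x := by
  filter_upwards [coe_invFourier a, coe_invFourier b, coe_invFourier (convL a b)] with x h1 h2 h3
  rw [h1, h2, h3, Real.fourier_congr_ae (coe_convL a b), conv_eq_convolution,
    Real.fourier_mul_convolution_eq a.integrable b.integrable]

theorem fourier_starHat (a : ℝ → ℂ) (x : ℝ) : 𝓕 (starHat a) x = starRingEnd ℂ (𝓕 a x) := by
  rw [Real.fourier_real_eq_integral_exp_smul, Real.fourier_real_eq_integral_exp_smul,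
    ← integral_conj, ← integral_neg_eq_self]
  refine integral_congr_ae (Eventually.of_forall fun ξ => ?_)
  simp only [starHat, smul_eq_mul, map_mul, ← Complex.exp_conj, neg_neg, Complex.conj_I,
    Complex.conj_ofReal]
  congr 2
  push_cast
  ring

theorem invFourier_starL (a : HsHat s) :
    invFourier (starL a) =ᵐ[volume] fun x => starRingEnd ℂ (invFourier a x) := by
  filter_upwards [coe_invFourier a, coe_invFourier (starL a)] with x h1 h2
  rw [h1, h2, Real.fourier_congr_ae (coe_starL a), fourier_starHat]

theorem cubic_invFourier (a : HsHat s) : cubic (invFourier a) = invFourier (cubicHat a) := by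
  have h : (fun x : ℝ => ((‖invFourier a x‖ ^ 2 : ℝ) : ℂ) * invFourier a x) =ᵐ[volume]
      invFourier (cubicHat a) := by
    filter_upwards [invFourier_convL (convL a (starL a)) a, invFourier_convL a (starL a),
      invFourier_starL a] with x h1 h2 h3
    rw [cubicHat, h1, h2, h3, Complex.mul_conj, Complex.normSq_eq_norm_sq]
  -- The almost everywhere identity with an element of `L²` also shows that `cubic` takes its
  -- genuine value here, not the default `0`.
  have hm : MemLp (fun x : ℝ => ((‖invFourier a x‖ ^ 2 : ℝ) : ℂ) * invFourier a x) 2 volume :=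
    (memLp_congr_ae h).2 (Lp.memLp _)
  rw [cubic, dif_pos hm]
  exact Lp.ext (hm.coeFn_toLp.trans h)

theorem fourierMul_invFourier (m : Symbol) (hm : MemLp m.toFun ∞ volume) (a : HsHat s) :
    fourierMul m.toFun hm (invFourier a) = invFourier (m.op a) := by
  rw [fourierMul, invFourier_apply (m.op a), fourier_invFourier]
  congr 1
  refine Lp.ext ?_
  filter_upwards [Lp.coeFn_lpSMul (r := 2) (hm.toLp m.toFun) (inclL a), hm.coeFn_toLp, coe_inclL a,
    coe_inclL (m.op a), m.coe_op a] with ξ h1 h2 h3 h4 h5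
  rw [h1, h4, h5, Pi.smul_apply', h2, h3, smul_eq_mul]

/-- The symbol of the Szegő projector. -/
def szegoSymbol : Symbol where
  toFun := Set.indicator (Set.Ici (0 : ℝ)) (fun _ => (1 : ℂ))
  meas := measurable_const.indicator measurableSet_Ici
  bound := ⟨1, fun ξ => by
    by_cases h : ξ ∈ Set.Ici (0 : ℝ) <;> simp [h]⟩

theorem norm_propagatorSymbol (t ξ : ℝ) :
    ‖Complex.exp (-(Complex.I * (2 * Real.pi * |ξ| : ℝ) * t))‖ = 1 := by
  rw [Complex.norm_exp]
  simp

/-- The symbol of the propagator `e^{-i|D|t}`. -/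
def propSymbol (t : ℝ) : Symbol where
  toFun := fun ξ : ℝ => Complex.exp (-(Complex.I * (2 * Real.pi * |ξ| : ℝ) * t))
  meas := by fun_prop
  bound := ⟨1, fun ξ => (norm_propagatorSymbol t ξ).le⟩

theorem szego_invFourier (a : HsHat s) : szego (invFourier a) = invFourier (szegoSymbol.op a) :=
  fourierMul_invFourier szegoSymbol memLp_szegoSymbol a

theorem propagator_invFourier (t : ℝ) (a : HsHat s) :
    propagator t (invFourier a) = invFourier ((propSymbol t).op a) :=
  fourierMul_invFourier (propSymbol t) (memLp_propagatorSymbol t) a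

theorem norm_propSymbol_op {s : ℝ} (t : ℝ) (a : HsHat s) : ‖(propSymbol t).op a‖ = ‖a‖ := by
  have h : ‖(propSymbol t).op a‖ₑ ^ 2 = ‖a‖ₑ ^ 2 := by
    rw [HsHat.enorm_sq, HsHat.enorm_sq, energy_congr ((propSymbol t).coe_op a), energy, energy]
    refine lintegral_congr fun ξ => ?_
    have h1 : ‖(propSymbol t).toFun ξ‖ = 1 := norm_propagatorSymbol t ξ
    rw [enorm_mul, ← ofReal_norm ((propSymbol t).toFun ξ), h1]
    simp
  refine le_antisymm ?_ ?_
  · simpa using enorm_le_of_sq_le zero_le_one (by simpa using h.le)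
  · simpa using enorm_le_of_sq_le zero_le_one (by simpa using h.ge)

/-- A curve in `C(ℝ, H^s)` comes from a continuous curve in `HsHat s`. -/
theorem ContinuousHs.exists_lift {v : ℝ → L2} (hv : ContinuousHs s v) :
    ∃ ν : ℝ → HsHat s, Continuous ν ∧ ∀ t, invFourier (ν t) = v t := by
  choose ν hν using fun t => exists_invFourier_eq (hv.1 t)
  refine ⟨ν, continuous_iff_continuousAt.2 fun t₀ => ?_, hν⟩
  have h := hv.2 t₀
  rw [ContinuousAt, tendsto_iff_edist_tendsto_0]
  refine h.congr fun t => ?_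
  rw [← hν t, ← hν t₀, ← map_sub, hsNorm_invFourier, edist_eq_enorm_sub]

end

/-! ### Families of Fourier multipliers -/

/-- Dominated convergence for the weighted integral, with majorant `(K + K₀)² |a|²`. Only strong
convergence is claimed: the propagators, for instance, are not norm continuous in time. -/
theorem Symbol.tendsto_op_const {s : ℝ} {ι : Type*} {l : Filter ι} [l.IsCountablyGenerated]
    {m : ι → Symbol} {m₀ : Symbol} {K : ℝ} (hK : ∀ i ξ, ‖(m i).toFun ξ‖ ≤ K)
    (hm : ∀ ξ, Tendsto (fun i => (m i).toFun ξ) l (𝓝 (m₀.toFun ξ))) (a : HsHat s) :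
    Tendsto (fun i => (m i).op a) l (𝓝 (m₀.op a)) := by
  obtain ⟨K₀, hK₀⟩ := m₀.bound
  rw [tendsto_iff_edist_tendsto_0]
  have hsq : ∀ i, edist ((m i).op a) (m₀.op a) ^ 2 =
      ∫⁻ ξ, wt s ξ * ‖((m i).toFun ξ - m₀.toFun ξ) * a ξ‖ₑ ^ 2 := fun i => by
    rw [edist_eq_enorm_sub, HsHat.enorm_sq]
    refine energy_congr ?_
    filter_upwards [HsHat.coe_sub ((m i).op a) (m₀.op a), (m i).coe_op a, m₀.coe_op a]
      with ξ h1 h2 h3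
    rw [h1, h2, h3, sub_mul]
  have hlim : Tendsto (fun i => edist ((m i).op a) (m₀.op a) ^ 2) l (𝓝 0) := by
    simp_rw [hsq]
    have h0 : ∫⁻ ξ : ℝ, (0 : ℝ≥0∞) = 0 := by simp
    rw [← h0]
    refine tendsto_lintegral_filter_of_dominated_convergence
      (fun ξ => wt s ξ * ‖((K + K₀ : ℝ) : ℂ) * a ξ‖ₑ ^ 2) ?_ ?_ ?_ ?_
    · refine Eventually.of_forall fun i => ?_
      exact (measurable_wt s).mul (((((m i).meas.sub m₀.meas).mul
        (Lp.stronglyMeasurable a).measurable).enorm).pow_const 2)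
    · refine Eventually.of_forall fun i => Eventually.of_forall fun ξ => ?_
      gcongr
      refine enorm_le_iff_norm_le.2 ?_
      rw [norm_mul, norm_mul]
      gcongr
      have h1 := hK i ξ
      have h2 := hK₀ ξ
      calc _ ≤ ‖(m i).toFun ξ‖ + ‖m₀.toFun ξ‖ := norm_sub_le _ _
        _ ≤ K + K₀ := by linarith
        _ ≤ _ := by rw [Complex.norm_real]; exact le_abs_self _
    · exact ((energy_mul_le (K := ‖((K + K₀ : ℝ) : ℂ)‖)
        (Eventually.of_forall fun ξ => le_rfl)).trans_lt
        (ENNReal.mul_lt_top ENNReal.ofReal_lt_top a.energy_lt_top)).ne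
    · refine Eventually.of_forall fun ξ => ?_
      have h1 : Tendsto (fun i => ‖((m i).toFun ξ - m₀.toFun ξ) * a ξ‖ₑ) l (𝓝 0) := by
        have := (((hm ξ).sub_const (m₀.toFun ξ)).mul_const (a ξ)).enorm
        simpa using this
      have h2 := ENNReal.Tendsto.const_mul (a := wt s ξ)
        (ENNReal.Tendsto.pow (n := 2) h1) (Or.inr (wt_ne_top s ξ))
      simpa using h2
  have h3 := (ENNReal.continuous_rpow_const (y := (1 / 2 : ℝ))).tendsto 0 |>.comp hlim
  have h4 : (0 : ℝ≥0∞) ^ (1 / 2 : ℝ) = 0 := by simp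
  rw [h4] at h3
  refine h3.congr fun i => ?_
  simp only [Function.comp]
  rw [← ENNReal.rpow_natCast, ← ENNReal.rpow_mul]
  norm_num

theorem Symbol.tendsto_op {s : ℝ} {ι : Type*} {l : Filter ι} [l.IsCountablyGenerated]
    {m : ι → Symbol} {m₀ : Symbol} {K : ℝ} (hK0 : 0 ≤ K) (hK : ∀ i ξ, ‖(m i).toFun ξ‖ ≤ K)
    (hm : ∀ ξ, Tendsto (fun i => (m i).toFun ξ) l (𝓝 (m₀.toFun ξ))) {x : ι → HsHat s} {a : HsHat s}
    (hx : Tendsto x l (𝓝 a)) : Tendsto (fun i => (m i).op (x i)) l (𝓝 (m₀.op a)) := by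
  have h1 := Symbol.tendsto_op_const hK hm a
  have h2 : Tendsto (fun i => (m i).op (x i - a)) l (𝓝 0) := by
    refine squeeze_zero_norm (fun i => (m i).norm_op_le hK0 (hK i) (x i - a)) ?_
    simpa using ((hx.sub_const a).norm).const_mul K
  simpa using h2.add h1

theorem Symbol.continuous_op {s : ℝ} {m : ℝ → Symbol} {K : ℝ} (hK0 : 0 ≤ K)
    (hK : ∀ τ ξ, ‖(m τ).toFun ξ‖ ≤ K) (hm : ∀ ξ, Continuous fun τ => (m τ).toFun ξ)
    {x : ℝ → HsHat s} (hx : Continuous x) : Continuous fun τ => (m τ).op (x τ) :=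
  continuous_iff_continuousAt.2 fun τ =>
    Symbol.tendsto_op hK0 hK (fun ξ => (hm ξ).tendsto τ) (hx.tendsto τ)

/-- A product rule with the multiplier differentiable only pointwise in `ξ`. By the mean value
inequality its difference quotients are bounded by `K'`, so they converge strongly, and the slope
splits as quotient of `A` on the fixed vector plus `A` on the slope of `x`. -/
theorem Symbol.hasDerivAt_op {s : ℝ} {A O : ℝ → Symbol} {K K' : ℝ}
    (hA : ∀ τ ξ, ‖(A τ).toFun ξ‖ ≤ K) (hO : ∀ τ ξ, ‖(O τ).toFun ξ‖ ≤ K')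
    (hd : ∀ τ ξ, HasDerivAt (fun τ => (A τ).toFun ξ) ((O τ).toFun ξ) τ)
    {x : ℝ → HsHat s} {x' : HsHat s} {τ : ℝ} (hx : HasDerivAt x x' τ) :
    HasDerivAt (fun τ => (A τ).op (x τ)) ((O τ).op (x τ) + (A τ).op x') τ := by
  have hK0 : 0 ≤ K := (norm_nonneg _).trans (hA 0 0)
  have hK0' : 0 ≤ K' := (norm_nonneg _).trans (hO 0 0)
  have hlip : ∀ σ ξ, ‖(A σ).toFun ξ - (A τ).toFun ξ‖ ≤ K' * ‖σ - τ‖ := fun σ ξ =>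
    convex_univ.norm_image_sub_le_of_norm_hasDerivWithin_le
      (fun ρ _ => (hd ρ ξ).hasDerivWithinAt) (fun ρ _ => hO ρ ξ) (Set.mem_univ _) (Set.mem_univ _)
  have hq : ∀ σ ξ, ‖(((σ - τ)⁻¹ : ℝ) : ℂ) * ((A σ).toFun ξ - (A τ).toFun ξ)‖ ≤ K' := fun σ ξ => by
    rw [norm_mul, Complex.norm_real, norm_inv]
    rcases eq_or_ne (‖σ - τ‖) 0 with h0 | h0
    · rw [h0]; simpa using hK0'
    · rw [inv_mul_le_iff₀ (lt_of_le_of_ne (norm_nonneg _) h0.symm), mul_comm]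
      exact hlip σ ξ
  let Q : ℝ → Symbol := fun σ =>
    ⟨fun ξ => (((σ - τ)⁻¹ : ℝ) : ℂ) * ((A σ).toFun ξ - (A τ).toFun ξ),
      measurable_const.mul ((A σ).meas.sub (A τ).meas), K', hq σ⟩
  have hcontA : ∀ ξ, Tendsto (fun σ => (A σ).toFun ξ) (𝓝[≠] τ) (𝓝 ((A τ).toFun ξ)) := fun ξ =>
    ((hd τ ξ).continuousAt.tendsto).mono_left nhdsWithin_le_nhds
  have hQ : Tendsto (fun σ => (Q σ).op (x τ)) (𝓝[≠] τ) (𝓝 ((O τ).op (x τ))) := by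
    refine Symbol.tendsto_op_const (K := K') hq (fun ξ => ?_) (x τ)
    have := (hasDerivAt_iff_tendsto_slope.1 (hd τ ξ))
    refine this.congr fun σ => ?_
    simp [Q, slope, Complex.real_smul]
  have hx' := Symbol.tendsto_op hK0 hA hcontA (hasDerivAt_iff_tendsto_slope.1 hx)
  rw [hasDerivAt_iff_tendsto_slope]
  refine (hQ.add hx').congr fun σ => ?_
  have hQop : (Q σ).op (x τ) = ((σ - τ)⁻¹ : ℝ) • ((A σ).op (x τ) - (A τ).op (x τ)) := by
    refine HsHat.ext ?_
    filter_upwards [(Q σ).coe_op (x τ), HsHat.coe_real_smul (σ - τ)⁻¹ ((A σ).op (x τ) - (A τ).op (x τ)),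
      HsHat.coe_sub ((A σ).op (x τ)) ((A τ).op (x τ)), (A σ).coe_op (x τ), (A τ).coe_op (x τ)]
      with ξ h1 h2 h3 h4 h5
    rw [h1, h2, h3, h4, h5]
    simp only [Q]
    push_cast
    ring
  rw [hQop, slope, slope, vsub_eq_sub, vsub_eq_sub, ContinuousLinearMap.map_smul_of_tower, map_sub,
    ← smul_add]
  congr 1
  abel

section

/-! ### The oscillating part of the nonlinearity -/

/-- The phase `e^{-4πiξτ}`. -/
def phase (τ ξ : ℝ) : ℂ := Complex.exp (-(4 * Real.pi * ξ * τ : ℝ) * Complex.I)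

theorem norm_phase (τ ξ : ℝ) : ‖phase τ ξ‖ = 1 := by
  rw [phase, ← Complex.ofReal_neg, Complex.norm_exp_ofReal_mul_I]

theorem measurable_phase (τ : ℝ) : Measurable (phase τ) := by unfold phase; fun_prop

/-- The symbol `e^{-4πiξτ}` restricted to `[-κ, 0)`. -/
def oscLow (κ τ : ℝ) : Symbol where
  toFun := (Set.Ico (-κ) 0).indicator (phase τ)
  meas := (measurable_phase τ).indicator measurableSet_Ico
  bound := ⟨1, fun ξ => (norm_indicator_le_norm_self _ _).trans (norm_phase τ ξ).le⟩

/-- The symbol `e^{-4πiξτ}` restricted to `(-∞, -κ)`. -/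
def oscHigh (κ τ : ℝ) : Symbol where
  toFun := (Set.Iio (-κ)).indicator (phase τ)
  meas := (measurable_phase τ).indicator measurableSet_Iio
  bound := ⟨1, fun ξ => (norm_indicator_le_norm_self _ _).trans (norm_phase τ ξ).le⟩

theorem norm_oscLow_le (κ τ ξ : ℝ) : ‖(oscLow κ τ).toFun ξ‖ ≤ 1 :=
  (norm_indicator_le_norm_self _ _).trans (norm_phase τ ξ).le

theorem norm_oscHigh_le (κ τ ξ : ℝ) : ‖(oscHigh κ τ).toFun ξ‖ ≤ 1 :=
  (norm_indicator_le_norm_self _ _).trans (norm_phase τ ξ).le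

/-- The function `e^{-4πiξτ} / (-4πiξ)` restricted to `(-∞, -κ)`. -/
def oscPrimFun (κ τ : ℝ) : ℝ → ℂ :=
  (Set.Iio (-κ)).indicator fun ξ => phase τ ξ / (-(4 * Real.pi * ξ : ℝ) * Complex.I)

theorem norm_oscPrimFun {κ τ ξ : ℝ} (h : ξ < -κ) :
    ‖oscPrimFun κ τ ξ‖ = (4 * Real.pi * |ξ|)⁻¹ := by
  rw [oscPrimFun, Set.indicator_of_mem (Set.mem_Iio.2 h), norm_div, norm_phase, norm_mul, Complex.norm_I, norm_neg,
    Complex.norm_real, Real.norm_eq_abs, abs_mul, abs_of_pos (by positivity : 0 < 4 * Real.pi),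
    mul_one, one_div]

theorem norm_oscPrimFun_le' {κ τ ξ r : ℝ} (hκ : 0 < κ) (hr : 0 < r) (h : ξ < -κ) (h' : ξ ≤ -r) :
    ‖oscPrimFun κ τ ξ‖ ≤ r⁻¹ := by
  rw [norm_oscPrimFun h]
  refine inv_anti₀ hr ?_
  rw [abs_of_neg (by linarith)]
  nlinarith [Real.pi_gt_three]

theorem norm_oscPrimFun_le {κ τ ξ : ℝ} (hκ : 0 < κ) : ‖oscPrimFun κ τ ξ‖ ≤ κ⁻¹ := by
  by_cases h : ξ < -κ
  · exact norm_oscPrimFun_le' hκ hκ h h.le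
  · rw [oscPrimFun, Set.indicator_of_notMem (by simpa using h)]
    simpa using hκ.le

/-- The symbol which is a primitive in time of `oscHigh`. -/
def oscPrim (κ : ℝ) (hκ : 0 < κ) (τ : ℝ) : Symbol where
  toFun := oscPrimFun κ τ
  meas := ((measurable_phase τ).div (by fun_prop)).indicator measurableSet_Iio
  bound := ⟨κ⁻¹, fun _ => norm_oscPrimFun_le hκ⟩

theorem hasDerivAt_phase (τ ξ : ℝ) :
    HasDerivAt (fun τ => phase τ ξ) (phase τ ξ * (-(4 * Real.pi * ξ : ℝ) * Complex.I)) τ := by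
  unfold phase
  have h1 : HasDerivAt (fun τ : ℝ => -((4 * Real.pi * ξ * τ : ℝ) : ℂ) * Complex.I)
      (-(4 * Real.pi * ξ : ℝ) * Complex.I) τ := by
    have := (((hasDerivAt_id τ).const_mul (4 * Real.pi * ξ)).ofReal_comp.neg).mul_const Complex.I
    simpa using this
  exact h1.cexp

theorem hasDerivAt_oscPrim {κ : ℝ} (hκ : 0 < κ) (τ ξ : ℝ) :
    HasDerivAt (fun τ => (oscPrim κ hκ τ).toFun ξ) ((oscHigh κ τ).toFun ξ) τ := by
  simp only [oscPrim, oscPrimFun, oscHigh]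
  by_cases h : ξ ∈ Set.Iio (-κ)
  · simp only [Set.indicator_of_mem h]
    have hne : (-(4 * Real.pi * ξ : ℝ) * Complex.I : ℂ) ≠ 0 := by
      have : ξ ≠ 0 := by
        have : ξ < -κ := h
        linarith
      have h4 : (4 * Real.pi * ξ : ℝ) ≠ 0 := by positivity
      exact mul_ne_zero (neg_ne_zero.2 (by exact_mod_cast h4)) Complex.I_ne_zero
    have := (hasDerivAt_phase τ ξ).div_const (-(4 * Real.pi * ξ : ℝ) * Complex.I)
    rwa [mul_div_cancel_right₀ _ hne] at this
  · simp only [Set.indicator_of_notMem h]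
    exact hasDerivAt_const τ (0 : ℂ)

theorem norm_le_of_energy_le {s : ℝ} {a : HsHat s} {c : ℝ} (hc : 0 ≤ c)
    (h : energy s a ≤ ENNReal.ofReal (c ^ 2)) : ‖a‖ ≤ c := by
  rw [← a.enorm_sq, ← ofReal_norm, ← ENNReal.ofReal_pow (norm_nonneg _),
    ENNReal.ofReal_le_ofReal_iff (by positivity)] at h
  exact le_of_sq_le_sq h hc

/-- The Fourier transform is at most `S` on an interval of length `κ`, and the weight there is at
most `2`. -/
theorem norm_oscLow_op_le {s κ τ S : ℝ} (hκ : 0 ≤ κ) (hS : 0 ≤ S)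
    (hw : ∀ ξ, |ξ| ≤ κ → wt s ξ ≤ 2) {a : HsHat s} (ha : ∀ᵐ ξ, ‖a ξ‖ ≤ S) :
    ‖(oscLow κ τ).op a‖ ≤ Real.sqrt (2 * κ) * S := by
  refine norm_le_of_energy_le (by positivity) ?_
  rw [energy_congr ((oscLow κ τ).coe_op a), mul_pow, Real.sq_sqrt (by positivity)]
  calc energy s (fun ξ => (oscLow κ τ).toFun ξ * a ξ)
      ≤ ∫⁻ ξ, (Set.Ico (-κ) 0).indicator (fun _ => 2 * ENNReal.ofReal (S ^ 2)) ξ := by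
        refine lintegral_mono_ae (ha.mono fun ξ hξ => ?_)
        by_cases h : ξ ∈ Set.Ico (-κ) 0
        · rw [Set.indicator_of_mem h]
          gcongr
          · refine hw ξ ?_
            rw [abs_of_neg h.2]
            linarith [h.1]
          · rw [← ofReal_norm, ← ENNReal.ofReal_pow (norm_nonneg _)]
            refine ENNReal.ofReal_le_ofReal (pow_le_pow_left₀ (norm_nonneg _) ?_ 2)
            rw [norm_mul]
            calc _ ≤ 1 * S := by gcongr; exact norm_oscLow_le κ τ ξ
              _ = S := one_mul S
        · simp only [oscLow]
          simp [Set.indicator_of_notMem h]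
    _ = ENNReal.ofReal (2 * κ * S ^ 2) := by
        rw [lintegral_indicator measurableSet_Ico, lintegral_const]
        simp only [MeasurableSet.univ, Measure.restrict_apply, Set.univ_inter, Real.volume_Ico]
        rw [ENNReal.ofReal_mul (by positivity), ENNReal.ofReal_mul (by positivity)]
        simp
        ring

theorem lintegral_Iio_inv_sq {κ : ℝ} (hκ : 0 < κ) :
    ∫⁻ ξ in Set.Iio (-κ), ENNReal.ofReal ((ξ ^ 2)⁻¹) = ENNReal.ofReal κ⁻¹ := by
  have h1 : ∫⁻ ξ in Set.Iio (-κ), ENNReal.ofReal ((ξ ^ 2)⁻¹) =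
      ∫⁻ ξ in Set.Ioi κ, ENNReal.ofReal (ξ ^ (-2 : ℝ)) := by
    rw [← lintegral_indicator measurableSet_Iio, ← lintegral_neg_eq_self,
      ← lintegral_indicator measurableSet_Ioi]
    refine lintegral_congr fun ξ => ?_
    by_cases h : κ < ξ
    · rw [Set.indicator_of_mem (by simpa using h), Set.indicator_of_mem (by simpa using h)]
      rw [Real.rpow_neg (by linarith)]
      norm_num
    · rw [Set.indicator_of_notMem (by simpa using h), Set.indicator_of_notMem (by simpa using h)]
  rw [h1, ← ofReal_integral_eq_lintegral_ofReal (integrableOn_Ioi_rpow_of_lt (by norm_num) hκ),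
    integral_Ioi_rpow_of_lt (by norm_num) hκ]
  · norm_num [Real.rpow_neg_one]
  · refine (ae_restrict_mem measurableSet_Ioi).mono fun ξ hξ => ?_
    have : 0 < ξ := hκ.trans hξ
    simp only [Pi.zero_apply]
    positivity

/-- The primitive has modulus `1/(4π|ξ|)`. On `(-r, -κ)` it is paired with the supremum `S`, and `∫
ξ^{-2} = 1/κ` gives `S/√κ`; for `ξ ≤ -r` it is at most `1/r` and multiplies the `H^s` norm. -/
theorem norm_oscPrim_op_le {s κ r τ S : ℝ} (hκ : 0 < κ) (hr : 0 < r) (hS : 0 ≤ S)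
    (hw : ∀ ξ, |ξ| ≤ r → wt s ξ ≤ 2) {a : HsHat s} (ha : ∀ᵐ ξ, ‖a ξ‖ ≤ S) :
    ‖(oscPrim κ hκ τ).op a‖ ≤ S / Real.sqrt κ + ‖a‖ / r := by
  refine norm_le_of_energy_le (by positivity) ?_
  rw [energy_congr ((oscPrim κ hκ τ).coe_op a)]
  have hpt : ∀ᵐ ξ, wt s ξ * ‖(oscPrim κ hκ τ).toFun ξ * a ξ‖ₑ ^ 2 ≤
      ENNReal.ofReal (S ^ 2) * (Set.Iio (-κ)).indicator (fun ξ => ENNReal.ofReal ((ξ ^ 2)⁻¹)) ξ +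
        ENNReal.ofReal (r⁻¹ ^ 2) * (wt s ξ * ‖a ξ‖ₑ ^ 2) := by
    refine ha.mono fun ξ hξ => ?_
    by_cases h : ξ < -κ
    · rw [Set.indicator_of_mem (by simpa using h)]
      rcases le_total ξ (-r) with h' | h'
      · refine le_trans ?_ le_add_self
        rw [enorm_mul, mul_pow, mul_left_comm, ENNReal.ofReal_pow (by positivity)]
        gcongr
        rw [← ofReal_norm]
        exact ENNReal.ofReal_le_ofReal (norm_oscPrimFun_le' hκ hr h h')
      · refine le_trans ?_ le_self_add
        have h2 : ‖(oscPrim κ hκ τ).toFun ξ * a ξ‖ ≤ (4 * Real.pi * |ξ|)⁻¹ * S := by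
          rw [norm_mul]
          gcongr
          exact (norm_oscPrimFun h).le
        have hneg : ξ < 0 := by linarith
        calc wt s ξ * ‖(oscPrim κ hκ τ).toFun ξ * a ξ‖ₑ ^ 2
            ≤ 2 * ENNReal.ofReal (((4 * Real.pi * |ξ|)⁻¹ * S) ^ 2) := by
              gcongr
              · exact hw ξ (by rw [abs_of_neg hneg]; linarith)
              · rw [← ofReal_norm, ENNReal.ofReal_pow (by positivity)]
                gcongr
          _ = ENNReal.ofReal (2 * ((4 * Real.pi * |ξ|)⁻¹ * S) ^ 2) := by
              rw [ENNReal.ofReal_mul (by norm_num)]; simp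
          _ ≤ ENNReal.ofReal (S ^ 2 * (ξ ^ 2)⁻¹) := by
              refine ENNReal.ofReal_le_ofReal ?_
              rw [mul_pow, inv_pow, mul_pow, sq_abs, mul_inv]
              -- The factor `4π` of the phase pays for the bound `2` on the weight.
              have hpi : 2 * ((4 * Real.pi) ^ 2)⁻¹ ≤ 1 := by
                rw [← div_eq_mul_inv, div_le_one (by positivity)]
                nlinarith [Real.pi_gt_three]
              have : 0 ≤ (ξ ^ 2)⁻¹ * S ^ 2 := by positivity
              nlinarith
          _ = _ := ENNReal.ofReal_mul (by positivity)
    · have h0 : (oscPrim κ hκ τ).toFun ξ = 0 := by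
        simp only [oscPrim, oscPrimFun]
        exact Set.indicator_of_notMem (by simpa using h) _
      simp [h0]
  calc energy s (fun ξ => (oscPrim κ hκ τ).toFun ξ * a ξ)
      ≤ ∫⁻ ξ, (ENNReal.ofReal (S ^ 2) *
          (Set.Iio (-κ)).indicator (fun ξ => ENNReal.ofReal ((ξ ^ 2)⁻¹)) ξ +
        ENNReal.ofReal (r⁻¹ ^ 2) * (wt s ξ * ‖a ξ‖ₑ ^ 2)) := lintegral_mono_ae hpt
    _ = ENNReal.ofReal (S ^ 2) * ENNReal.ofReal κ⁻¹ + ENNReal.ofReal (r⁻¹ ^ 2) * energy s a := by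
        rw [lintegral_add_left, lintegral_const_mul' _ _ ENNReal.ofReal_ne_top,
          lintegral_const_mul' _ _ ENNReal.ofReal_ne_top, lintegral_indicator measurableSet_Iio,
          lintegral_Iio_inv_sq hκ, energy]
        exact measurable_const.mul (Measurable.indicator (by fun_prop) measurableSet_Iio)
    _ = ENNReal.ofReal (S ^ 2 * κ⁻¹ + r⁻¹ ^ 2 * ‖a‖ ^ 2) := by
        rw [← a.enorm_sq, ← ofReal_norm, ENNReal.ofReal_add (by positivity) (by positivity),
          ENNReal.ofReal_mul (by positivity), ENNReal.ofReal_mul (by positivity),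
          ENNReal.ofReal_pow (norm_nonneg a)]
    _ ≤ _ := by
        refine ENNReal.ofReal_le_ofReal ?_
        have h1 : (S / Real.sqrt κ) ^ 2 = S ^ 2 * κ⁻¹ := by
          rw [div_pow, Real.sq_sqrt hκ.le, div_eq_mul_inv]
        have h2 : (‖a‖ / r) ^ 2 = r⁻¹ ^ 2 * ‖a‖ ^ 2 := by
          rw [div_pow, inv_pow, div_eq_mul_inv, mul_comm]
        rw [← h1, ← h2]
        have : 0 ≤ S / Real.sqrt κ * (‖a‖ / r) := by positivity
        nlinarith

theorem continuous_phase (ξ : ℝ) : Continuous fun τ => phase τ ξ := by unfold phase; fun_prop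

theorem continuous_oscLow (κ ξ : ℝ) : Continuous fun τ => (oscLow κ τ).toFun ξ := by
  simp only [oscLow]
  by_cases h : ξ ∈ Set.Ico (-κ) 0
  · simpa only [Set.indicator_of_mem h] using continuous_phase ξ
  · simpa only [Set.indicator_of_notMem h] using continuous_const

theorem continuous_oscHigh (κ ξ : ℝ) : Continuous fun τ => (oscHigh κ τ).toFun ξ := by
  simp only [oscHigh]
  by_cases h : ξ ∈ Set.Iio (-κ)
  · simpa only [Set.indicator_of_mem h] using continuous_phase ξ
  · simpa only [Set.indicator_of_notMem h] using continuous_const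

/-- Non-stationary phase away from the frequency `0`, and a crude bound near it. -/
theorem norm_integral_osc_le {s κ r S S' N N' t : ℝ} (hκ : 0 < κ) (hκr : κ ≤ r) (hS : 0 ≤ S)
    (hS' : 0 ≤ S') (hw : ∀ ξ, |ξ| ≤ r → wt s ξ ≤ 2) {g g' : ℝ → HsHat s}
    (hg : ∀ τ, HasDerivAt g (g' τ) τ) (hg' : Continuous g')
    (hgS : ∀ τ, ∀ᵐ ξ, ‖g τ ξ‖ ≤ S) (hgS' : ∀ τ, ∀ᵐ ξ, ‖g' τ ξ‖ ≤ S')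
    (hgN : ∀ τ, ‖g τ‖ ≤ N) (hgN' : ∀ τ, ‖g' τ‖ ≤ N') (ht : 0 ≤ t) :
    ‖∫ τ in (0 : ℝ)..t, ((oscLow κ τ).op (g τ) + (oscHigh κ τ).op (g τ))‖ ≤
      t * (Real.sqrt (2 * κ) * S) + 2 * (S / Real.sqrt κ + N / r) +
        t * (S' / Real.sqrt κ + N' / r) := by
  have hr : 0 < r := hκ.trans_le hκr
  have hgc : Continuous g := continuous_iff_continuousAt.2 fun τ => (hg τ).continuousAt
  have hcl : Continuous fun τ => (oscLow κ τ).op (g τ) :=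
    Symbol.continuous_op zero_le_one (norm_oscLow_le κ) (continuous_oscLow κ) hgc
  have hch : Continuous fun τ => (oscHigh κ τ).op (g τ) :=
    Symbol.continuous_op zero_le_one (norm_oscHigh_le κ) (continuous_oscHigh κ) hgc
  have hcp : Continuous fun τ => (oscPrim κ hκ τ).op (g' τ) :=
    Symbol.continuous_op (inv_nonneg.2 hκ.le) (fun _ _ => norm_oscPrimFun_le hκ)
      (fun ξ => continuous_iff_continuousAt.2 fun τ => (hasDerivAt_oscPrim hκ τ ξ).continuousAt) hg'
  have hd : ∀ τ, HasDerivAt (fun τ => (oscPrim κ hκ τ).op (g τ))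
      ((oscHigh κ τ).op (g τ) + (oscPrim κ hκ τ).op (g' τ)) τ := fun τ =>
    Symbol.hasDerivAt_op (fun _ _ => norm_oscPrimFun_le hκ) (norm_oscHigh_le κ)
      (hasDerivAt_oscPrim hκ) (hg τ)
  -- Integration by parts in time: the derivative moves from the phase to `g`.
  have hparts : ∫ τ in (0 : ℝ)..t, (oscHigh κ τ).op (g τ) =
      (oscPrim κ hκ t).op (g t) - (oscPrim κ hκ 0).op (g 0) -
        ∫ τ in (0 : ℝ)..t, (oscPrim κ hκ τ).op (g' τ) := by
    have h1 := intervalIntegral.integral_eq_sub_of_hasDerivAt (fun τ _ => hd τ)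
      ((hch.add hcp).intervalIntegrable 0 t)
    rw [← h1, intervalIntegral.integral_add (hch.intervalIntegrable 0 t)
      (hcp.intervalIntegrable 0 t), add_sub_cancel_right]
  have hA : ∀ τ, ‖(oscPrim κ hκ τ).op (g τ)‖ ≤ S / Real.sqrt κ + N / r := fun τ =>
    (norm_oscPrim_op_le hκ hr hS hw (hgS τ)).trans (by gcongr; exact hgN τ)
  have hA' : ∀ τ, ‖(oscPrim κ hκ τ).op (g' τ)‖ ≤ S' / Real.sqrt κ + N' / r := fun τ =>
    (norm_oscPrim_op_le hκ hr hS' hw (hgS' τ)).trans (by gcongr; exact hgN' τ)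
  have hI1 : ‖∫ τ in (0 : ℝ)..t, (oscLow κ τ).op (g τ)‖ ≤ Real.sqrt (2 * κ) * S * |t - 0| :=
    intervalIntegral.norm_integral_le_of_norm_le_const fun τ _ =>
      norm_oscLow_op_le hκ.le hS (fun ξ hξ => hw ξ (hξ.trans hκr)) (hgS τ)
  have hI2 : ‖∫ τ in (0 : ℝ)..t, (oscPrim κ hκ τ).op (g' τ)‖ ≤
      (S' / Real.sqrt κ + N' / r) * |t - 0| :=
    intervalIntegral.norm_integral_le_of_norm_le_const fun τ _ => hA' τ
  rw [sub_zero, abs_of_nonneg ht] at hI1 hI2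
  rw [intervalIntegral.integral_add (hcl.intervalIntegrable 0 t) (hch.intervalIntegrable 0 t),
    hparts]
  calc _ ≤ ‖∫ τ in (0 : ℝ)..t, (oscLow κ τ).op (g τ)‖ +
        (‖(oscPrim κ hκ t).op (g t)‖ + ‖(oscPrim κ hκ 0).op (g 0)‖ +
          ‖∫ τ in (0 : ℝ)..t, (oscPrim κ hκ τ).op (g' τ)‖) := by
        refine (norm_add_le _ _).trans ?_
        gcongr
        exact (norm_sub_le _ _).trans (by gcongr; exact norm_sub_le _ _)
    _ ≤ _ := by linarith [hA t, hA 0]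

/-! ### The nonlinearity along the linear flow -/

/-- The Fourier side of the fact that translations commute with products. -/
theorem conv_mul_char {e : ℝ → ℂ} (he : ∀ ξ η, e η * e (ξ - η) = e ξ) (a b : ℝ → ℂ) :
    conv (fun ξ => e ξ * a ξ) (fun ξ => e ξ * b ξ) = fun ξ => e ξ * conv a b ξ := by
  funext ξ
  simp only [conv]
  rw [← integral_const_mul]
  refine integral_congr_ae (Eventually.of_forall fun η => ?_)
  simp only
  rw [← he ξ η]
  ring

variable {s : ℝ} [hs : Fact (1 / 2 < s)]

theorem coe_cubicHat (a : HsHat s) :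
    cubicHat a =ᵐ[volume] conv (conv a (starHat a)) a := by
  refine (coe_convL _ a).trans ?_
  rw [conv_congr ((coe_convL a (starL a)).trans
    (by rw [conv_congr (ae_eq_refl _) (coe_starL a)])) (ae_eq_refl _)]

/-- The interaction representation of the nonlinearity, for data with nonnegative frequencies. -/
theorem propSymbol_cubicHat {κ : ℝ} (hκ : 0 ≤ κ) (τ : ℝ) {w : HsHat s}
    (hw : ∀ᵐ ξ : ℝ, ξ < 0 → w ξ = 0) :
    (propSymbol (-τ)).op (cubicHat ((propSymbol τ).op w)) =
      szegoSymbol.op (cubicHat w) + ((oscLow κ τ).op (cubicHat w) + (oscHigh κ τ).op (cubicHat w)) := by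
  set e : ℝ → ℂ := fun ξ => Complex.exp (-(2 * Real.pi * ξ * τ : ℝ) * Complex.I) with he
  have hchar : ∀ ξ η, e η * e (ξ - η) = e ξ := fun ξ η => by
    simp only [he]
    rw [← Complex.exp_add]
    congr 1
    push_cast
    ring
  -- On the support of `w` one has `|ξ| = ξ`, so the propagator multiplies by the character `e`,
  -- that is, translates in space.
  have hP : (propSymbol τ).op w =ᵐ[volume] fun ξ => e ξ * w ξ := by
    filter_upwards [(propSymbol τ).coe_op w, hw] with ξ h1 h2
    rw [h1]
    rcases lt_or_ge ξ 0 with h | h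
    · simp [h2 h]
    · congr 1
      simp only [propSymbol, he, abs_of_nonneg h]
      congr 1
      push_cast
      ring
  have hstar : starHat (fun ξ => e ξ * w ξ) = fun ξ => e ξ * starHat w ξ := by
    funext ξ
    simp only [starHat, map_mul, he, ← Complex.exp_conj]
    congr 2
    rw [map_neg, Complex.conj_ofReal, Complex.conj_I]
    push_cast
    ring
  have hcub : cubicHat ((propSymbol τ).op w) =ᵐ[volume] fun ξ => e ξ * cubicHat w ξ := by
    filter_upwards [coe_cubicHat ((propSymbol τ).op w), coe_cubicHat w] with ξ h1 h2
    rw [h1, h2, conv_congr (a := conv _ _)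
      (by rw [conv_congr hP ((starHat_congr hP).trans (by rw [hstar]))]) hP, conv_mul_char hchar,
      conv_mul_char hchar]
  refine HsHat.ext ?_
  filter_upwards [(propSymbol (-τ)).coe_op (cubicHat ((propSymbol τ).op w)), hcub,
    HsHat.coe_add (szegoSymbol.op (cubicHat w))
      ((oscLow κ τ).op (cubicHat w) + (oscHigh κ τ).op (cubicHat w)),
    HsHat.coe_add ((oscLow κ τ).op (cubicHat w)) ((oscHigh κ τ).op (cubicHat w)),
    szegoSymbol.coe_op (cubicHat w), (oscLow κ τ).coe_op (cubicHat w),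
    (oscHigh κ τ).coe_op (cubicHat w)] with ξ h1 h2 h3 h4 h5 h6 h7
  rw [h1, h2, h3, h4, h5, h6, h7, ← mul_assoc, ← add_mul, ← add_mul]
  congr 1
  -- The surviving phase is `|ξ| - ξ`: zero for `ξ ≥ 0` and `-2ξ` for `ξ < 0`.
  have hexp : (propSymbol (-τ)).toFun ξ * e ξ =
      Complex.exp ((2 * Real.pi * (|ξ| - ξ) * τ : ℝ) * Complex.I) := by
    simp only [propSymbol, he]
    rw [← Complex.exp_add]
    congr 1
    push_cast
    ring
  rw [hexp]
  simp only [szegoSymbol, oscLow, oscHigh]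
  rcases lt_or_ge ξ 0 with h | h
  · rw [Set.indicator_of_notMem (by simpa using h), abs_of_neg h]
    have hph : Complex.exp ((2 * Real.pi * (-ξ - ξ) * τ : ℝ) * Complex.I) = phase τ ξ := by
      rw [phase]
      congr 2
      push_cast
      ring
    rw [hph]
    rcases lt_or_ge ξ (-κ) with h' | h'
    · rw [Set.indicator_of_notMem (fun hh => by linarith [hh.1]), Set.indicator_of_mem (by simpa using h')]
      simp
    · rw [Set.indicator_of_mem (show ξ ∈ Set.Ico (-κ) 0 from ⟨h', h⟩),
        Set.indicator_of_notMem (by simpa using h')]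
      simp
  · rw [Set.indicator_of_mem (by simpa using h), abs_of_nonneg h,
      Set.indicator_of_notMem (fun hh => by linarith [hh.2]),
      Set.indicator_of_notMem (by simp only [Set.mem_Iio, not_lt]; linarith)]
    simp

end

section

/-! ### Conservation of mass and momentum -/

theorem conj_conv_starHat (w : ℝ → ℂ) (ζ : ℝ) :
    starRingEnd ℂ (conv w (starHat w) ζ) = ∫ η, starRingEnd ℂ (w (ζ + η)) * w η := by
  rw [conv, ← integral_conj, ← integral_add_left_eq_self _ ζ]
  refine integral_congr_ae (Eventually.of_forall fun η => ?_)
  simp [starHat]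

/-- Hermitian symmetry of the Fourier transform of the real function `|f|²`. -/
theorem conv_starHat_neg (w : ℝ → ℂ) (ζ : ℝ) :
    conv w (starHat w) (-ζ) = starRingEnd ℂ (conv w (starHat w) ζ) := by
  rw [conj_conv_starHat, conv]
  refine integral_congr_ae (Eventually.of_forall fun η => ?_)
  simp only [starHat]
  rw [mul_comm]
  congr 3
  ring

variable {s : ℝ} [hs : Fact (1 / 2 < s)]

/-- The integrand of the pairing of `(1 + D) f` with `|f|² f`. -/
def momIntegrand (w : ℝ → ℂ) (p : ℝ × ℝ) : ℂ :=
  ((1 + 2 * Real.pi * p.1 : ℝ) : ℂ) *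
    (starRingEnd ℂ (w p.1) * (w p.2 * conv w (starHat w) (p.1 - p.2)))

theorem aesm_conv_starHat (w : HsHat s) : AEStronglyMeasurable (conv w (starHat w)) volume :=
  (integrable_conv w.integrable ((starL w).integrable.congr (coe_starL w))).aestronglyMeasurable

/-- Cauchy-Schwarz pairs `(1 + D) f`, taken in `H^{-s}`, with `|f|² f`, taken in `H^s` by the
algebra property. The first factor is finite because `(1 + 2πξ)²` is at most twice the weight of
exponent `2s`, as `2s > 1`. The integrability justifies every use of Fubini in the next proof. -/
theorem integrable_momIntegrand (w : HsHat s) :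
    Integrable (momIntegrand w) (volume.prod volume) := by
  set q := conv w (starHat w) with hq
  have hqm : AEStronglyMeasurable q volume := aesm_conv_starHat w
  have hqe : energy s q < ∞ :=
    (energy_conv_self w.aesm (aesm_starHat w.aesm)).trans_lt (ENNReal.mul_lt_top algConst_lt_top
      (ENNReal.mul_lt_top w.energy_lt_top (energy_starHat_lt_top w)))
  have hqp : AEStronglyMeasurable (fun p : ℝ × ℝ => q (p.1 - p.2)) (volume.prod volume) :=
    hqm.comp_quasiMeasurePreserving (quasiMeasurePreserving_sub _ _)
  have hφ : Measurable fun ξ : ℝ => ((1 + 2 * Real.pi * ξ : ℝ) : ℂ) := by fun_prop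
  have hm : AEStronglyMeasurable (momIntegrand w) (volume.prod volume) :=
    (hφ.comp measurable_fst).aestronglyMeasurable.mul
      ((Complex.continuous_conj.comp_aestronglyMeasurable w.aesm.comp_fst).mul
        (w.aesm.comp_snd.mul hqp))
  refine ⟨hm, ?_⟩
  rw [HasFiniteIntegral, lintegral_prod _ hm.enorm]
  have hinner : ∀ ξ, ∫⁻ η, ‖momIntegrand w (ξ, η)‖ₑ =
      (wt (-(s / 2)) ξ * ‖((1 + 2 * Real.pi * ξ : ℝ) : ℂ) * w ξ‖ₑ) *
        (wt (s / 2) ξ * ∫⁻ η, ‖w η‖ₑ * ‖q (ξ - η)‖ₑ) := fun ξ => by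
    have h1 : wt (-(s / 2)) ξ * wt (s / 2) ξ = 1 := by rw [wt_mul]; simp
    rw [mul_mul_mul_comm, h1, one_mul, ← lintegral_const_mul' _ _ enorm_ne_top]
    refine lintegral_congr fun η => ?_
    simp only [momIntegrand, enorm_mul, RCLike.enorm_conj]
    ring
  rw [lintegral_congr hinner]
  have hF : AEMeasurable fun ξ => wt (-(s / 2)) ξ * ‖((1 + 2 * Real.pi * ξ : ℝ) : ℂ) * w ξ‖ₑ :=
    (measurable_wt _).aemeasurable.mul (hφ.aestronglyMeasurable.mul w.aesm).enorm
  have hG : AEMeasurable fun ξ => wt (s / 2) ξ * ∫⁻ η, ‖w η‖ₑ * ‖q (ξ - η)‖ₑ := by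
    refine (measurable_wt _).aemeasurable.mul ?_
    have : AEMeasurable (fun p : ℝ × ℝ => ‖w p.2‖ₑ * ‖q (p.1 - p.2)‖ₑ) (volume.prod volume) :=
      w.aesm.comp_snd.enorm.mul hqp.enorm
    exact this.lintegral_prod_right'
  have hCS := sq_lintegral_mul_le hF hG
  refine (ENNReal.pow_lt_top_iff.1 (hCS.trans_lt (ENNReal.mul_lt_top ?_ ?_))).resolve_right
    (by norm_num)
  · refine lt_of_le_of_lt (lintegral_mono (g := fun ξ => 2 * (wt s ξ * ‖w ξ‖ₑ ^ 2)) fun ξ => ?_) ?_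
    · rw [mul_pow, wt_sq, enorm_mul, mul_pow]
      have h1 : ‖((1 + 2 * Real.pi * ξ : ℝ) : ℂ)‖ₑ ^ 2 ≤ 2 * wt 1 ξ := by
        rw [← ofReal_norm, Complex.norm_real, ← ENNReal.ofReal_pow (norm_nonneg _),
          Real.norm_eq_abs, sq_abs, wt, Real.rpow_one]
        calc _ ≤ ENNReal.ofReal (2 * (1 + (2 * Real.pi * ξ) ^ 2)) :=
              ENNReal.ofReal_le_ofReal (by nlinarith [sq_nonneg (1 - 2 * Real.pi * ξ)])
          _ = _ := by rw [ENNReal.ofReal_mul (by norm_num)]; simp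
      calc wt (2 * -(s / 2)) ξ * (‖((1 + 2 * Real.pi * ξ : ℝ) : ℂ)‖ₑ ^ 2 * ‖w ξ‖ₑ ^ 2)
          ≤ wt (2 * -(s / 2)) ξ * ((2 * wt (2 * s) ξ) * ‖w ξ‖ₑ ^ 2) := by
            gcongr
            exact h1.trans (by gcongr; exact wt_mono (by linarith [hs.out]) ξ)
        _ = 2 * ((wt (2 * -(s / 2)) ξ * wt (2 * s) ξ) * ‖w ξ‖ₑ ^ 2) := by ring
        _ = _ := by
            rw [wt_mul]
            congr 3
            ring
    · rw [lintegral_const_mul' _ _ (by norm_num)]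
      exact ENNReal.mul_lt_top (by norm_num) w.energy_lt_top
  · refine lt_of_le_of_lt (le_of_eq (lintegral_congr fun ξ => ?_))
      ((lintegral_wt_mul_sq_lintegral_le w.aesm.enorm hqm.enorm
        (wt_conv_bound_self (by linarith [hs.out] : (0 : ℝ) ≤ s))).trans_lt
        (ENNReal.mul_lt_top algConst_lt_top (ENNReal.mul_lt_top w.energy_lt_top hqe)))
    rw [mul_pow, wt_sq]
    congr 2
    ring

/-- The pairing of `(1 + D) f` with `|f|² f` is real. -/
theorem im_integral_momentum (w : HsHat s) :
    (∫ ξ, ((1 + 2 * Real.pi * ξ : ℝ) : ℂ) *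
      (starRingEnd ℂ (w ξ) * conv (conv w (starHat w)) w ξ)).im = 0 := by
  set q := conv w (starHat w) with hq
  have hqm : AEStronglyMeasurable q volume := aesm_conv_starHat w
  have hint := integrable_momIntegrand w
  have hI : ∫ ξ, ((1 + 2 * Real.pi * ξ : ℝ) : ℂ) * (starRingEnd ℂ (w ξ) * conv q w ξ) =
      ∫ p, momIntegrand w p ∂(volume.prod volume) := by
    rw [integral_prod _ hint]
    refine integral_congr_ae (Eventually.of_forall fun ξ => ?_)
    simp only [momIntegrand]
    rw [integral_const_mul, integral_const_mul, conv_comm q w, conv]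
  have hconj : starRingEnd ℂ (∫ p, momIntegrand w p ∂(volume.prod volume)) =
      ∫ p : ℝ × ℝ, ((1 + 2 * Real.pi * p.2 : ℝ) : ℂ) *
        (starRingEnd ℂ (w p.1) * (w p.2 * q (p.1 - p.2))) ∂(volume.prod volume) := by
    rw [← integral_conj, ← integral_prod_swap]
    refine integral_congr_ae (Eventually.of_forall fun p => ?_)
    simp only [momIntegrand, Prod.fst_swap, Prod.snd_swap, map_mul, Complex.conj_conj,
      Complex.conj_ofReal]
    rw [← conv_starHat_neg w, neg_sub, ← hq]
    ring
  have hint2 : Integrable (fun p : ℝ × ℝ => ((1 + 2 * Real.pi * p.2 : ℝ) : ℂ) *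
      (starRingEnd ℂ (w p.1) * (w p.2 * q (p.1 - p.2)))) (volume.prod volume) := by
    have h1 : Integrable (fun p => starRingEnd ℂ (momIntegrand w p)) (volume.prod volume) :=
      (integrable_norm_iff (Complex.continuous_conj.comp_aestronglyMeasurable hint.1)).1
        (by simpa using hint.norm)
    refine h1.swap.congr (Eventually.of_forall fun p => ?_)
    simp only [Function.comp, momIntegrand, Prod.fst_swap, Prod.snd_swap, map_mul,
      Complex.conj_conj, Complex.conj_ofReal]
    rw [← conv_starHat_neg w, neg_sub, ← hq]
    ring
  -- Exchanging the two variables conjugates the integrand up to its multiplier; subtracting cancels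
  -- the `1` and leaves `2π(ξ - η)`, a function of the frequency of `|f|²` alone.
  have hdiff : (∫ p, momIntegrand w p ∂(volume.prod volume)) -
      starRingEnd ℂ (∫ p, momIntegrand w p ∂(volume.prod volume)) =
      ∫ p : ℝ × ℝ, ((2 * Real.pi * (p.1 - p.2) : ℝ) : ℂ) *
        (starRingEnd ℂ (w p.1) * (w p.2 * q (p.1 - p.2))) ∂(volume.prod volume) := by
    rw [hconj, ← integral_sub hint hint2]
    refine integral_congr_ae (Eventually.of_forall fun p => ?_)
    simp only [momIntegrand]
    push_cast
    ring
  have hint3 : Integrable (fun p : ℝ × ℝ => ((2 * Real.pi * (p.1 - p.2) : ℝ) : ℂ) *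
        (starRingEnd ℂ (w p.1) * (w p.2 * q (p.1 - p.2)))) (volume.prod volume) := by
    refine (hint.sub hint2).congr (Eventually.of_forall fun p => ?_)
    simp only [momIntegrand, Pi.sub_apply]
    push_cast
    ring
  have hmp := measurePreserving_add_prod (volume : Measure ℝ) (volume : Measure ℝ)
  -- With `ζ = ξ - η` as a new variable, the integral over `η` reassembles the conjugate of `q ζ`.
  have hshear : ∫ p : ℝ × ℝ, ((2 * Real.pi * (p.1 - p.2) : ℝ) : ℂ) *
        (starRingEnd ℂ (w p.1) * (w p.2 * q (p.1 - p.2))) ∂(volume.prod volume) =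
      ∫ p : ℝ × ℝ, ((2 * Real.pi * p.1 : ℝ) : ℂ) *
        (starRingEnd ℂ (w (p.1 + p.2)) * (w p.2 * q p.1)) ∂(volume.prod volume) := by
    conv_lhs => rw [← hmp.map_eq]
    rw [integral_map hmp.measurable.aemeasurable (by rw [hmp.map_eq]; exact hint3.1)]
    simp
  have hint4 : Integrable (fun p : ℝ × ℝ => ((2 * Real.pi * p.1 : ℝ) : ℂ) *
        (starRingEnd ℂ (w (p.1 + p.2)) * (w p.2 * q p.1))) (volume.prod volume) := by
    have := hmp.integrable_comp_of_integrable hint3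
    simpa [Function.comp_def] using this
  have hJ : ∫ p : ℝ × ℝ, ((2 * Real.pi * p.1 : ℝ) : ℂ) *
        (starRingEnd ℂ (w (p.1 + p.2)) * (w p.2 * q p.1)) ∂(volume.prod volume) =
      ∫ ζ, ((2 * Real.pi * ζ : ℝ) : ℂ) * (q ζ * starRingEnd ℂ (q ζ)) := by
    rw [integral_prod _ hint4]
    refine integral_congr_ae (Eventually.of_forall fun ζ => ?_)
    simp only
    rw [hq, conj_conv_starHat, ← hq, ← integral_const_mul, ← integral_const_mul]
    refine integral_congr_ae (Eventually.of_forall fun η => ?_)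
    simp only
    ring
  -- `|q|²` is even by Hermitian symmetry, so the integrand is odd.
  have hodd : ∫ ζ, ((2 * Real.pi * ζ : ℝ) : ℂ) * (q ζ * starRingEnd ℂ (q ζ)) = 0 := by
    have h1 := integral_neg_eq_self
      (fun ζ : ℝ => ((2 * Real.pi * ζ : ℝ) : ℂ) * (q ζ * starRingEnd ℂ (q ζ))) volume
    have h2 : ∫ ζ : ℝ, ((2 * Real.pi * (-ζ) : ℝ) : ℂ) * (q (-ζ) * starRingEnd ℂ (q (-ζ))) =
        -∫ ζ, ((2 * Real.pi * ζ : ℝ) : ℂ) * (q ζ * starRingEnd ℂ (q ζ)) := by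
      rw [← integral_neg]
      refine integral_congr_ae (Eventually.of_forall fun ζ => ?_)
      simp only
      rw [hq, conv_starHat_neg, ← hq, Complex.conj_conj]
      push_cast
      ring
    rw [h2] at h1
    exact self_eq_neg.1 h1.symm
  rw [hshear, hJ, hodd, sub_eq_zero] at hdiff
  rw [hI]
  exact Complex.conj_eq_iff_im.1 hdiff.symm

/-- The symbol `(1 + 2πξ) / (1 + (2πξ)²)^s`, which represents `1 + D` for the inner product
of `H^s`. -/
def momSymbol (s : ℝ) (hs : 1 / 2 < s) : Symbol where
  toFun := fun ξ => (((1 + 2 * Real.pi * ξ) / (1 + (2 * Real.pi * ξ) ^ 2) ^ s : ℝ) : ℂ)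
  meas := by fun_prop
  bound := ⟨2, fun ξ => by
    rw [Complex.norm_real, norm_div, Real.norm_eq_abs, Real.norm_eq_abs,
      abs_of_pos (by positivity : 0 < (1 + (2 * Real.pi * ξ) ^ 2) ^ s), div_le_iff₀ (by positivity)]
    have h1 : (1 + (2 * Real.pi * ξ) ^ 2) ^ (1 / 2 : ℝ) ≤ (1 + (2 * Real.pi * ξ) ^ 2) ^ s :=
      Real.rpow_le_rpow_of_exponent_le (one_le_jap ξ) hs.le
    rw [← Real.sqrt_eq_rpow] at h1
    have h2 : |1 + 2 * Real.pi * ξ| ≤ 2 * Real.sqrt (1 + (2 * Real.pi * ξ) ^ 2) := by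
      refine abs_le_of_sq_le_sq ?_ (by positivity)
      rw [mul_pow, Real.sq_sqrt (jap_pos ξ).le]
      nlinarith [sq_nonneg (1 - 2 * Real.pi * ξ)]
    linarith⟩

theorem integral_wtMeasure (s : ℝ) (f : ℝ → ℂ) :
    ∫ ξ, f ξ ∂(wtMeasure s) = ∫ ξ, (wt s ξ).toReal • f ξ :=
  integral_withDensity_eq_integral_toReal_smul (measurable_wt s)
    (Eventually.of_forall fun ξ => (wt_ne_top s ξ).lt_top) f

theorem inner_momSymbol (a b : HsHat s) :
    inner ℂ a ((momSymbol s hs.out).op b) =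
      ∫ ξ, ((1 + 2 * Real.pi * ξ : ℝ) : ℂ) * (starRingEnd ℂ (a ξ) * b ξ) := by
  rw [L2.inner_def, integral_wtMeasure]
  refine integral_congr_ae ?_
  filter_upwards [(momSymbol s hs.out).coe_op b] with ξ h
  have hne : ((1 + (2 * Real.pi * ξ) ^ 2) ^ s : ℝ) ≠ 0 := by positivity
  rw [h]
  simp only [wt, momSymbol, RCLike.inner_apply]
  rw [ENNReal.toReal_ofReal (by positivity), Complex.real_smul, Complex.ofReal_div]
  generalize (1 + (2 * Real.pi * ξ) ^ 2) ^ s = X at hne ⊢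
  have hne' : (X : ℂ) ≠ 0 := by exact_mod_cast hne
  field_simp

/-- Mass plus momentum. -/
def massMom (w : HsHat s) : ℂ := inner ℂ w ((momSymbol s hs.out).op w)

/-- Mass and momentum are conserved by the Szegő equation. -/
theorem massMom_const {w : ℝ → HsHat s} (hw : ∀ t, ∀ᵐ ξ : ℝ, ξ < 0 → w t ξ = 0)
    (hd : ∀ t, HasDerivAt w (-(Complex.I • szegoSymbol.op (cubicHat (w t)))) t) (t : ℝ) :
    (massMom (w t)).re = (massMom (w 0)).re := by
  -- The projector drops out of the pairing because `w t` has no negative frequencies. What remains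
  -- is `-i` times a number shown to be real by `im_integral_momentum`.
  have key : ∀ t, inner ℂ (w t) ((momSymbol s hs.out).op
      (-(Complex.I • szegoSymbol.op (cubicHat (w t))))) = -(Complex.I *
        ∫ ξ, ((1 + 2 * Real.pi * ξ : ℝ) : ℂ) *
          (starRingEnd ℂ (w t ξ) * conv (conv (w t) (starHat (w t))) (w t) ξ)) := fun t => by
    rw [map_neg, map_smul, inner_neg_right, inner_smul_right, inner_momSymbol]
    congr 2
    refine integral_congr_ae ?_
    filter_upwards [hw t, szegoSymbol.coe_op (cubicHat (w t)), coe_cubicHat (w t)] with ξ h1 h2 h3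
    rw [h2, h3]
    rcases lt_or_ge ξ 0 with h | h
    · simp [h1 h]
    · simp [szegoSymbol, h]
  have hsymm : ∀ a b : HsHat s, inner ℂ a ((momSymbol s hs.out).op b) =
      starRingEnd ℂ (inner ℂ b ((momSymbol s hs.out).op a)) := fun a b => by
    rw [inner_momSymbol, inner_momSymbol, ← integral_conj]
    refine integral_congr_ae (Eventually.of_forall fun ξ => ?_)
    simp only [map_mul, Complex.conj_conj, Complex.conj_ofReal]
    ring
  -- By symmetry of the form the derivative is twice the real part of the purely imaginary quantity
  -- in `key`.
  have hderiv : ∀ t, HasDerivAt (fun t => (massMom (w t)).re) 0 t := fun t => by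
    have h1 : HasDerivAt (fun t => (momSymbol s hs.out).op (w t)) ((momSymbol s hs.out).op
        (-(Complex.I • szegoSymbol.op (cubicHat (w t))))) t :=
      (((momSymbol s hs.out).op (s := s)).restrictScalars ℝ).hasFDerivAt.comp_hasDerivAt t (hd t)
    have h2 := (hd t).inner ℂ h1
    have h3 := Complex.reCLM.hasFDerivAt.comp_hasDerivAt t h2
    rw [hsymm (-(Complex.I • szegoSymbol.op (cubicHat (w t)))) (w t), key t] at h3
    have h4 := im_integral_momentum (w t)
    simp only [Complex.reCLM_apply, Complex.add_re, Complex.conj_re, Complex.neg_re, Complex.mul_re,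
      Complex.I_re, Complex.I_im, h4, zero_mul, mul_zero, sub_zero, neg_zero, add_zero] at h3
    exact h3
  exact is_const_of_deriv_eq_zero (fun t => (hderiv t).differentiableAt)
    (fun t => (hderiv t).deriv) t 0

/-- For `x ≥ 0` one has `√(1 + x²) ≤ 1 + x ≤ 2√(1 + x²)`, so mass plus momentum is equivalent to the
squared `H^{1/2}` norm on nonnegative frequencies. -/
theorem one_add_bounds {ξ : ℝ} (hξ : 0 ≤ ξ) :
    wt (1 / 2) ξ ≤ ENNReal.ofReal (1 + 2 * Real.pi * ξ) ∧
      ENNReal.ofReal (1 + 2 * Real.pi * ξ) ≤ 2 * wt (1 / 2) ξ := by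
  have hx : 0 ≤ 2 * Real.pi * ξ := by positivity
  simp only [wt, ← Real.sqrt_eq_rpow]
  constructor
  · refine ENNReal.ofReal_le_ofReal (Real.sqrt_le_left (by positivity) |>.2 ?_)
    nlinarith
  · have h2 : (2 : ℝ≥0∞) = ENNReal.ofReal 2 := by simp
    rw [h2, ← ENNReal.ofReal_mul (by norm_num)]
    refine ENNReal.ofReal_le_ofReal ?_
    refine le_of_sq_le_sq ?_ (by positivity)
    rw [mul_pow, Real.sq_sqrt (jap_pos ξ).le]
    nlinarith [sq_nonneg (1 - 2 * Real.pi * ξ)]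

theorem ofReal_massMom {w : HsHat s} (hw : ∀ᵐ ξ : ℝ, ξ < 0 → w ξ = 0) :
    ENNReal.ofReal (massMom w).re = ∫⁻ ξ, ENNReal.ofReal (1 + 2 * Real.pi * ξ) * ‖w ξ‖ₑ ^ 2 := by
  have h1 : massMom w = ((∫ ξ, (1 + 2 * Real.pi * ξ) * ‖w ξ‖ ^ 2 : ℝ) : ℂ) := by
    rw [massMom, inner_momSymbol, ← integral_complex_ofReal]
    refine integral_congr_ae (Eventually.of_forall fun ξ => ?_)
    simp only
    rw [Complex.conj_mul']
    push_cast
    ring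
  have hpos : ∀ᵐ ξ : ℝ, 0 ≤ (1 + 2 * Real.pi * ξ) * ‖w ξ‖ ^ 2 := hw.mono fun ξ h => by
    rcases lt_or_ge ξ 0 with h' | h'
    · simp [h h']
    · positivity
  have hle : ∀ᵐ ξ : ℝ, ENNReal.ofReal ((1 + 2 * Real.pi * ξ) * ‖w ξ‖ ^ 2) =
      ENNReal.ofReal (1 + 2 * Real.pi * ξ) * ‖w ξ‖ₑ ^ 2 := Eventually.of_forall fun ξ => by
    rw [ENNReal.ofReal_mul' (by positivity), ENNReal.ofReal_pow (norm_nonneg _), ofReal_norm]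
  have hm : AEStronglyMeasurable (fun ξ : ℝ => (1 + 2 * Real.pi * ξ) * ‖w ξ‖ ^ 2) volume := by
    have h1 : Measurable fun ξ : ℝ => 1 + 2 * Real.pi * ξ := by fun_prop
    exact h1.aestronglyMeasurable.mul (w.aesm.norm.pow 2)
  rw [h1, Complex.ofReal_re]
  rw [ofReal_integral_eq_lintegral_ofReal ?_ hpos]
  · exact lintegral_congr_ae hle
  · refine ⟨hm, ?_⟩
    rw [hasFiniteIntegral_iff_ofReal hpos, lintegral_congr_ae hle]
    refine lt_of_le_of_lt (lintegral_mono_ae (g := fun ξ => 2 * (wt s ξ * ‖w ξ‖ₑ ^ 2)) ?_) ?_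
    · refine hw.mono fun ξ h => ?_
      rcases lt_or_ge ξ 0 with h' | h'
      · simp [h h']
      · rw [← mul_assoc]
        gcongr
        exact (one_add_bounds h').2.trans (by gcongr; exact wt_mono hs.out.le ξ)
    · rw [lintegral_const_mul' _ _ (by norm_num)]
      exact ENNReal.mul_lt_top (by norm_num) w.energy_lt_top

/-- The `H^{1/2}` norm is almost conserved by the Szegő equation. -/
theorem energy_half_le {w : ℝ → HsHat s} (hw : ∀ t, ∀ᵐ ξ : ℝ, ξ < 0 → w t ξ = 0)
    (hd : ∀ t, HasDerivAt w (-(Complex.I • szegoSymbol.op (cubicHat (w t)))) t) (t : ℝ) :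
    energy (1 / 2) (w t) ≤ 2 * energy (1 / 2) (w 0) := by
  calc energy (1 / 2) (w t)
      ≤ ∫⁻ ξ, ENNReal.ofReal (1 + 2 * Real.pi * ξ) * ‖w t ξ‖ₑ ^ 2 := by
        refine lintegral_mono_ae ((hw t).mono fun ξ h => ?_)
        rcases lt_or_ge ξ 0 with h' | h'
        · simp [h h']
        · gcongr
          exact (one_add_bounds h').1
    _ = ∫⁻ ξ, ENNReal.ofReal (1 + 2 * Real.pi * ξ) * ‖w 0 ξ‖ₑ ^ 2 := by
        rw [← ofReal_massMom (hw t), massMom_const hw hd t, ofReal_massMom (hw 0)]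
    _ ≤ ∫⁻ ξ, 2 * (wt (1 / 2) ξ * ‖w 0 ξ‖ₑ ^ 2) := by
        refine lintegral_mono_ae ((hw 0).mono fun ξ h => ?_)
        rcases lt_or_ge ξ 0 with h' | h'
        · simp [h h']
        · rw [← mul_assoc]
          gcongr
          exact (one_add_bounds h').2
    _ = _ := by rw [lintegral_const_mul' _ _ (by norm_num), energy]

end

section

/-! ### Bounds for the nonlinearity and its derivative -/

variable {s : ℝ} [hs : Fact (1 / 2 < s)]

/-- Read off in physical space, where convolution becomes pointwise multiplication. -/
theorem convL_assoc (a b c : HsHat s) : convL (convL a b) c = convL a (convL b c) := by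
  refine invFourier_injective (Lp.ext ?_)
  filter_upwards [invFourier_convL (convL a b) c, invFourier_convL a b,
    invFourier_convL a (convL b c), invFourier_convL b c] with x h1 h2 h3 h4
  rw [h1, h2, h3, h4, mul_assoc]

/-- The square of the constant in the algebra property of `H^s`. -/
def algSq (s : ℝ) : ℝ := (algConst s).toReal

theorem algSq_nonneg {s : ℝ} : 0 ≤ algSq s := ENNReal.toReal_nonneg

theorem norm_convL_le (a b : HsHat s) : ‖convL a b‖ ≤ Real.sqrt (algSq s) * ‖a‖ * ‖b‖ :=
  a.norm_convMk_le b

theorem norm_convL_convL_le (a b c : HsHat s) :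
    ‖convL (convL a b) c‖ ≤ algSq s * (‖a‖ * ‖b‖ * ‖c‖) := by
  calc ‖convL (convL a b) c‖ ≤ Real.sqrt (algSq s) * ‖convL a b‖ * ‖c‖ := norm_convL_le _ _
    _ ≤ Real.sqrt (algSq s) * (Real.sqrt (algSq s) * ‖a‖ * ‖b‖) * ‖c‖ := by
        gcongr; exact norm_convL_le a b
    _ = Real.sqrt (algSq s) ^ 2 * (‖a‖ * ‖b‖ * ‖c‖) := by ring
    _ = _ := by rw [Real.sq_sqrt algSq_nonneg]

/-- The derivative of `cubicHat` at `a` in the direction `x`. -/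
def cubicDeriv (a x : HsHat s) : HsHat s :=
  convL (convL x (starL a)) a + convL (convL a (starL x)) a + convL (convL a (starL a)) x

theorem norm_cubicHat_le (a : HsHat s) : ‖cubicHat a‖ ≤ algSq s * ‖a‖ ^ 3 := by
  refine (norm_convL_convL_le _ _ _).trans (le_of_eq ?_)
  rw [norm_starL]; ring

theorem norm_cubicDeriv_le (a x : HsHat s) : ‖cubicDeriv a x‖ ≤ 3 * algSq s * (‖a‖ ^ 2 * ‖x‖) := by
  have h1 := norm_convL_convL_le x (starL a) a
  have h2 := norm_convL_convL_le a (starL x) a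
  have h3 := norm_convL_convL_le a (starL a) x
  rw [norm_starL] at h1 h2 h3
  refine (norm_add₃_le).trans ((add_le_add (add_le_add h1 h2) h3).trans (le_of_eq ?_))
  ring

theorem norm_cubicHat_sub_le (a b : HsHat s) :
    ‖cubicHat a - cubicHat b‖ ≤ algSq s * (‖a‖ + ‖b‖) ^ 2 * ‖a - b‖ := by
  -- Telescoping, one factor replaced at a time.
  have h : cubicHat a - cubicHat b = convL (convL a (starL a)) (a - b) +
      convL (convL a (starL (a - b))) b + convL (convL (a - b) (starL b)) b := by
    simp only [cubicHat, map_sub, sub_apply]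
    abel
  have h1 := norm_convL_convL_le a (starL a) (a - b)
  have h2 := norm_convL_convL_le a (starL (a - b)) b
  have h3 := norm_convL_convL_le (a - b) (starL b) b
  rw [norm_starL] at h1 h2 h3
  rw [h]
  refine (norm_add₃_le).trans ((add_le_add (add_le_add h1 h2) h3).trans ?_)
  have h4 : 0 ≤ algSq s * (‖a‖ * ‖b‖ * ‖a - b‖) := mul_nonneg algSq_nonneg (by positivity)
  nlinarith

theorem isBoundedBilinearMap_convL :
    IsBoundedBilinearMap ℝ fun p : HsHat s × HsHat s => convL p.1 p.2 where
  add_left x y z := by simp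
  smul_left c x y := by
    rw [ContinuousLinearMap.map_smul_of_tower, smul_apply]
  add_right x y z := by simp
  smul_right c x y := ContinuousLinearMap.map_smul_of_tower _ _ _
  bound := ⟨Real.sqrt (algSq s) + 1, by positivity, fun a b => (norm_convL_le a b).trans (by
    gcongr
    linarith)⟩

theorem hasDerivAt_convL {x y : ℝ → HsHat s} {x' y' : HsHat s} {t : ℝ} (hx : HasDerivAt x x' t)
    (hy : HasDerivAt y y' t) :
    HasDerivAt (fun t => convL (x t) (y t)) (convL (x t) y' + convL x' (y t)) t := by
  have h := (isBoundedBilinearMap_convL.hasFDerivAt (x t, y t)).comp_hasDerivAt t (hx.prodMk hy)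
  exact h

theorem hasDerivAt_cubicHat {w : ℝ → HsHat s} {w' : HsHat s} {t : ℝ} (hw : HasDerivAt w w' t) :
    HasDerivAt (fun t => cubicHat (w t)) (cubicDeriv (w t) w') t := by
  have h1 : HasDerivAt (fun t => starL (w t)) (starL w') t :=
    starL.hasFDerivAt.comp_hasDerivAt t hw
  have h2 := hasDerivAt_convL (hasDerivAt_convL hw h1) hw
  have h3 : cubicDeriv (w t) w' = convL (convL (w t) (starL (w t))) w' +
      convL (convL (w t) (starL w') + convL w' (starL (w t))) (w t) := by
    rw [cubicDeriv, map_add, add_apply]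
    abel
  rw [h3]
  exact h2

theorem continuous_convL {x y : ℝ → HsHat s} (hx : Continuous x) (hy : Continuous y) :
    Continuous fun t => convL (x t) (y t) :=
  isBoundedBilinearMap_convL.continuous.comp (hx.prodMk hy)

theorem continuous_cubicHat {x : ℝ → HsHat s} (hx : Continuous x) :
    Continuous fun t => cubicHat (x t) :=
  continuous_convL (continuous_convL hx (starL.continuous.comp hx)) hx

theorem continuous_cubicDeriv {x y : ℝ → HsHat s} (hx : Continuous x) (hy : Continuous y) :
    Continuous fun t => cubicDeriv (x t) (y t) :=
  ((continuous_convL (continuous_convL hy (starL.continuous.comp hx)) hx).add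
    (continuous_convL (continuous_convL hx (starL.continuous.comp hy)) hx)).add
    (continuous_convL (continuous_convL hx (starL.continuous.comp hx)) hy)

/-! ### Bounds depending only on the `H^{1/2}` norm -/

/-- A real majorant of `convConst`. -/
def supConst : ℝ := convConst.toReal + 1

theorem one_le_supConst : 1 ≤ supConst := by
  have : 0 ≤ convConst.toReal := ENNReal.toReal_nonneg
  unfold supConst
  linarith

theorem convConst_le : convConst ≤ ENNReal.ofReal supConst := by
  rw [← ENNReal.ofReal_toReal convConst_lt_top.ne]
  exact ENNReal.ofReal_le_ofReal (by unfold supConst; linarith)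

theorem energy_starL {s : ℝ} (σ : ℝ) (a : HsHat s) : energy σ (starL a) = energy σ a := by
  rw [energy_congr (coe_starL a), energy_starHat]

theorem energy_quarter_convL_le {a b : HsHat s} {m : ℝ}
    (ha : energy (1 / 2) a ≤ ENNReal.ofReal (m ^ 2))
    (hb : energy (1 / 2) b ≤ ENNReal.ofReal (m ^ 2)) :
    energy (1 / 4) (convL a b) ≤ ENNReal.ofReal (supConst * m ^ 4) := by
  rw [energy_congr (coe_convL a b)]
  refine (energy_conv_half_half a.aesm b.aesm).trans ?_
  calc _ ≤ ENNReal.ofReal supConst * (ENNReal.ofReal (m ^ 2) * ENNReal.ofReal (m ^ 2)) := by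
        gcongr; exact convConst_le
    _ = _ := by
        rw [← ENNReal.ofReal_mul (by positivity), ← ENNReal.ofReal_mul
          (by linarith [one_le_supConst])]
        ring_nf

theorem norm_le_of_enorm_sq_le {z : ℂ} {c : ℝ} (hc : 0 ≤ c) (h : ‖z‖ₑ ^ 2 ≤ ENNReal.ofReal (c ^ 2)) :
    ‖z‖ ≤ c := by
  rw [← ofReal_norm, ← ENNReal.ofReal_pow (norm_nonneg _),
    ENNReal.ofReal_le_ofReal_iff (by positivity)] at h
  exact le_of_sq_le_sq h hc

/-- The third factor is needed only in `L²`: it will hold the time derivative of the solution, which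
the `H^{1/2}` norm controls in `L²` but not in `H^{1/2}`. -/
theorem ae_norm_convL_convL_le {a b c : HsHat s} {m n : ℝ} (hn : 0 ≤ n)
    (ha : energy (1 / 2) a ≤ ENNReal.ofReal (m ^ 2))
    (hb : energy (1 / 2) b ≤ ENNReal.ofReal (m ^ 2))
    (hc : energy 0 c ≤ ENNReal.ofReal (n ^ 2)) :
    ∀ᵐ ξ, ‖convL (convL a b) c ξ‖ ≤ supConst * m ^ 2 * n := by
  have hD := one_le_supConst
  filter_upwards [coe_convL (convL a b) c] with ξ h
  rw [h]
  refine norm_le_of_enorm_sq_le (by positivity) ?_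
  calc _ ≤ energy 0 (convL a b) * energy 0 c := sq_enorm_conv_le (convL a b).aesm c.aesm ξ
    _ ≤ ENNReal.ofReal (supConst * m ^ 4) * ENNReal.ofReal (n ^ 2) := by
        gcongr
        exact (energy_mono (by norm_num) _).trans (energy_quarter_convL_le ha hb)
    _ = ENNReal.ofReal (supConst * (m ^ 4 * n ^ 2)) := by
        rw [← ENNReal.ofReal_mul (by positivity)]
        ring_nf
    _ ≤ _ := by
        refine ENNReal.ofReal_le_ofReal ?_
        have : 0 ≤ m ^ 4 * n ^ 2 := by positivity
        nlinarith

theorem energy_zero_cubicHat_le {a : HsHat s} {m : ℝ}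
    (ha : energy (1 / 2) a ≤ ENNReal.ofReal (m ^ 2)) :
    energy 0 (cubicHat a) ≤ ENNReal.ofReal ((supConst * m ^ 3) ^ 2) := by
  have hD := one_le_supConst
  have ha' : energy (1 / 2) (starL a) ≤ ENNReal.ofReal (m ^ 2) := by rwa [energy_starL]
  rw [cubicHat, energy_congr (coe_convL _ a)]
  refine (energy_conv_quarter_half (convL a (starL a)).aesm a.aesm).trans ?_
  calc _ ≤ ENNReal.ofReal supConst * (ENNReal.ofReal (supConst * m ^ 4) * ENNReal.ofReal (m ^ 2)) := by
        gcongr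
        · exact convConst_le
        · exact energy_quarter_convL_le ha ha'
    _ = _ := by
        rw [← ENNReal.ofReal_mul (by positivity), ← ENNReal.ofReal_mul (by positivity)]
        ring_nf

theorem ae_norm_cubicHat_le {a : HsHat s} {m : ℝ} (hm : 0 ≤ m)
    (ha : energy (1 / 2) a ≤ ENNReal.ofReal (m ^ 2)) :
    ∀ᵐ ξ, ‖cubicHat a ξ‖ ≤ supConst * m ^ 3 := by
  refine (ae_norm_convL_convL_le hm ha (by rwa [energy_starL])
    ((energy_mono (by norm_num) _).trans ha)).mono fun ξ h => h.trans (le_of_eq (by ring))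

theorem ae_norm_cubicDeriv_le {a x : HsHat s} {m n : ℝ} (hn : 0 ≤ n)
    (ha : energy (1 / 2) a ≤ ENNReal.ofReal (m ^ 2)) (hx : energy 0 x ≤ ENNReal.ofReal (n ^ 2)) :
    ∀ᵐ ξ, ‖cubicDeriv a x ξ‖ ≤ 3 * (supConst * m ^ 2 * n) := by
  have ha' : energy (1 / 2) (starL a) ≤ ENNReal.ofReal (m ^ 2) := by rwa [energy_starL]
  -- Reordering puts the direction `x`, known only in `L²`, in the last slot.
  have e1 : convL (convL x (starL a)) a = convL (convL a (starL a)) x := by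
    rw [convL_assoc, convL_comm x, convL_comm (starL a)]
  have e2 : convL (convL a (starL x)) a = convL (convL a a) (starL x) := by
    rw [convL_assoc, convL_comm (starL x), ← convL_assoc]
  filter_upwards [ae_norm_convL_convL_le hn ha ha' hx,
    ae_norm_convL_convL_le hn ha ha (c := starL x) (by rwa [energy_starL]),
    HsHat.coe_add (convL (convL x (starL a)) a + convL (convL a (starL x)) a)
      (convL (convL a (starL a)) x),
    HsHat.coe_add (convL (convL x (starL a)) a) (convL (convL a (starL x)) a)] with ξ h1 h2 h3 h4
  rw [cubicDeriv, h3, h4, e1, e2]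
  refine norm_add₃_le.trans ?_
  linarith

/-! ### The equations on the Fourier side -/

theorem ae_eq_zero_of_memHsPlus {w : HsHat s} (h : MemHsPlus s (invFourier w)) :
    ∀ᵐ ξ : ℝ, ξ < 0 → w ξ = 0 := by
  filter_upwards [h.2, coe_fourier_invFourier w] with ξ h1 h2 h3
  rw [← h2]
  exact h1 h3

theorem hasDerivAt_integral_of_continuous {s : ℝ} {f : ℝ → HsHat s} (hf : Continuous f) (t : ℝ) :
    HasDerivAt (fun t => ∫ τ in (0 : ℝ)..t, f τ) (f t) t :=
  intervalIntegral.integral_hasDerivAt_right (hf.intervalIntegrable 0 t)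
    hf.stronglyMeasurable.stronglyMeasurableAtFilter hf.continuousAt

theorem norm_szegoSymbol_op_le {s : ℝ} (a : HsHat s) : ‖szegoSymbol.op a‖ ≤ ‖a‖ := by
  refine (szegoSymbol.norm_op_le zero_le_one (fun ξ => ?_) a).trans (one_mul _).le
  by_cases h : ξ ∈ Set.Ici (0 : ℝ) <;> simp [szegoSymbol, h]

theorem energy_szegoSymbol_op_le {s : ℝ} (σ : ℝ) (a : HsHat s) :
    energy σ (szegoSymbol.op a) ≤ energy σ a := by
  refine energy_le_of_norm_le ((szegoSymbol.coe_op a).mono fun ξ h => ?_)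
  rw [h]
  by_cases h : ξ ∈ Set.Ici (0 : ℝ) <;> simp [szegoSymbol, h]

/-- A solution of the Szegő equation is `C¹` with values in `H^s`. -/
theorem IsSzegoSolution.hasDerivAt_lift {W₀ : L2} {W : ℝ → L2} (hW : IsSzegoSolution s W₀ W)
    {w : ℝ → HsHat s} (hwc : Continuous w) (hw : ∀ t, invFourier (w t) = W t) (t : ℝ) :
    HasDerivAt w (-(Complex.I • szegoSymbol.op (cubicHat (w t)))) t := by
  set f : ℝ → HsHat s := fun t => -(Complex.I • szegoSymbol.op (cubicHat (w t))) with hf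
  have hfc : Continuous f :=
    (((szegoSymbol.op).continuous.comp (continuous_cubicHat hwc)).const_smul Complex.I).neg
  have hJ : ∀ t, invFourier (f t) = deriv W t := fun t => by
    have h1 := hW.equation t
    rw [← hw t, cubic_invFourier, szego_invFourier] at h1
    rw [hf]
    simp only [map_neg, map_smul]
    rw [← h1, smul_smul, Complex.I_mul_I, neg_one_smul, neg_neg]
  -- The derivative is known in `L²` only, but it is the image of a continuous curve in `HsHat s`.
  -- Integrating in `L²` and using injectivity of `invFourier` gives an integral equation in `HsHat
  -- s`, which can be differentiated there.
  have hint : ∀ t, w t = w 0 + ∫ τ in (0 : ℝ)..t, f τ := fun t => by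
    refine invFourier_injective ?_
    have hderiv : deriv W = fun t => invFourier (f t) := funext fun t => (hJ t).symm
    have h2 := intervalIntegral.integral_eq_sub_of_hasDerivAt
      (fun τ _ => (hW.differentiable τ).hasDerivAt) (a := 0) (b := t)
      ((by rw [hderiv]; exact invFourier.continuous.comp hfc : Continuous (deriv W)).intervalIntegrable
        0 t)
    have h3 : ∫ τ in (0 : ℝ)..t, invFourier (f τ) = invFourier (∫ τ in (0 : ℝ)..t, f τ) :=
      invFourier.intervalIntegral_comp_comm (hfc.intervalIntegrable 0 t)
    rw [map_add, hw, hw, ← h3, ← hderiv, h2]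
    abel
  have h4 := (hasDerivAt_integral_of_continuous hfc t).const_add (w 0)
  exact h4.congr_of_eventuallyEq (Eventually.of_forall hint)

theorem norm_propSymbol_le (t ξ : ℝ) : ‖(propSymbol t).toFun ξ‖ ≤ 1 := (norm_propagatorSymbol t ξ).le

theorem continuous_propSymbol (ξ : ℝ) : Continuous fun t => (propSymbol t).toFun ξ := by
  simp only [propSymbol]; fun_prop

theorem propSymbol_op_op {s : ℝ} (t t' : ℝ) (a : HsHat s) :
    (propSymbol t).op ((propSymbol t').op a) = (propSymbol (t + t')).op a := by
  refine HsHat.ext ?_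
  filter_upwards [(propSymbol t).coe_op ((propSymbol t').op a), (propSymbol t').coe_op a,
    (propSymbol (t + t')).coe_op a] with ξ h1 h2 h3
  rw [h1, h2, h3, ← mul_assoc]
  congr 1
  simp only [propSymbol]
  rw [← Complex.exp_add]
  congr 1
  push_cast
  ring

theorem propSymbol_zero_op {s : ℝ} (a : HsHat s) : (propSymbol 0).op a = a := by
  refine HsHat.ext ?_
  filter_upwards [(propSymbol 0).coe_op a] with ξ h
  rw [h]
  simp [propSymbol]

/-- Duhamel's formula in the interaction representation. -/
theorem IsNLWSolution.duhamel_lift {w₀ : HsHat s} {v : ℝ → L2}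
    (hv : IsNLWSolution s (invFourier w₀) v) {ν : ℝ → HsHat s} (hνc : Continuous ν)
    (hν : ∀ t, invFourier (ν t) = v t) (t : ℝ) :
    (propSymbol (-t)).op (ν t) =
      w₀ - Complex.I • ∫ τ in (0 : ℝ)..t, (propSymbol (-τ)).op (cubicHat (ν τ)) := by
  have hc : Continuous fun τ => (propSymbol (t - τ)).op (cubicHat (ν τ)) :=
    Symbol.continuous_op (m := fun τ => propSymbol (t - τ)) zero_le_one
      (fun τ => norm_propSymbol_le (t - τ))
      (fun ξ => (continuous_propSymbol ξ).comp (continuous_const.sub continuous_id))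
      (continuous_cubicHat hνc)
  have h1 : ν t = (propSymbol t).op w₀ -
      Complex.I • ∫ τ in (0 : ℝ)..t, (propSymbol (t - τ)).op (cubicHat (ν τ)) := by
    refine invFourier_injective ?_
    have h2 : ∫ τ in (0 : ℝ)..t, invFourier ((propSymbol (t - τ)).op (cubicHat (ν τ))) =
        invFourier (∫ τ in (0 : ℝ)..t, (propSymbol (t - τ)).op (cubicHat (ν τ))) :=
      invFourier.intervalIntegral_comp_comm (hc.intervalIntegrable 0 t)
    rw [map_sub, map_smul, ← h2, hν, hv.duhamel t, propagator_invFourier]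
    congr 2
    refine intervalIntegral.integral_congr fun τ _ => ?_
    rw [← hν τ, cubic_invFourier, propagator_invFourier]
  have h3 : (propSymbol (-t)).op (∫ τ in (0 : ℝ)..t, (propSymbol (t - τ)).op (cubicHat (ν τ))) =
      ∫ τ in (0 : ℝ)..t, (propSymbol (-τ)).op (cubicHat (ν τ)) := by
    rw [← (propSymbol (-t)).op.intervalIntegral_comp_comm (hc.intervalIntegrable 0 t)]
    refine intervalIntegral.integral_congr fun τ _ => ?_
    have h4 : -t + (t - τ) = -τ := by ring
    simp only [propSymbol_op_op, h4]
  rw [h1, map_sub, map_smul, h3, propSymbol_op_op, neg_add_cancel, propSymbol_zero_op]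

end

section

/-! ### Grönwall's inequality and a continuity argument -/

/-- Grönwall in integral form: the right-hand side times `e^{-kt}` is nonincreasing. -/
theorem le_exp_of_le_integral {f : ℝ → ℝ} (hf : Continuous f) {ρ k T : ℝ} (hk : 0 ≤ k)
    (h : ∀ t, 0 ≤ t → t ≤ T → f t ≤ ρ + k * ∫ τ in (0 : ℝ)..t, f τ) {t : ℝ} (ht : 0 ≤ t)
    (htT : t ≤ T) : f t ≤ ρ * Real.exp (k * t) := by
  set G : ℝ → ℝ := fun t => ρ + k * ∫ τ in (0 : ℝ)..t, f τ with hG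
  have hGd : ∀ t, HasDerivAt G (k * f t) t := fun t =>
    ((intervalIntegral.integral_hasDerivAt_right (hf.intervalIntegrable 0 t)
      hf.stronglyMeasurable.stronglyMeasurableAtFilter hf.continuousAt).const_mul k).const_add ρ
  have hE : ∀ t, HasDerivAt (fun t => G t * Real.exp (-(k * t)))
      (k * f t * Real.exp (-(k * t)) + G t * (Real.exp (-(k * t)) * -k)) t := fun t =>
    (hGd t).mul (by
      have : HasDerivAt (fun t => -(k * t)) (-k) t := by
        have h1 := ((hasDerivAt_id t).const_mul k).neg
        rw [mul_one] at h1
        exact h1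
      exact this.exp)
  have hanti : AntitoneOn (fun t => G t * Real.exp (-(k * t))) (Set.Icc 0 T) := by
    refine antitoneOn_of_deriv_nonpos (convex_Icc 0 T)
      (fun t _ => (hE t).continuousAt.continuousWithinAt)
      (fun t _ => (hE t).differentiableAt.differentiableWithinAt) fun t ht' => ?_
    rw [interior_Icc] at ht'
    rw [(hE t).deriv]
    have h1 : f t ≤ G t := h t ht'.1.le ht'.2.le
    have h2 : 0 ≤ k * Real.exp (-(k * t)) * (G t - f t) :=
      mul_nonneg (by positivity) (by linarith)
    nlinarith
  have h3 := hanti (Set.mem_Icc.2 ⟨le_refl 0, ht.trans htT⟩) (Set.mem_Icc.2 ⟨ht, htT⟩) ht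
  have h0 : G 0 = ρ := by simp [hG]
  simp only [h0, mul_zero, neg_zero, Real.exp_zero, mul_one] at h3
  have h4 : G t * Real.exp (-(k * t)) * Real.exp (k * t) = G t := by
    rw [mul_assoc, ← Real.exp_add]; simp
  calc f t ≤ G t := h t ht htT
    _ = G t * Real.exp (-(k * t)) * Real.exp (k * t) := h4.symm
    _ ≤ ρ * Real.exp (k * t) := by gcongr

/-- If `f` ever exceeded `β`, then at the first time where `f = β` the integral inequality would
still hold on the whole past, and Grönwall would give a value strictly below `β`. -/
theorem le_exp_of_bootstrap {f : ℝ → ℝ} (hf : Continuous f) (hf0 : f 0 = 0)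
    {ρ k T β : ℝ} (hρ : 0 ≤ ρ) (hk : 0 ≤ k) (hβ : ρ * Real.exp (k * T) < β)
    (h : ∀ t, 0 ≤ t → t ≤ T → (∀ τ, 0 ≤ τ → τ ≤ t → f τ ≤ β) →
      f t ≤ ρ + k * ∫ τ in (0 : ℝ)..t, f τ) {t : ℝ} (ht : 0 ≤ t) (htT : t ≤ T) :
    f t ≤ ρ * Real.exp (k * T) := by
  have hexp : ∀ {t'}, t' ≤ T → ρ * Real.exp (k * t') ≤ ρ * Real.exp (k * T) := fun ht' => by
    gcongr
  have hgron : ∀ t', 0 ≤ t' → t' ≤ T → (∀ τ, 0 ≤ τ → τ ≤ t' → f τ ≤ β) →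
      f t' ≤ ρ * Real.exp (k * T) := fun t' h0 hT hle =>
    (le_exp_of_le_integral (T := t') hf hk (fun τ h1 h2 => h τ h1 (h2.trans hT)
      fun σ h3 h4 => hle σ h3 (h4.trans h2)) h0 le_rfl).trans (hexp hT)
  have hβ0 : 0 < β := lt_of_le_of_lt (by positivity) hβ
  refine hgron t ht htT fun τ h1 h2 => ?_
  by_contra! hcon
  set S : Set ℝ := Set.Icc 0 τ ∩ f ⁻¹' Set.Ici β with hS
  have hSc : IsCompact S := isCompact_Icc.inter_right (isClosed_Ici.preimage hf)
  obtain ⟨t₁, ht₁, hmin⟩ := hSc.exists_isLeast ⟨τ, ⟨h1, le_rfl⟩, hcon.le⟩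
  have heq : f t₁ = β := by
    obtain ⟨c, hc, hfc⟩ := intermediate_value_Icc ht₁.1.1 hf.continuousOn
      (show β ∈ Set.Icc (f 0) (f t₁) from ⟨by rw [hf0]; exact hβ0.le, ht₁.2⟩)
    have hcS : c ∈ S := ⟨⟨hc.1, hc.2.trans ht₁.1.2⟩, hfc.ge⟩
    rw [le_antisymm (hmin hcS) hc.2, hfc]
  have hlt : f t₁ ≤ ρ * Real.exp (k * T) :=
    hgron t₁ ht₁.1.1 (ht₁.1.2.trans (h2.trans htT)) fun σ h3 h4 => by
      by_contra! h5
      have : t₁ ≤ σ := hmin ⟨⟨h3, h4.trans ht₁.1.2⟩, h5.le⟩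
      rw [le_antisymm h4 this, heq] at h5
      exact lt_irrefl _ h5
  linarith

/-! ### Comparison of the two equations -/

variable {s : ℝ} [hs : Fact (1 / 2 < s)]

/-- The difference of the two solutions, in the interaction representation. -/
theorem interaction_diff {κ : ℝ} (hκ : 0 ≤ κ) {w₀ : HsHat s} {ν w : ℝ → HsHat s}
    (hνc : Continuous ν) (hwc : Continuous w) (hw0 : w 0 = w₀)
    (hν : ∀ t, (propSymbol (-t)).op (ν t) =
      w₀ - Complex.I • ∫ τ in (0 : ℝ)..t, (propSymbol (-τ)).op (cubicHat (ν τ)))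
    (hd : ∀ t, HasDerivAt w (-(Complex.I • szegoSymbol.op (cubicHat (w t)))) t)
    (hw : ∀ t, ∀ᵐ ξ : ℝ, ξ < 0 → w t ξ = 0) (t : ℝ) :
    (propSymbol (-t)).op (ν t) - w t =
      -(Complex.I • ∫ τ in (0 : ℝ)..t, (propSymbol (-τ)).op
          (cubicHat (ν τ) - cubicHat ((propSymbol τ).op (w τ)))) -
        Complex.I • ∫ τ in (0 : ℝ)..t,
          ((oscLow κ τ).op (cubicHat (w τ)) + (oscHigh κ τ).op (cubicHat (w τ))) := by
  have hg := continuous_cubicHat hwc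
  have hP : ∀ {x : ℝ → HsHat s}, Continuous x → Continuous fun τ => (propSymbol (-τ)).op (x τ) :=
    fun hx => Symbol.continuous_op (m := fun τ => propSymbol (-τ)) zero_le_one
      (fun τ => norm_propSymbol_le (-τ)) (fun ξ => (continuous_propSymbol ξ).comp continuous_neg) hx
  have c1 : Continuous fun τ => (propSymbol (-τ)).op (cubicHat (ν τ)) := hP (continuous_cubicHat hνc)
  have c2 : Continuous fun τ => (propSymbol (-τ)).op (cubicHat ((propSymbol τ).op (w τ))) :=
    hP (continuous_cubicHat (Symbol.continuous_op zero_le_one norm_propSymbol_le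
      continuous_propSymbol hwc))
  have c3 : Continuous fun τ => szegoSymbol.op (cubicHat (w τ)) := szegoSymbol.op.continuous.comp hg
  have c4 : Continuous fun τ =>
      (oscLow κ τ).op (cubicHat (w τ)) + (oscHigh κ τ).op (cubicHat (w τ)) :=
    (Symbol.continuous_op zero_le_one (norm_oscLow_le κ) (continuous_oscLow κ) hg).add
      (Symbol.continuous_op zero_le_one (norm_oscHigh_le κ) (continuous_oscHigh κ) hg)
  have hwint : w t = w₀ - Complex.I • ∫ τ in (0 : ℝ)..t, szegoSymbol.op (cubicHat (w τ)) := by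
    have h1 := intervalIntegral.integral_eq_sub_of_hasDerivAt (fun τ _ => hd τ)
      (((c3.const_smul Complex.I).neg).intervalIntegrable 0 t)
    rw [intervalIntegral.integral_neg, intervalIntegral.integral_smul, hw0] at h1
    rw [sub_eq_add_neg, h1]
    abel
  have hsplit : ∫ τ in (0 : ℝ)..t, (propSymbol (-τ)).op (cubicHat ((propSymbol τ).op (w τ))) =
      (∫ τ in (0 : ℝ)..t, szegoSymbol.op (cubicHat (w τ))) + ∫ τ in (0 : ℝ)..t,
          ((oscLow κ τ).op (cubicHat (w τ)) + (oscHigh κ τ).op (cubicHat (w τ))) := by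
    rw [← intervalIntegral.integral_add (c3.intervalIntegrable 0 t) (c4.intervalIntegrable 0 t)]
    exact intervalIntegral.integral_congr fun τ _ => propSymbol_cubicHat hκ τ (hw τ)
  have hsub : ∫ τ in (0 : ℝ)..t, (propSymbol (-τ)).op
          (cubicHat (ν τ) - cubicHat ((propSymbol τ).op (w τ))) =
      (∫ τ in (0 : ℝ)..t, (propSymbol (-τ)).op (cubicHat (ν τ))) -
        ∫ τ in (0 : ℝ)..t, (propSymbol (-τ)).op (cubicHat ((propSymbol τ).op (w τ))) := by
    rw [← intervalIntegral.integral_sub (c1.intervalIntegrable 0 t) (c2.intervalIntegrable 0 t)]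
    exact intervalIntegral.integral_congr fun τ _ => map_sub _ _ _
  rw [hν t, hwint, hsub, hsplit, smul_sub, smul_add]
  abel

theorem norm_interaction_sub {s : ℝ} (τ : ℝ) (a b : HsHat s) :
    ‖(propSymbol (-τ)).op a - b‖ = ‖a - (propSymbol τ).op b‖ := by
  rw [← norm_propSymbol_op (-τ) (a - (propSymbol τ).op b), map_sub, propSymbol_op_op,
    neg_add_cancel, propSymbol_zero_op]

/-- Stability of the interaction representation, under a bound on the oscillating part. -/
theorem norm_interaction_diff_le {κ : ℝ} (hκ : 0 ≤ κ) {w₀ : HsHat s} {ν w : ℝ → HsHat s}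
    (hνc : Continuous ν) (hwc : Continuous w) (hw0 : w 0 = w₀)
    (hν : ∀ t, (propSymbol (-t)).op (ν t) =
      w₀ - Complex.I • ∫ τ in (0 : ℝ)..t, (propSymbol (-τ)).op (cubicHat (ν τ)))
    (hd : ∀ t, HasDerivAt w (-(Complex.I • szegoSymbol.op (cubicHat (w t)))) t)
    (hw : ∀ t, ∀ᵐ ξ : ℝ, ξ < 0 → w t ξ = 0) {b β ρ T : ℝ} (hb : ∀ t, ‖w t‖ ≤ b) (hρ : 0 ≤ ρ)
    (hR : ∀ t, 0 ≤ t → t ≤ T → ‖∫ τ in (0 : ℝ)..t,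
      ((oscLow κ τ).op (cubicHat (w τ)) + (oscHigh κ τ).op (cubicHat (w τ)))‖ ≤ ρ)
    (hβ : ρ * Real.exp (algSq s * (2 * b + β) ^ 2 * T) < β) {t : ℝ} (ht : 0 ≤ t) (htT : t ≤ T) :
    ‖(propSymbol (-t)).op (ν t) - w t‖ ≤ ρ * Real.exp (algSq s * (2 * b + β) ^ 2 * T) := by
  have hA : 0 ≤ algSq s := algSq_nonneg
  have hβ0 : 0 < β := lt_of_le_of_lt (by positivity) hβ
  have hb0 : 0 ≤ b := (norm_nonneg _).trans (hb 0)
  set d : ℝ → HsHat s := fun t => (propSymbol (-t)).op (ν t) - w t with hdd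
  have hdc : Continuous d :=
    (Symbol.continuous_op (m := fun τ => propSymbol (-τ)) zero_le_one
      (fun τ => norm_propSymbol_le (-τ)) (fun ξ => (continuous_propSymbol ξ).comp continuous_neg)
      hνc).sub hwc
  refine le_exp_of_bootstrap (f := fun t => ‖d t‖) hdc.norm ?_ hρ (by positivity) hβ ?_ ht htT
  · have h0 := hν 0
    simp only [intervalIntegral.integral_same, smul_zero, sub_zero] at h0
    simp only [hdd]
    rw [h0, hw0, sub_self, norm_zero]
  · intro t ht htT hle
    have h1 : ‖∫ τ in (0 : ℝ)..t, (propSymbol (-τ)).op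
        (cubicHat (ν τ) - cubicHat ((propSymbol τ).op (w τ)))‖ ≤
        ∫ τ in (0 : ℝ)..t, algSq s * (2 * b + β) ^ 2 * ‖d τ‖ := by
      refine intervalIntegral.norm_integral_le_of_norm_le ht (ae_of_all _ fun τ hτ => ?_)
        ((continuous_const.mul hdc.norm).intervalIntegrable 0 t)
      rw [norm_propSymbol_op]
      refine (norm_cubicHat_sub_le _ _).trans ?_
      have h2 : ‖ν τ - (propSymbol τ).op (w τ)‖ = ‖d τ‖ := (norm_interaction_sub τ _ _).symm
      have h3 : ‖(propSymbol τ).op (w τ)‖ ≤ b := by rw [norm_propSymbol_op]; exact hb τ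
      -- The bootstrap hypothesis keeps the wave solution within `β` of the transported Szegő
      -- solution; this fixes the Lipschitz constant `A (2b + β)²`.
      have h4 : ‖ν τ‖ ≤ b + β := by
        calc ‖ν τ‖ = ‖(propSymbol τ).op (w τ) + (ν τ - (propSymbol τ).op (w τ))‖ := by
              rw [add_sub_cancel]
          _ ≤ b + β := (norm_add_le _ _).trans
              (add_le_add h3 (by rw [h2]; exact hle τ hτ.1.le hτ.2))
      rw [h2]
      have h6 : ‖ν τ‖ + ‖(propSymbol τ).op (w τ)‖ ≤ 2 * b + β := by linarith
      exact mul_le_mul_of_nonneg_right (mul_le_mul_of_nonneg_left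
        (pow_le_pow_left₀ (by positivity) h6 2) hA) (norm_nonneg _)
    rw [intervalIntegral.integral_const_mul] at h1
    have h5 : d t = _ := interaction_diff hκ hνc hwc hw0 hν hd hw t
    rw [h5]
    refine (norm_sub_le _ _).trans ?_
    rw [norm_neg, norm_smul, norm_smul, Complex.norm_I, one_mul, one_mul]
    linarith [hR t ht htT]

/-- The bound on the oscillating part, in terms of the sizes `m` and `b` of the solution of the
Szegő equation in `H^{1/2}` and `H^s`. -/
theorem norm_osc_szego_le {κ r m b : ℝ} (hκ : 0 < κ) (hκr : κ ≤ r)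
    (hwt : ∀ ξ, |ξ| ≤ r → wt s ξ ≤ 2) (hm : 0 ≤ m) {w : ℝ → HsHat s}
    (hd : ∀ t, HasDerivAt w (-(Complex.I • szegoSymbol.op (cubicHat (w t)))) t)
    (hE : ∀ t, energy (1 / 2) (w t) ≤ ENNReal.ofReal (m ^ 2)) (hb : ∀ t, ‖w t‖ ≤ b)
    {t : ℝ} (ht : 0 ≤ t) :
    ‖∫ τ in (0 : ℝ)..t, ((oscLow κ τ).op (cubicHat (w τ)) + (oscHigh κ τ).op (cubicHat (w τ)))‖ ≤
      t * (Real.sqrt (2 * κ) * (supConst * m ^ 3)) +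
        2 * (supConst * m ^ 3 / Real.sqrt κ + algSq s * b ^ 3 / r) +
        t * (3 * (supConst ^ 2 * m ^ 5) / Real.sqrt κ + 3 * (algSq s ^ 2 * b ^ 5) / r) := by
  have hD := one_le_supConst
  have hA : 0 ≤ algSq s := algSq_nonneg
  have hb0 : 0 ≤ b := (norm_nonneg _).trans (hb 0)
  have hwc : Continuous w := continuous_iff_continuousAt.2 fun t => (hd t).continuousAt
  set w' : ℝ → HsHat s := fun t => -(Complex.I • szegoSymbol.op (cubicHat (w t))) with hw'
  have hw'c : Continuous w' :=
    ((szegoSymbol.op.continuous.comp (continuous_cubicHat hwc)).const_smul Complex.I).neg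
  have hgN : ∀ τ, ‖cubicHat (w τ)‖ ≤ algSq s * b ^ 3 := fun τ =>
    (norm_cubicHat_le _).trans (by gcongr; exact hb τ)
  have hw'N : ∀ τ, ‖w' τ‖ ≤ algSq s * b ^ 3 := fun τ => by
    rw [hw', norm_neg, norm_smul, Complex.norm_I, one_mul]
    exact (norm_szegoSymbol_op_le _).trans (hgN τ)
  have hw'E : ∀ τ, energy 0 (w' τ) ≤ ENNReal.ofReal ((supConst * m ^ 3) ^ 2) := fun τ => by
    have h1 : w' τ = (-Complex.I) • szegoSymbol.op (cubicHat (w τ)) := (neg_smul _ _).symm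
    rw [h1]
    refine (energy_le_of_norm_le ?_).trans
      ((energy_szegoSymbol_op_le 0 _).trans (energy_zero_cubicHat_le (hE τ)))
    filter_upwards [HsHat.coe_smul (-Complex.I) (szegoSymbol.op (cubicHat (w τ)))] with ξ h2
    rw [h2]
    simp
  -- Applied with `S = D m³`, `S' = 3 D² m⁵` from the `H^{1/2}` bounds (`D` is `supConst`), and `N =
  -- A b³`, `N' = 3 A² b⁵` from the algebra property (`A` is `algSq s`).
  refine norm_integral_osc_le (g' := fun τ => cubicDeriv (w τ) (w' τ)) hκ hκr (by positivity)
    (by positivity) hwt (fun τ => hasDerivAt_cubicHat (hd τ)) (continuous_cubicDeriv hwc hw'c)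
    (fun τ => ae_norm_cubicHat_le hm (hE τ)) (fun τ => ?_) hgN (fun τ => ?_) ht
  · refine (ae_norm_cubicDeriv_le (by positivity) (hE τ) (hw'E τ)).mono fun ξ h => h.trans (le_of_eq ?_)
    ring
  · refine (norm_cubicDeriv_le _ _).trans ?_
    calc 3 * algSq s * (‖w τ‖ ^ 2 * ‖w' τ‖) ≤ 3 * algSq s * (b ^ 2 * (algSq s * b ^ 3)) := by
          gcongr
          · exact hb τ
          · exact hw'N τ
      _ = _ := by ring

/-- The radius may depend on `s`, since it enters only terms absorbed by the smallness of `ε`; in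
exchange the low-frequency bounds no longer depend on `s`. -/
theorem exists_wt_le_two (s : ℝ) : ∃ r : ℝ, 0 < r ∧ ∀ ξ, |ξ| ≤ r → wt s ξ ≤ 2 := by
  have hc : Continuous fun ξ : ℝ => (1 + (2 * Real.pi * ξ) ^ 2) ^ s :=
    Continuous.rpow_const (by fun_prop) fun ξ => Or.inl (jap_pos ξ).ne'
  have h1 : ∀ᶠ ξ in 𝓝 (0 : ℝ), (1 + (2 * Real.pi * ξ) ^ 2) ^ s < 2 :=
    hc.continuousAt.eventually_lt continuousAt_const (by simp)
  obtain ⟨r, hr, h2⟩ := Metric.eventually_nhds_iff.1 h1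
  refine ⟨r / 2, by positivity, fun ξ hξ => ?_⟩
  have h3 := h2 (y := ξ) (by rw [Real.dist_eq, sub_zero]; linarith)
  rw [wt]
  exact (ENNReal.ofReal_le_ofReal h3.le).trans (by simp)

/-- The smallness conditions on `ε`. -/
theorem exists_small (K₁ K₂ K₃ r : ℝ) (hr : 0 < r) : ∃ ε₀ : ℝ, 0 < ε₀ ∧ ε₀ ≤ 1 ∧ ∀ ε, 0 < ε →
    ε < ε₀ → K₁ * (ε * (1 + Real.log (1 / ε)) ^ 6) ≤ 1 ∧ K₂ * (ε * (1 + Real.log (1 / ε)) ^ 6) ≤ 1 ∧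
      K₃ * ε ^ (1 / 4 : ℝ) < 1 ∧ ε ^ 2 ≤ r := by
  -- From `log x ≤ 12 x^{1/12}`: the sixth power of the logarithm costs at most `13⁶ ε^{-1/2}`. The
  -- power `6` is one from `t ε²` and five from `(L^α)⁵` in `osc_bound_le`.
  have hbd : ∀ ε : ℝ, 0 < ε → ε < 1 →
      ε * (1 + Real.log (1 / ε)) ^ 6 ≤ 13 ^ 6 * ε ^ (1 / 2 : ℝ) := fun ε h0 h1 => by
    have hx : 1 ≤ 1 / ε := by rw [le_div_iff₀ h0]; linarith
    have h2 := Real.log_le_rpow_div (x := 1 / ε) (ε := 1 / 12) (by positivity) (by norm_num)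
    have h3 : 1 ≤ (1 / ε) ^ (1 / 12 : ℝ) := Real.one_le_rpow hx (by norm_num)
    have h4 : 1 + Real.log (1 / ε) ≤ 13 * (1 / ε) ^ (1 / 12 : ℝ) := by
      have : (1 / ε) ^ (1 / 12 : ℝ) / (1 / 12) = 12 * (1 / ε) ^ (1 / 12 : ℝ) := by ring
      linarith
    have h5 : 0 ≤ Real.log (1 / ε) := Real.log_nonneg hx
    calc ε * (1 + Real.log (1 / ε)) ^ 6 ≤ ε * (13 * (1 / ε) ^ (1 / 12 : ℝ)) ^ 6 := by gcongr
      _ = 13 ^ 6 * (ε * ((1 / ε) ^ (1 / 12 : ℝ)) ^ (6 : ℕ)) := by ring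
      _ = _ := by
        rw [← Real.rpow_natCast ((1 / ε) ^ (1 / 12 : ℝ)), ← Real.rpow_mul (by positivity), one_div ε, Real.inv_rpow h0.le,
          ← Real.rpow_neg h0.le]
        nth_rewrite 1 [← Real.rpow_one ε]
        rw [← Real.rpow_add h0]
        norm_num
  have ht : ∀ p : ℝ, 0 < p → Tendsto (fun ε : ℝ => ε ^ p) (𝓝 0) (𝓝 0) := fun p hp => by
    have := (Real.continuous_rpow_const (q := p) hp.le).tendsto 0
    rwa [Real.zero_rpow hp.ne'] at this
  have ht' : ∀ K p : ℝ, 0 < p → ∀ᶠ ε in 𝓝 (0 : ℝ), K * ε ^ p < 1 := fun K p hp => by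
    have := (ht p hp).const_mul K
    rw [mul_zero] at this
    exact this.eventually_lt_const one_pos
  have hev : ∀ᶠ ε in 𝓝 (0 : ℝ), (|K₁| * 13 ^ 6) * ε ^ (1 / 2 : ℝ) < 1 ∧
      (|K₂| * 13 ^ 6) * ε ^ (1 / 2 : ℝ) < 1 ∧ K₃ * ε ^ (1 / 4 : ℝ) < 1 ∧ ε ^ 2 < r := by
    refine (ht' _ _ (by norm_num)).and ((ht' _ _ (by norm_num)).and ((ht' _ _ (by norm_num)).and ?_))
    exact (continuous_pow 2).continuousAt.eventually_lt continuousAt_const (by simpa using hr)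
  obtain ⟨e, he, h⟩ := Metric.eventually_nhds_iff.1 hev
  refine ⟨min e 1, lt_min he one_pos, min_le_right _ _, fun ε h0 h1 => ?_⟩
  obtain ⟨a1, a2, a3, a4⟩ := h (y := ε) (by
    rw [Real.dist_eq, sub_zero, abs_of_pos h0]; exact h1.trans_le (min_le_left _ _))
  have hε1 : ε < 1 := h1.trans_le (min_le_right _ _)
  have hx : 1 ≤ 1 / ε := by rw [le_div_iff₀ h0]; linarith
  have hlog : 0 ≤ Real.log (1 / ε) := Real.log_nonneg hx
  have hgen : ∀ K : ℝ, |K| * 13 ^ 6 * ε ^ (1 / 2 : ℝ) < 1 →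
      K * (ε * (1 + Real.log (1 / ε)) ^ 6) ≤ 1 := fun K hK => by
    calc K * (ε * (1 + Real.log (1 / ε)) ^ 6) ≤ |K| * (ε * (1 + Real.log (1 / ε)) ^ 6) := by
          gcongr; exact le_abs_self K
      _ ≤ |K| * (13 ^ 6 * ε ^ (1 / 2 : ℝ)) :=
          mul_le_mul_of_nonneg_left (hbd ε h0 hε1) (abs_nonneg K)
      _ ≤ 1 := by linarith
  exact ⟨hgen K₁ a1, hgen K₂ a2, a3, a4.le⟩

end

section

/-! ### The approximation theorem -/

theorem rpow_le_one_add {L p : ℝ} (hL : 0 < L) (hp : 0 ≤ p) (hp1 : p ≤ 1) : L ^ p ≤ 1 + L := by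
  rcases le_total L 1 with h | h
  · linarith [Real.rpow_le_one hL.le h hp]
  · have := Real.rpow_le_rpow_of_exponent_le h hp1
    rw [Real.rpow_one] at this
    linarith

/-- The part of the constant in the error bound which comes from low frequencies. -/
def errConst (M : ℝ) : ℝ := 32 * supConst * |M| ^ 3 + 96 * supConst ^ 2 * |M| ^ 5 + 1

theorem errConst_pos (M : ℝ) : 0 < errConst M := by
  have := one_le_supConst
  unfold errConst
  positivity

variable {s : ℝ} [hs : Fact (1 / 2 < s)]

/-- The numerical estimate of the bound of `norm_osc_szego_le`. -/
theorem osc_bound_le {A C M r ε L α t : ℝ} (hA : 0 ≤ A) (hC : 0 < C) (hM : 0 ≤ M) (hr : 0 < r)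
    (hε : 0 < ε) (hL : 0 < L) (hLε : L ≤ Real.log (1 / ε)) (hα : 0 ≤ α)
    (hα' : α ≤ 1 / 2) (ht : 0 ≤ t) (htT : t * ε ^ 2 ≤ L ^ (1 - 2 * α))
    (hsmall : (2 * A * C ^ 3 + 3 * A ^ 2 * C ^ 5) / r * (ε * (1 + Real.log (1 / ε)) ^ 6) ≤ 1) :
    t * (Real.sqrt (2 * ε ^ 2) * (supConst * (2 * ε * M) ^ 3)) +
        2 * (supConst * (2 * ε * M) ^ 3 / Real.sqrt (ε ^ 2) + A * (C * ε * L ^ α) ^ 3 / r) +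
        t * (3 * (supConst ^ 2 * (2 * ε * M) ^ 5) / Real.sqrt (ε ^ 2) +
          3 * (A ^ 2 * (C * ε * L ^ α) ^ 5) / r) ≤ errConst M * ε ^ 2 * (1 + L) := by
  have hD := one_le_supConst
  have hΘ : t * ε ^ 2 ≤ 1 + L := htT.trans (rpow_le_one_add hL (by linarith) (by linarith))
  have hLα : L ^ α ≤ 1 + L := rpow_le_one_add hL hα (by linarith)
  have hLα0 : 0 ≤ L ^ α := by positivity
  have hsqrt : Real.sqrt (2 * ε ^ 2) ≤ 2 * ε :=
    Real.sqrt_le_iff.2 ⟨by positivity, by nlinarith [sq_nonneg ε]⟩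
  rw [Real.sqrt_sq hε.le]
  set Λ := 1 + Real.log (1 / ε) with hΛ
  have hLΛ : 1 + L ≤ Λ := by linarith
  have h1 : t * (Real.sqrt (2 * ε ^ 2) * (supConst * (2 * ε * M) ^ 3)) ≤
      16 * supConst * M ^ 3 * ε ^ 2 * (1 + L) := by
    calc t * (Real.sqrt (2 * ε ^ 2) * (supConst * (2 * ε * M) ^ 3))
        ≤ t * (2 * ε * (supConst * (2 * ε * M) ^ 3)) := by gcongr
      _ = 16 * supConst * M ^ 3 * ε ^ 2 * (t * ε ^ 2) := by ring
      _ ≤ _ := by gcongr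
  have h2 : 2 * (supConst * (2 * ε * M) ^ 3 / ε) ≤ 16 * supConst * M ^ 3 * ε ^ 2 * (1 + L) := by
    calc 2 * (supConst * (2 * ε * M) ^ 3 / ε) = 16 * supConst * M ^ 3 * ε ^ 2 * 1 := by
          field_simp; ring
      _ ≤ _ := by gcongr; linarith
  have h3 : t * (3 * (supConst ^ 2 * (2 * ε * M) ^ 5) / ε) ≤
      96 * supConst ^ 2 * M ^ 5 * ε ^ 2 * (1 + L) := by
    calc t * (3 * (supConst ^ 2 * (2 * ε * M) ^ 5) / ε) =
          96 * supConst ^ 2 * M ^ 5 * ε ^ 2 * (t * ε ^ 2) := by field_simp; ring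
      _ ≤ _ := by gcongr
  have hΛ1 : 1 ≤ Λ := by linarith
  have hΛ0 : 0 ≤ Λ := by linarith
  have h4 : 2 * (A * (C * ε * L ^ α) ^ 3 / r) ≤ 2 * A * C ^ 3 / r * ε ^ 3 * Λ ^ 6 := by
    calc 2 * (A * (C * ε * L ^ α) ^ 3 / r) = 2 * A * C ^ 3 / r * ε ^ 3 * (L ^ α) ^ 3 := by ring
      _ ≤ 2 * A * C ^ 3 / r * ε ^ 3 * Λ ^ 3 := by gcongr; exact hLα.trans hLΛ
      _ ≤ _ := by gcongr; norm_num
  have h5 : t * (3 * (A ^ 2 * (C * ε * L ^ α) ^ 5) / r) ≤ 3 * A ^ 2 * C ^ 5 / r * ε ^ 3 * Λ ^ 6 := by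
    calc t * (3 * (A ^ 2 * (C * ε * L ^ α) ^ 5) / r) =
          3 * A ^ 2 * C ^ 5 / r * ε ^ 3 * ((t * ε ^ 2) * (L ^ α) ^ 5) := by ring
      _ ≤ 3 * A ^ 2 * C ^ 5 / r * ε ^ 3 * (Λ * Λ ^ 5) := by
          gcongr
          · exact hΘ.trans hLΛ
          · exact hLα.trans hLΛ
      _ = _ := by ring
  -- The `H^s` terms carry an extra factor `ε` up to logarithms, so smallness absorbs all their
  -- dependence on `s` and `C`; they account for the `+ 1` in `errConst`.
  have h6 : 2 * A * C ^ 3 / r * ε ^ 3 * Λ ^ 6 + 3 * A ^ 2 * C ^ 5 / r * ε ^ 3 * Λ ^ 6 ≤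
      ε ^ 2 * (1 + L) := by
    calc _ = ε ^ 2 * ((2 * A * C ^ 3 + 3 * A ^ 2 * C ^ 5) / r * (ε * Λ ^ 6)) := by ring
      _ ≤ ε ^ 2 * 1 := by gcongr
      _ ≤ _ := by gcongr; linarith
  rw [errConst, abs_of_nonneg hM]
  linarith

/-- The numerical estimate of the exponential growth. -/
theorem growth_exponent_le {A C ε L α : ℝ} (hA : 0 ≤ A) (hC : 0 < C) (hε : 0 < ε)
    (hL : 0 < L) (hLε : L ≤ Real.log (1 / ε)) (hα : 0 ≤ α) (hα' : α ≤ 1 / 2)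
    (hsmall : 2 * A * (ε * (1 + Real.log (1 / ε)) ^ 6) ≤ 1) :
    A * (2 * (C * ε * L ^ α) + ε * Real.sqrt ε) ^ 2 * (1 / ε ^ 2 * L ^ (1 - 2 * α)) ≤
      8 * A * C ^ 2 * L + 1 := by
  have hLα0 : 0 ≤ L ^ α := by positivity
  have hΘ0 : 0 ≤ L ^ (1 - 2 * α) := by positivity
  have hΘ : L ^ (1 - 2 * α) ≤ 1 + L := rpow_le_one_add hL (by linarith) (by linarith)
  -- This cancellation of `α` dictates the time scale: growth of the squared norm times length of
  -- the interval is exactly `L`.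
  have hmul : (L ^ α) ^ 2 * L ^ (1 - 2 * α) = L := by
    rw [← Real.rpow_natCast, ← Real.rpow_mul hL.le, ← Real.rpow_add hL]
    have : α * ((2 : ℕ) : ℝ) + (1 - 2 * α) = 1 := by push_cast; ring
    rw [this, Real.rpow_one]
  have hsq : (2 * (C * ε * L ^ α) + ε * Real.sqrt ε) ^ 2 ≤
      8 * (C * ε * L ^ α) ^ 2 + 2 * ε ^ 3 := by
    have h1 : (ε * Real.sqrt ε) ^ 2 = ε ^ 3 := by
      rw [mul_pow, Real.sq_sqrt hε.le]; ring
    nlinarith [sq_nonneg (2 * (C * ε * L ^ α) - ε * Real.sqrt ε)]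
  set Λ := 1 + Real.log (1 / ε) with hΛ
  have hΛ1 : 1 ≤ Λ := by linarith
  have hΛ6 : Λ ≤ Λ ^ 6 := le_self_pow₀ hΛ1 (by norm_num)
  calc A * (2 * (C * ε * L ^ α) + ε * Real.sqrt ε) ^ 2 * (1 / ε ^ 2 * L ^ (1 - 2 * α))
      ≤ A * (8 * (C * ε * L ^ α) ^ 2 + 2 * ε ^ 3) * (1 / ε ^ 2 * L ^ (1 - 2 * α)) := by gcongr
    _ = 8 * A * C ^ 2 * ((L ^ α) ^ 2 * L ^ (1 - 2 * α)) + 2 * A * (ε * L ^ (1 - 2 * α)) := by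
        field_simp
    _ ≤ 8 * A * C ^ 2 * L + 2 * A * (ε * Λ ^ 6) := by
        rw [hmul]
        gcongr
        linarith
    _ ≤ _ := by linarith

theorem norm_interaction_diff_le_of_small {C M r ε L α : ℝ} (hC : 0 < C) (hM : 0 ≤ M) (hr : 0 < r)
    (hwt : ∀ ξ, |ξ| ≤ r → wt s ξ ≤ 2) (hε : 0 < ε) (hL : 0 < L)
    (hLε : L ≤ Real.log (1 / ε)) (hα : 0 ≤ α) (hα' : α ≤ 1 / 2)
    (hsmall₁ : (2 * algSq s * C ^ 3 + 3 * algSq s ^ 2 * C ^ 5) / r *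
      (ε * (1 + Real.log (1 / ε)) ^ 6) ≤ 1)
    (hsmall₂ : 2 * algSq s * (ε * (1 + Real.log (1 / ε)) ^ 6) ≤ 1) (hεr : ε ^ 2 ≤ r)
    (hβ : errConst M * Real.exp 1 * ε ^ 2 * Real.exp ((8 * algSq s * C ^ 2 + 1) * L) <
      ε * Real.sqrt ε)
    {w₀ : HsHat s} {ν w : ℝ → HsHat s} (hνc : Continuous ν) (hwc : Continuous w) (hw0 : w 0 = w₀)
    (hν : ∀ t, (propSymbol (-t)).op (ν t) =
      w₀ - Complex.I • ∫ τ in (0 : ℝ)..t, (propSymbol (-τ)).op (cubicHat (ν τ)))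
    (hd : ∀ t, HasDerivAt w (-(Complex.I • szegoSymbol.op (cubicHat (w t)))) t)
    (hw : ∀ t, ∀ᵐ ξ : ℝ, ξ < 0 → w t ξ = 0)
    (hE : energy (1 / 2) w₀ ≤ ENNReal.ofReal ((ε * M) ^ 2))
    (hb : ∀ t, ‖w t‖ ≤ C * ε * L ^ α) {t : ℝ} (ht : 0 ≤ t)
    (htT : t ≤ 1 / ε ^ 2 * L ^ (1 - 2 * α)) :
    ‖(propSymbol (-t)).op (ν t) - w t‖ ≤
      errConst M * Real.exp 1 * ε ^ 2 * Real.exp ((8 * algSq s * C ^ 2 + 1) * L) := by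
  have hA : 0 ≤ algSq s := algSq_nonneg
  have herr := errConst_pos M
  -- The factor `2` lost by `energy_half_le` on squares is majorised by `4`, whence the size `m =
  -- 2εM`.
  have hE' : ∀ t, energy (1 / 2) (w t) ≤ ENNReal.ofReal ((2 * ε * M) ^ 2) := fun t => by
    refine (energy_half_le hw hd t).trans ?_
    rw [hw0]
    calc 2 * energy (1 / 2) w₀ ≤ ENNReal.ofReal 2 * ENNReal.ofReal ((ε * M) ^ 2) := by
          gcongr; simp
      _ = ENNReal.ofReal (2 * (ε * M) ^ 2) := (ENNReal.ofReal_mul (by norm_num)).symm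
      _ ≤ _ := ENNReal.ofReal_le_ofReal (by nlinarith [sq_nonneg (ε * M)])
  have hR : ∀ t, 0 ≤ t → t ≤ 1 / ε ^ 2 * L ^ (1 - 2 * α) → ‖∫ τ in (0 : ℝ)..t,
      ((oscLow (ε ^ 2) τ).op (cubicHat (w τ)) + (oscHigh (ε ^ 2) τ).op (cubicHat (w τ)))‖ ≤
        errConst M * ε ^ 2 * (1 + L) := fun t ht htT => by
    refine (norm_osc_szego_le (by positivity) hεr hwt (by positivity) hd hE' hb ht).trans ?_
    refine osc_bound_le hA hC hM hr hε hL hLε hα hα' ht ?_ hsmall₁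
    calc t * ε ^ 2 ≤ 1 / ε ^ 2 * L ^ (1 - 2 * α) * ε ^ 2 := by gcongr
      _ = _ := by field_simp
  -- The polynomial loss is absorbed by `1 + L ≤ e^L`, which explains the `+ 1` in the exponent `8 A
  -- C² + 1`. The factor `e` comes from the contribution of `β = ε^{3/2}` to the growth exponent.
  have hle : errConst M * ε ^ 2 * (1 + L) * Real.exp (algSq s *
      (2 * (C * ε * L ^ α) + ε * Real.sqrt ε) ^ 2 * (1 / ε ^ 2 * L ^ (1 - 2 * α))) ≤
      errConst M * Real.exp 1 * ε ^ 2 * Real.exp ((8 * algSq s * C ^ 2 + 1) * L) := by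
    calc _ ≤ errConst M * ε ^ 2 * Real.exp L * Real.exp (8 * algSq s * C ^ 2 * L + 1) := by
          gcongr
          · linarith [Real.add_one_le_exp L]
          · exact growth_exponent_le hA hC hε hL hLε hα hα' hsmall₂
      _ = errConst M * ε ^ 2 * (Real.exp L * Real.exp (8 * algSq s * C ^ 2 * L + 1)) := by ring
      _ = errConst M * ε ^ 2 * (Real.exp 1 * Real.exp ((8 * algSq s * C ^ 2 + 1) * L)) := by
          rw [← Real.exp_add, ← Real.exp_add]
          ring_nf
      _ = _ := by ring
  exact (norm_interaction_diff_le (by positivity) hνc hwc hw0 hν hd hw hb (by positivity) hR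
    (hle.trans_lt hβ) ht htT).trans hle

end

end NLWSzego

end

/-! ### Choice of the constants and translation to the Fourier side. -/

theorem theorem1p2 :
    ∃ Cstar : ℝ → ℝ, (∀ M, 0 < Cstar M) ∧
      ∀ s : ℝ, 1 / 2 < s → ∀ C : ℝ, 0 < C →
        ∃ C₀ : ℝ, 0 < C₀ ∧ ∃ δ₀ : ℝ, 0 < δ₀ ∧
          ∀ M : ℝ, 0 ≤ M → ∃ ε₀ : ℝ, 0 < ε₀ ∧
            ∀ δ : ℝ, 0 < δ → δ < δ₀ → ∀ α : ℝ, 0 ≤ α → α ≤ 1 / 2 →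
            ∀ ε : ℝ, 0 < ε → ε < ε₀ →
            ∀ W₀ : NLWSzego.L2, NLWSzego.MemHsPlus s W₀ →
              NLWSzego.hsNorm (1 / 2) W₀ ≤ ENNReal.ofReal M →
            ∀ v W : ℝ → NLWSzego.L2,
              NLWSzego.IsNLWSolution s ((ε : ℂ) • W₀) v →
              NLWSzego.IsSzegoSolution s ((ε : ℂ) • W₀) W →
              (∀ t : ℝ, NLWSzego.hsNorm s (W t) ≤
                ENNReal.ofReal (C * ε * Real.log (1 / ε ^ δ) ^ α)) →
              ∀ t : ℝ, 0 ≤ t → t ≤ 1 / ε ^ 2 * Real.log (1 / ε ^ δ) ^ (1 - 2 * α) →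
                NLWSzego.hsNorm s (v t - NLWSzego.propagator t (W t)) ≤
                  ENNReal.ofReal (Cstar M * ε ^ (2 - C₀ * δ)) := by
  open NLWSzego in
  refine ⟨fun M => errConst M * Real.exp 1, fun M => mul_pos (errConst_pos M) (Real.exp_pos 1),
    fun s hs C hC => ?_⟩
  have : Fact (1 / 2 < s) := ⟨hs⟩
  have hA : 0 ≤ algSq s := algSq_nonneg
  set C₀ : ℝ := 8 * algSq s * C ^ 2 + 1 with hC₀
  have hC₀1 : 1 ≤ C₀ := by
    have : 0 ≤ 8 * algSq s * C ^ 2 := by positivity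
    linarith
  -- `δ₀ = 1/(4C₀)` guarantees `2 - C₀δ ≥ 7/4`, leaving a power `ε^{1/4}` of room below the
  -- bootstrap threshold `ε^{3/2}`.
  refine ⟨C₀, by linarith, 1 / (4 * C₀), by positivity, fun M hM => ?_⟩
  obtain ⟨r, hr, hwt⟩ := exists_wt_le_two s
  obtain ⟨ε₀, hε₀, hε₀1, hsmall⟩ := exists_small
    ((2 * algSq s * C ^ 3 + 3 * algSq s ^ 2 * C ^ 5) / r) (2 * algSq s)
    (errConst M * Real.exp 1) r hr
  refine ⟨ε₀, hε₀, fun δ hδ hδ₀ α hα hα' ε hε hεε₀ W₀ hW₀ hW₀M v W hv hW hWb t ht htT => ?_⟩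
  obtain ⟨hs1, hs2, hs3, hs4⟩ := hsmall ε hε hεε₀
  have hε1 : ε < 1 := hεε₀.trans_le hε₀1
  have hlog : Real.log (1 / ε ^ δ) = δ * Real.log (1 / ε) := by
    rw [one_div, one_div, ← Real.inv_rpow hε.le, Real.log_rpow (inv_pos.2 hε)]
  have hlog0 : 0 < Real.log (1 / ε) := Real.log_pos (by rw [lt_div_iff₀ hε]; linarith)
  have hδC : C₀ * δ ≤ 1 / 4 := by
    rw [lt_div_iff₀ (by positivity)] at hδ₀
    linarith
  have hδ1 : δ ≤ 1 := by nlinarith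
  set L := Real.log (1 / ε ^ δ) with hLdef
  have hL : 0 < L := by rw [hlog]; positivity
  have hLε : L ≤ Real.log (1 / ε) := by rw [hlog]; nlinarith
  -- The exponential Grönwall growth becomes the power loss, since `L = δ log(1/ε)`.
  have hexp : Real.exp (C₀ * L) = ε ^ (-(C₀ * δ)) := by
    rw [Real.rpow_def_of_pos hε, hlog, one_div, Real.log_inv]
    ring_nf
  have hfin : errConst M * Real.exp 1 * ε ^ 2 * Real.exp (C₀ * L) =
      errConst M * Real.exp 1 * ε ^ (2 - C₀ * δ) := by
    rw [hexp, mul_assoc, ← Real.rpow_natCast ε 2, ← Real.rpow_add hε]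
    congr 2
  have herr := errConst_pos M
  -- This is the step that makes `ε₀` depend on `M`: the spare factor `ε^{1/4}` must beat `errConst
  -- M * e`.
  have hβ : errConst M * Real.exp 1 * ε ^ 2 * Real.exp (C₀ * L) < ε * Real.sqrt ε := by
    rw [hfin]
    have h1 : ε ^ (2 - C₀ * δ) ≤ ε ^ (1 / 4 + 3 / 2 : ℝ) :=
      Real.rpow_le_rpow_of_exponent_ge hε hε1.le (by linarith)
    have h2 : ε ^ (3 / 2 : ℝ) = ε * Real.sqrt ε := by
      rw [Real.sqrt_eq_rpow]
      nth_rewrite 2 [← Real.rpow_one ε]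
      rw [← Real.rpow_add hε]
      norm_num
    have h3 : 0 < ε ^ (3 / 2 : ℝ) := by positivity
    rw [Real.rpow_add hε] at h1
    rw [← h2]
    calc errConst M * Real.exp 1 * ε ^ (2 - C₀ * δ)
        ≤ errConst M * Real.exp 1 * (ε ^ (1 / 4 : ℝ) * ε ^ (3 / 2 : ℝ)) := by gcongr
      _ = (errConst M * Real.exp 1 * ε ^ (1 / 4 : ℝ)) * ε ^ (3 / 2 : ℝ) := by ring
      _ < 1 * ε ^ (3 / 2 : ℝ) := by gcongr
      _ = _ := one_mul _
  obtain ⟨a₀, ha₀⟩ := exists_invFourier_eq hW₀.1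
  obtain ⟨ν, hνc, hν⟩ := hv.continuousHs.exists_lift
  obtain ⟨w, hwc, hw⟩ := hW.continuousHs.exists_lift
  have hinit : invFourier ((ε : ℂ) • a₀) = (ε : ℂ) • W₀ := by rw [map_smul, ha₀]
  have hw0 : w 0 = (ε : ℂ) • a₀ := invFourier_injective (by rw [hw, hW.initial, hinit])
  rw [← hinit] at hv
  have hE : energy (1 / 2) ((ε : ℂ) • a₀ : HsHat s) ≤ ENNReal.ofReal ((ε * M) ^ 2) := by
    have h1 : energy (1 / 2) a₀ ≤ ENNReal.ofReal (M ^ 2) := by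
      rw [← ha₀, hsNorm_invFourier_energy] at hW₀M
      rw [ENNReal.ofReal_pow hM]
      calc energy (1 / 2) a₀ = (energy (1 / 2) a₀ ^ (1 / 2 : ℝ)) ^ 2 := by
            rw [← ENNReal.rpow_natCast, ← ENNReal.rpow_mul]; norm_num
        _ ≤ _ := by gcongr
    rw [energy_congr (HsHat.coe_smul (ε : ℂ) a₀), mul_pow, ENNReal.ofReal_mul (by positivity)]
    refine (energy_mul_le (K := ε) (Eventually.of_forall fun _ => ?_)).trans (by gcongr)
    rw [Complex.norm_real, Real.norm_eq_abs, abs_of_pos hε]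
  have hb : ∀ t, ‖w t‖ ≤ C * ε * L ^ α := fun t => by
    have h1 := hWb t
    rw [← hw t, hsNorm_invFourier, ← ofReal_norm,
      ENNReal.ofReal_le_ofReal_iff (by positivity)] at h1
    exact h1
  have hwd := hW.hasDerivAt_lift hwc hw
  have hwsupp : ∀ t, ∀ᵐ ξ : ℝ, ξ < 0 → w t ξ = 0 := fun t =>
    ae_eq_zero_of_memHsPlus (by rw [hw t]; exact hW.memHsPlus t)
  have hmain := norm_interaction_diff_le_of_small hC hM hr hwt hε hL hLε hα hα' hs1 hs2 hs4
    hβ hνc hwc hw0 (hv.duhamel_lift hνc hν) hwd hwsupp hE hb ht htT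
  -- The propagator is an isometry of `H^s`, so the bound in the interaction picture is the bound on
  -- `v(t) - e^{-i|D|t} W(t)`.
  rw [norm_interaction_sub, hfin] at hmain
  rw [← hν t, ← hw t, propagator_invFourier, ← map_sub, hsNorm_invFourier, ← ofReal_norm]
  exact ENNReal.ofReal_le_ofReal hmain
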